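/- Let $\epsilon\in\{1,-1\}$, $n\ge 3$, and let $\mathbb{Q}_\epsilon^n$ be the unit sphere $\mathbb{S}^n$ ($\epsilon=1$) or hyperbolic space $\mathbb{H}^n$ ($\epsilon=-1$). Write $\tan_\epsilon=\tan$, $\tanh$ for $\epsilon=1,-1$ respectively. Let $\Sigma$ be a connected hypersurface smoothly immersed in $\mathbb{Q}_\epsilon^n\times\mathbb{R}$. Suppose that $\Sigma$ is symmetric, i.e. (locally) invariant under the isometries of $\mathbb{Q}_\epsilon^n$, acting trivially on $\mathbb{R}$, that preserve each member of a family of concentric geodesic spheres (elliptic case) or, if $\epsilon=-1$, of a parallel family of horospheres (parabolic case) or of the family of hypersurfaces equidistant to a totally geodesic hyperplane (hyperbolic case). Suppose that the induced metric of $\Sigma$ has constant sectional curvature $K$. Then $K\ge\epsilon$, and $\Sigma$ is (its image is) an open subset of one of the following hypersurfaces, each of which is properly embedded and has constant sectional curvature $K$. Given a parallel family $f_s(p)=\exp_{f(p)}(s\,\eta(p))$ of hypersurfaces of $\mathbb{Q}_\epsilon^n$ and a function $\rho$ with values in $[0,1)$, its graph with $\rho$-function $\rho$ is the set of the points $(f_s(p),\phi(s))$,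 where $\phi(s)=\int_{s_0}^s\rho/\sqrt{1-\rho^2}$. The hypersurfaces in (ii) and (iii) are meant up to vertical translations and reflections over horizontal hyperplanes. (i) ($K=\epsilon$) A horizontal hyperplane $\mathbb{Q}_\epsilon^n\times\{t\}$. (ii) ($K>\epsilon$) The rotational hypersurface determined by the family of geodesic spheres of radius $s$ centered at a point $o\in\mathbb{Q}_\epsilon^n$ and $\rho(s)=\sqrt{K-\epsilon}\,\tan_\epsilon(s)$, $s_0=0$. If $K\le 0$, it is the entire graph obtained for $s\in[0,\infty)$; if $K>0$, it is the sphere that is the union of the closure of the graph over $s\in[0,\delta)$, $\tan_\epsilon(\delta)=1/\sqrt{K-\epsilon}$ (with $0<\delta<\pi/2$ if $\epsilon=1$), and of the closure of its reflection over $\mathbb{Q}_\epsilon^n\times\{\phi(\delta)\}$. (iii) ($\epsilon=-1$, $K\in(-1,0)$) Either the entire graph with constant $\rho=\sqrt{K+1}$, $s\in\mathbb{R}$, over a parallel family of horospheres; or the union of the graph with $\rho(s)=\sqrt{K+1}\,\coth(s)$, $s\in[\lambda_0,\infty)$, $s_0=\lambda_0=\operatorname{arctanh}\sqrt{K+1}$,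 over the hypersurfaces at signed distance $s$ from a totally geodesic hyperplane of $\mathbb{H}^n$, and of its reflection over $\mathbb{H}^n\times\{0\}$. (iv) ($\epsilon=-1$, $K=0$) The flat vertical cylinder $\mathscr{H}\times\mathbb{R}$ over a horosphere $\mathscr{H}\subset\mathbb{H}^n$. -/

import Mathlib

open Set Filter Topology
open scoped Manifold ContDiff

noncomputable section

namespace ProductHypersurface

/-! ### The ambient space `Q_ε^n × ℝ`

`Q_ε^n`, for `ε = 1` or `ε = -1`, is realized in `ℝ^{n+1}` with the bilinear form
`ε x₀ y₀ + x₁ y₁ + ⋯ + xₙ yₙ`: the unit sphere for `ε = 1`, and one sheet of the two-sheeted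
hyperboloid (the hyperboloid model of hyperbolic space) for `ε = -1`. -/

/-- The linear space `ℝ^{n+1}` that contains the space form. -/
abbrev Vec (n : ℕ) : Type := Fin (n + 1) → ℝ

/-- The linear space `ℝ^{n+1} × ℝ` that contains the product `Q_ε^n × ℝ`. -/
abbrev Amb (n : ℕ) : Type := Vec n × ℝ

/-- The Euclidean (`ε = 1`) or Lorentzian (`ε = -1`) inner product of `ℝ^{n+1}`. -/
def form {n : ℕ} (ε : ℝ) (x y : Vec n) : ℝ :=
  ε * x 0 * y 0 + ∑ i : Fin n, x i.succ * y i.succ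

/-- The space form `Q_ε^n`. Its metric is the restriction of `form ε` to its tangent spaces. -/
def spaceForm (n : ℕ) (ε : ℝ) : Set (Vec n) :=
  {x | form ε x x = ε ∧ (ε = -1 → 0 < x 0)}

/-- The product `Q_ε^n × ℝ`. -/
def productSpace (n : ℕ) (ε : ℝ) : Set (Amb n) := spaceForm n ε ×ˢ univ

/-- The inner product that induces the product metric `⟨ , ⟩ + dt²` of `Q_ε^n × ℝ`. -/
def prodForm {n : ℕ} (ε : ℝ) (X Y : Amb n) : ℝ := form ε X.1 Y.1 + X.2 * Y.2

/-! ### Sectional curvature of a Riemannian metric in coordinates -/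

/-- The coordinate space `ℝ^n`. -/
abbrev Coord (n : ℕ) : Type := EuclideanSpace ℝ (Fin n)

/-- The partial derivative `∂ᵢ h`. -/
def pd {n : ℕ} (i : Fin n) (h : Coord n → ℝ) (x : Coord n) : ℝ :=
  fderiv ℝ h x (EuclideanSpace.single i (1 : ℝ))

/-- The Christoffel symbol
`Γᵏᵢⱼ = ½ ∑ₗ gᵏˡ (∂ᵢ gⱼₗ + ∂ⱼ gᵢₗ - ∂ₗ gᵢⱼ)` of a metric `g`. -/
def christoffel {n : ℕ} (g : Coord n → Matrix (Fin n) (Fin n) ℝ) (k i j : Fin n)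
    (x : Coord n) : ℝ :=
  (1 / 2 : ℝ) * ∑ l, (g x)⁻¹ k l *
    (pd i (fun y => g y j l) x + pd j (fun y => g y i l) x - pd l (fun y => g y i j) x)

/-- The component `Rˡᵢⱼₖ` of the curvature tensor, defined by `R(∂ᵢ, ∂ⱼ)∂ₖ = ∑ₗ Rˡᵢⱼₖ ∂ₗ` where
`R(X, Y)Z = ∇_X ∇_Y Z - ∇_Y ∇_X Z - ∇_[X,Y] Z`. -/
def riemann {n : ℕ} (g : Coord n → Matrix (Fin n) (Fin n) ℝ) (l i j k : Fin n)
    (x : Coord n) : ℝ :=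
  pd i (christoffel g l j k) x - pd j (christoffel g l i k) x
    + ∑ m, (christoffel g m j k x * christoffel g l i m x
      - christoffel g m i k x * christoffel g l j m x)

/-- The number `⟨R(u, v)w, z⟩`. -/
def curvatureForm {n : ℕ} (g : Coord n → Matrix (Fin n) (Fin n) ℝ) (x : Coord n)
    (u v w z : Fin n → ℝ) : ℝ :=
  ∑ i, ∑ j, ∑ k, ∑ l, ∑ m, u i * v j * w k * z m * riemann g l i j k x * g x l m

/-- The inner product `g_x(u, v)`. -/
def metricForm {n : ℕ} (g : Coord n → Matrix (Fin n) (Fin n) ℝ) (x : Coord n)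
    (u v : Fin n → ℝ) : ℝ :=
  ∑ i, ∑ j, u i * v j * g x i j

/-- The sectional curvature of the plane spanned by `u` and `v`. -/
def sectionalCurvature {n : ℕ} (g : Coord n → Matrix (Fin n) (Fin n) ℝ) (x : Coord n)
    (u v : Fin n → ℝ) : ℝ :=
  curvatureForm g x u v v u /
    (metricForm g x u u * metricForm g x v v - metricForm g x u v ^ 2)

/-- The first fundamental form of a parametrization `X` of a piece of a hypersurface of
`Q_ε^n × ℝ`. -/
def inducedMetric {n : ℕ} (ε : ℝ) (X : Coord n → Amb n) (x : Coord n) :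
    Matrix (Fin n) (Fin n) ℝ :=
  Matrix.of fun i j => prodForm ε (fderiv ℝ X x (EuclideanSpace.single i (1 : ℝ)))
    (fderiv ℝ X x (EuclideanSpace.single j (1 : ℝ)))

/-- All sectional curvatures of the parametrized hypersurface `X`, at all points of the open set
`U` of parameters, are equal to `K`. -/
def PatchHasCurvature {n : ℕ} (ε : ℝ) (X : Coord n → Amb n) (U : Set (Coord n)) (K : ℝ) : Prop :=
  ∀ x ∈ U, ∀ u v : Fin n → ℝ, LinearIndependent ℝ ![u, v] →
    sectionalCurvature (inducedMetric ε X) x u v = K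

/-! ### Hypersurfaces -/

/-- `f` immerses the `n`-manifold `S` smoothly into `Q_ε^n × ℝ`, as a hypersurface. -/
structure IsHypersurface {n : ℕ} (ε : ℝ) {S : Type*} [TopologicalSpace S]
    [ChartedSpace (Coord n) S] (f : S → Amb n) : Prop where
  mem : ∀ p, f p ∈ productSpace n ε
  smooth : ContMDiff (𝓡 n) 𝓘(ℝ, Amb n) ∞ f
  immersion : ∀ p, Function.Injective (mfderiv (𝓡 n) 𝓘(ℝ, Amb n) f p)

/-- The metric induced by the immersion `f` has constant sectional curvature `K`. -/
def HasConstantSectionalCurvature {n : ℕ} (ε : ℝ) {S : Type*} [TopologicalSpace S]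
    [ChartedSpace (Coord n) S] (f : S → Amb n) (K : ℝ) : Prop :=
  ∀ e ∈ IsManifold.maximalAtlas (𝓡 n) ∞ S, PatchHasCurvature ε (f ∘ e.symm) e.target K

/-- `P` is a properly embedded smooth hypersurface of `Q_ε^n × ℝ`: a closed subset that is,
locally in `Q_ε^n × ℝ`, the zero set of a smooth function whose differential does not vanish on
the tangent space of `Q_ε^n × ℝ`. -/
structure IsProperlyEmbeddedHypersurface {n : ℕ} (ε : ℝ) (P : Set (Amb n)) : Prop where
  subset : P ⊆ productSpace n ε
  closed : IsClosed P
  regular : ∀ q ∈ P, ∃ (W : Set (Amb n)) (F : Amb n → ℝ), IsOpen W ∧ q ∈ W ∧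
    ContDiffOn ℝ ∞ F W ∧ P ∩ W = {y ∈ productSpace n ε ∩ W | F y = 0} ∧
    ∃ w : Amb n, form ε q.1 w.1 = 0 ∧ fderiv ℝ F q w ≠ 0

/-- The hypersurface `P` of `Q_ε^n × ℝ` has constant sectional curvature `K`: this holds in every
regular smooth parametrization of a piece of `P`. -/
def SubsetHasConstantSectionalCurvature {n : ℕ} (ε : ℝ) (P : Set (Amb n)) (K : ℝ) : Prop :=
  ∀ (U : Set (Coord n)) (X : Coord n → Amb n), IsOpen U → ContDiffOn ℝ ∞ X U →
    (∀ x ∈ U, Function.Injective (fderiv ℝ X x)) → MapsTo X U P → PatchHasCurvature ε X U K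

/-! ### Symmetric hypersurfaces -/

/-- The vectors `v` that determine a parallel family of totally umbilical hypersurfaces of
`Q_ε^n`, namely the level sets in `Q_ε^n` of `x ↦ form ε x v`. These are
* the geodesic spheres with center `v` if `v ∈ Q_ε^n` (elliptic case);
* the horospheres with a common point at infinity, if `ε = -1` and `v` is a future-directed null
  vector (parabolic case);
* a totally geodesic hyperplane and its equidistant hypersurfaces, if `ε = -1` and `v` is a unit
  spacelike vector (hyperbolic case). -/
def IsAxis {n : ℕ} (ε : ℝ) (v : Vec n) : Prop :=
  v ∈ spaceForm n ε ∨ (ε = -1 ∧ form ε v v = 0 ∧ 0 < v 0) ∨ (ε = -1 ∧ form ε v v = 1)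

/-- The isometries of `Q_ε^n` that leave invariant each member of the parallel family determined
by `v`. (The isometries of `Q_ε^n` are the restrictions of the linear maps that preserve the form
and `Q_ε^n`.) -/
def symmetryGroup {n : ℕ} (ε : ℝ) (v : Vec n) : Set (Vec n →L[ℝ] Vec n) :=
  {A | (∀ x y, form ε (A x) (A y) = form ε x y) ∧ MapsTo A (spaceForm n ε) (spaceForm n ε) ∧
    A v = v}

/-- The immersed hypersurface `f` is symmetric: it is invariant under the elliptic, parabolic or
hyperbolic isometries of `Q_ε^n` determined by some parallel family, acting trivially on the
factor `ℝ`. Invariance is understood locally (every piece of the hypersurface around a point `p`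
contains the images of `f p` under all isometries of the family that are close to the identity), so
that open pieces of invariant hypersurfaces are symmetric as well. -/
def IsSymmetric {n : ℕ} (ε : ℝ) {S : Type*} [TopologicalSpace S] (f : S → Amb n) : Prop :=
  ∃ v : Vec n, IsAxis ε v ∧ ∀ p : S, ∀ U ∈ 𝓝 p,
    ∀ᶠ A in 𝓝[symmetryGroup ε v] (ContinuousLinearMap.id ℝ (Vec n)),
      (A (f p).1, (f p).2) ∈ f '' U

/-- An embedded hypersurface that is invariant under all isometries determined by a parallel
family is symmetric. -/
theorem isSymmetric_of_invariant {n : ℕ} (ε : ℝ) {S : Type*} [TopologicalSpace S] (f : S → Amb n)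
    (hf : IsEmbedding f) (v : Vec n) (hv : IsAxis ε v)
    (h : ∀ A ∈ symmetryGroup ε v, ∀ p, (A (f p).1, (f p).2) ∈ range f) : IsSymmetric ε f := by
  refine ⟨v, hv, fun p U hU => ?_⟩
  rw [hf.nhds_eq_comap, mem_comap] at hU
  obtain ⟨W, hW, hWU⟩ := hU
  have hc : Continuous fun A : Vec n →L[ℝ] Vec n => ((A (f p).1, (f p).2) : Amb n) := by fun_prop
  have h0 : ∀ᶠ A in 𝓝 (ContinuousLinearMap.id ℝ (Vec n)),
      ((A (f p).1, (f p).2) : Amb n) ∈ W :=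
    hc.continuousAt.eventually_mem (by simpa using hW)
  filter_upwards [nhdsWithin_le_nhds h0, self_mem_nhdsWithin] with A hA hAG
  obtain ⟨q, hq⟩ := h A hAG p
  exact ⟨q, hWU (by rw [mem_preimage, hq]; exact hA), hq⟩

/-! ### Graphs over parallel hypersurfaces -/

/-- `cos` if `ε = 1` and `cosh` if `ε = -1`. -/
def cosE (ε s : ℝ) : ℝ := if ε = 1 then Real.cos s else Real.cosh s

/-- `sin` if `ε = 1` and `sinh` if `ε = -1`. -/
def sinE (ε s : ℝ) : ℝ := if ε = 1 then Real.sin s else Real.sinh s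

/-- `tan` if `ε = 1` and `tanh` if `ε = -1`. -/
def tanE (ε s : ℝ) : ℝ := if ε = 1 then Real.tan s else Real.tanh s

/-- `arctan` if `ε = 1` and `arctanh` if `ε = -1`. -/
def arctanE (ε x : ℝ) : ℝ := if ε = 1 then Real.arctan x else Real.artanh x

/-- The geodesic `s ↦ exp_x(s η)` of `Q_ε^n`, where `η` is a unit tangent vector at `x`. -/
def geodesic {n : ℕ} (ε : ℝ) (x η : Vec n) (s : ℝ) : Vec n := cosE ε s • x + sinE ε s • η

/-- The `(f_s, φ)`-graph `{(f_s(p), φ(s)) : s ∈ I}`. The parallel family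
`f_s(p) = exp_{f(p)}(s η(p))` is given through the set `B` of the pairs `(f(p), η(p))` of base
points and unit normal vectors. -/
def parallelGraph {n : ℕ} (ε : ℝ) (B : Set (Vec n × Vec n)) (φ : ℝ → ℝ) (I : Set ℝ) :
    Set (Amb n) :=
  {q | ∃ b ∈ B, ∃ s ∈ I, q = (geodesic ε b.1 b.2 s, φ s)}

/-- The function `φ(s) = ∫_{s₀}^s ρ / √(1 - ρ²)` that corresponds to
`ρ = φ' / √(1 + φ'²)` and vanishes at `s₀`. -/
def heightOf (ρ : ℝ → ℝ) (s₀ s : ℝ) : ℝ := ∫ u in s₀..s, ρ u / √(1 - ρ u ^ 2)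

/-- The unit normal vectors at `o`; the parallel family they generate consists of the geodesic
spheres with center `o`. -/
def sphereData {n : ℕ} (ε : ℝ) (o : Vec n) : Set (Vec n × Vec n) :=
  {b | b.1 = o ∧ form ε o b.2 = 0 ∧ form ε b.2 b.2 = 1}

/-- The horosphere `{x : form x v = -1}` of hyperbolic space determined by the future-directed null
vector `v`, with its unit normal `v - x`. -/
def horosphereData {n : ℕ} (v : Vec n) : Set (Vec n × Vec n) :=
  {b | b.1 ∈ spaceForm n (-1) ∧ form (-1) b.1 v = -1 ∧ b.2 = v - b.1}

/-- The totally geodesic hyperplane `{x : form x v = 0}` of hyperbolic space determined by the unit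
spacelike vector `v`, with its unit normal `v`. The parallel family it generates consists of its
equidistant hypersurfaces. -/
def hyperplaneData {n : ℕ} (v : Vec n) : Set (Vec n × Vec n) :=
  {b | b.1 ∈ spaceForm n (-1) ∧ form (-1) b.1 v = 0 ∧ b.2 = v}

/-- The reflection of `Q_ε^n × ℝ` over the horizontal hyperplane of height `h`. -/
def reflection {n : ℕ} (h : ℝ) (q : Amb n) : Amb n := (q.1, 2 * h - q.2)

/-! ### The examples -/

/-- The horizontal hyperplane `Q_ε^n × {h}`. -/
def horizontalHyperplane (n : ℕ) (ε h : ℝ) : Set (Amb n) := spaceForm n ε ×ˢ {h}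

/-- The function `ρ(s) = √(K - ε) tan_ε(s)`. -/
def rotationalRho (ε K s : ℝ) : ℝ := √(K - ε) * tanE ε s

/-- The radius `δ = arctan_ε(1 / √(K - ε))`, at which `ρ = 1` (for `K > 0`). -/
def rotationalRadius (ε K : ℝ) : ℝ := arctanE ε (1 / √(K - ε))

/-- The rotational hypersurface about `{o} × ℝ` of constant sectional curvature `K > ε`. It is made
from the `(f_s, φ)`-graph over the geodesic spheres with center `o` and with the above function
`ρ`: for `K ≤ 0` it is this graph, with `s ∈ [0, ∞)`; for `K > 0` it is the sphere obtained by
gluing the closure of this graph, with `s ∈ [0, δ)`, to the closure of its reflection over the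
horizontal hyperplane of height `φ(δ)`. -/
def rotationalHypersurface {n : ℕ} (ε : ℝ) (o : Vec n) (K : ℝ) : Set (Amb n) :=
  let φ := heightOf (rotationalRho ε K) 0
  let δ := rotationalRadius ε K
  if 0 < K then
    closure (parallelGraph ε (sphereData ε o) φ (Ico 0 δ)) ∪
      closure (reflection (φ δ) '' parallelGraph ε (sphereData ε o) φ (Ico 0 δ))
  else parallelGraph ε (sphereData ε o) φ (Ici 0)

/-- The entire graph over hyperbolic space that is invariant by parabolic translations, of constant
sectional curvature `K ∈ (-1, 0)`: the `(f_s, φ)`-graph over a parallel family of horospheres with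
constant function `ρ = √(K + 1)`. -/
def parabolicHypersurface {n : ℕ} (v : Vec n) (K : ℝ) : Set (Amb n) :=
  parallelGraph (-1) (horosphereData v) (heightOf (fun _ => √(K + 1)) 0) univ

/-- The function `ρ(s) = √(K + 1) coth(s)`. -/
def hyperbolicRho (K s : ℝ) : ℝ := √(K + 1) * (Real.cosh s / Real.sinh s)

/-- The hypersurface invariant by hyperbolic translations of constant sectional curvature
`K ∈ (-1, 0)`: the union of the `(f_s, φ)`-graph over the hypersurfaces equidistant to a totally
geodesic hyperplane, with the above function `ρ`, `s ∈ [λ₀, ∞)`, `λ₀ = arctanh √(K + 1)` and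
`φ(λ₀) = 0`, and of its reflection over the horizontal hyperplane of height `0`. -/
def hyperbolicHypersurface {n : ℕ} (v : Vec n) (K : ℝ) : Set (Amb n) :=
  let s₀ := Real.artanh √(K + 1)
  let Γ := parallelGraph (-1) (hyperplaneData v) (heightOf (hyperbolicRho K) s₀) (Ici s₀)
  Γ ∪ reflection 0 '' Γ

/-- The vertical cylinder over the horosphere `{x : form x v = -1}` of hyperbolic space. -/
def horosphereCylinder {n : ℕ} (v : Vec n) : Set (Amb n) :=
  {x | x ∈ spaceForm n (-1) ∧ form (-1) x v = -1} ×ˢ univ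

/-- The isometry `(x, t) ↦ (x, σ t + b)` of `Q_ε^n × ℝ`, where `σ = 1` or `σ = -1`. -/
def verticalMotion {n : ℕ} (σ b : ℝ) (q : Amb n) : Amb n := (q.1, σ * q.2 + b)

/-- `P` is the image of `P₀` under a vertical translation, possibly after a reflection over a
horizontal hyperplane. -/
def VerticallyCongruent {n : ℕ} (P P₀ : Set (Amb n)) : Prop :=
  ∃ σ b : ℝ, (σ = 1 ∨ σ = -1) ∧ P = verticalMotion σ b '' P₀

/-- The list of properly embedded hypersurfaces of `Q_ε^n × ℝ` of constant sectional curvature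
`K` in the classification. -/
def IsModel {n : ℕ} (ε K : ℝ) (P : Set (Amb n)) : Prop :=
  (K = ε ∧ ∃ h : ℝ, P = horizontalHyperplane n ε h) ∨
  (ε < K ∧ ∃ o ∈ spaceForm n ε, VerticallyCongruent P (rotationalHypersurface ε o K)) ∨
  (ε = -1 ∧ -1 < K ∧ K < 0 ∧ ∃ v : Vec n, form (-1) v v = 0 ∧ 0 < v 0 ∧
    VerticallyCongruent P (parabolicHypersurface v K)) ∨
  (ε = -1 ∧ -1 < K ∧ K < 0 ∧ ∃ v : Vec n, form (-1) v v = 1 ∧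
    VerticallyCongruent P (hyperbolicHypersurface v K)) ∨
  (ε = -1 ∧ K = 0 ∧ ∃ v : Vec n, form (-1) v v = 0 ∧ 0 < v 0 ∧ P = horosphereCylinder v)

end ProductHypersurface

end

open Set Filter Topology
open scoped Manifold ContDiff

noncomputable section

namespace ProductHypersurface

/-! ### Coordinate derivatives and the Gauss equation -/

/-! Let `v` be the axis, `c = ⟨x, v⟩` and `t` the height, both restricted to the hypersurface, and
let `D = ⟨v, v⟩ - ε c²` be the squared length of the tangential part `v^⊤` of `v`. Everything is
governed by the two functions `c` and `t`.

Local invariance makes the hypersurface tangent to the orbits wherever `D ≠ 0`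
(`IsHypersurface.isTangentToOrbits`). The orbits have codimension two in the product, so `dc` and
`dt` are proportional there (`IsTangentToOrbits.wedge_eq_zero`), do not both vanish, and `(∂ₑt v^⊤,
-∂ₑc)` is a normal vector. In orbit directions the second fundamental form with respect to it is `ε
c ∂ₑt` times the metric. As `n ≥ 3`, some tangent plane consists of orbit directions, and the Gauss
equation (`IsPatch.curvatureForm_eq`) turns its curvature into the first-order relation `(K - ε)(D
(∂ₑt)² + (∂ₑc)²) = c² (∂ₑt)²` (`profile_equation`). Signs give `K ≥ ε`.

If `K = ε`, then `c ∂ₑt = 0`. Were `∂ₑt` nonzero somewhere, `c` would vanish on an open set and the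
hypersurface would be a vertical cylinder there, which forces `K = 0 ≠ ε`
(`curvature_eq_zero_of_axisFun_const`). Hence the height is constant.

If `K > ε`, then `dt ≠ 0` where `D ≠ 0`, and `C = dc/dt` satisfies `C² = l c² - ⟨v, v⟩` with `l =
εK/(K - ε)`. Differentiation gives `c'' = l c`, hence `c = A genCos l t + B genSin l t` with `l A² -
B² = ⟨v, v⟩`. The coefficients are locally constant; points with `D = 0` are isolated and do not
separate a ball, so by connectedness the coefficients are global (`exists_hasProfileAt`,
`exists_profile`).

Conversely, every level set `⟨x, v⟩ = A genCos l t + B genSin l t` with this constraint is a regular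
hypersurface of constant curvature `K` (`isProperlyEmbedded_profileHypersurface`,
`profileHypersurface_hasCurvature`). Integrating the `ρ`-functions explicitly presents the models as
such level sets. Addition formulas absorb `A` and `B` into a vertical translation, a reflection or a
change of `v`, and the signs of `⟨v, v⟩` and `K` exclude the remaining combinations
(`exists_isModel`). For the sphere in `ℍ^n × ℝ` the function is a cosine, and connectedness selects
one period. Finally, an immersed hypersurface inside an embedded one of the same dimension is open
in it (`exists_isOpen_range_eq`). -/

/-- The partial derivative `∂ᵢ X` of a vector-valued map. -/
def partialDeriv {n : ℕ} {E : Type*} [NormedAddCommGroup E] [NormedSpace ℝ E] (i : Fin n)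
    (X : Coord n → E) (y : Coord n) : E :=
  fderiv ℝ X y (EuclideanSpace.single i (1 : ℝ))

theorem pd_eq_partialDeriv {n : ℕ} (i : Fin n) (h : Coord n → ℝ) : pd i h = partialDeriv i h := rfl

section Calculus

variable {n : ℕ} {E : Type*} [NormedAddCommGroup E] [NormedSpace ℝ E]

theorem fderiv_apply_eq_sum (X : Coord n → E) (y u : Coord n) :
    fderiv ℝ X y u = ∑ i, u i • partialDeriv i X y := by
  conv_lhs => rw [← (EuclideanSpace.basisFun (Fin n) ℝ).sum_repr u]
  simp [partialDeriv]

theorem contDiffOn_partialDeriv {U : Set (Coord n)} (hU : IsOpen U) {X : Coord n → E}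
    (hX : ContDiffOn ℝ ∞ X U) (i : Fin n) : ContDiffOn ℝ ∞ (partialDeriv i X) U :=
  (hX.fderiv_of_isOpen hU (m := ∞) (by simp)).clm_apply contDiffOn_const

theorem differentiableAt_of_smooth {U : Set (Coord n)} (hU : IsOpen U) {X : Coord n → E}
    (hX : ContDiffOn ℝ ∞ X U) {y : Coord n} (hy : y ∈ U) : DifferentiableAt ℝ X y :=
  (hX.contDiffAt (hU.mem_nhds hy)).differentiableAt (by simp)

theorem partialDeriv_comm {U : Set (Coord n)} (hU : IsOpen U) {X : Coord n → E}
    (hX : ContDiffOn ℝ ∞ X U) {y : Coord n} (hy : y ∈ U) (i j : Fin n) :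
    partialDeriv i (partialDeriv j X) y = partialDeriv j (partialDeriv i X) y := by
  have hs : IsSymmSndFDerivAt ℝ X y :=
    (hX.contDiffAt (hU.mem_nhds hy)).isSymmSndFDerivAt
      (by simpa using ENat.LEInfty.out)
  have hd : DifferentiableAt ℝ (fderiv ℝ X) y :=
    ((hX.fderiv_of_isOpen hU (m := ∞) (by simp)).contDiffAt (hU.mem_nhds hy)).differentiableAt
      (by simp)
  have key : ∀ a b : Fin n, partialDeriv a (partialDeriv b X) y
      = fderiv ℝ (fderiv ℝ X) y (EuclideanSpace.single a 1) (EuclideanSpace.single b 1) := by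
    intro a b
    unfold partialDeriv
    rw [fderiv_clm_apply hd (differentiableAt_const _)]
    simp
  rw [key, key, hs]

theorem partialDeriv_congr {U : Set (Coord n)} (hU : IsOpen U) {X Y : Coord n → E}
    (h : EqOn X Y U) {y : Coord n} (hy : y ∈ U) (i : Fin n) :
    partialDeriv i X y = partialDeriv i Y y := by
  unfold partialDeriv
  rw [Filter.EventuallyEq.fderiv_eq (h.eventuallyEq_of_mem (hU.mem_nhds hy))]

theorem partialDeriv_bilin {F : Type*} [NormedAddCommGroup F] [NormedSpace ℝ F]
    (b : E →L[ℝ] F →L[ℝ] ℝ) {X : Coord n → E} {Y : Coord n → F} {y : Coord n}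
    (hX : DifferentiableAt ℝ X y) (hY : DifferentiableAt ℝ Y y) (i : Fin n) :
    partialDeriv i (fun z => b (X z) (Y z)) y
      = b (partialDeriv i X y) (Y y) + b (X y) (partialDeriv i Y y) := by
  unfold partialDeriv
  rw [(b.hasFDerivAt_of_bilinear hX.hasFDerivAt hY.hasFDerivAt).fderiv]
  simp [add_comm]

theorem partialDeriv_mul {h k : Coord n → ℝ} {y : Coord n}
    (hh : DifferentiableAt ℝ h y) (hk : DifferentiableAt ℝ k y) (i : Fin n) :
    partialDeriv i (fun z => h z * k z) y
      = partialDeriv i h y * k y + h y * partialDeriv i k y := by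
  simpa using partialDeriv_bilin (ContinuousLinearMap.mul ℝ ℝ) hh hk i

theorem partialDeriv_sum {ι : Type*} (s : Finset ι) {h : ι → Coord n → E} {y : Coord n}
    (hh : ∀ l ∈ s, DifferentiableAt ℝ (h l) y) (i : Fin n) :
    partialDeriv i (fun z => ∑ l ∈ s, h l z) y = ∑ l ∈ s, partialDeriv i (h l) y := by
  unfold partialDeriv
  rw [fderiv_fun_sum hh]
  simp

end Calculus

/-! ### The Gauss equation for a map into a vector space with a symmetric bilinear form. -/

section Gauss

variable {n : ℕ} {E : Type*} [NormedAddCommGroup E] [NormedSpace ℝ E]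

/-- The metric that a bilinear form induces on the parameter domain of `X`. -/
def gram (b : E →L[ℝ] E →L[ℝ] ℝ) (X : Coord n → E) (y : Coord n) : Matrix (Fin n) (Fin n) ℝ :=
  Matrix.of fun i j => b (partialDeriv i X y) (partialDeriv j X y)

variable {b : E →L[ℝ] E →L[ℝ] ℝ} {U : Set (Coord n)} {X : Coord n → E}

theorem pd_gram (hU : IsOpen U) (hX : ContDiffOn ℝ ∞ X U) {y : Coord n} (hy : y ∈ U)
    (i j l : Fin n) :
    pd i (fun z => gram b X z j l) y
      = b (partialDeriv i (partialDeriv j X) y) (partialDeriv l X y)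
        + b (partialDeriv j X y) (partialDeriv i (partialDeriv l X) y) := by
  rw [pd_eq_partialDeriv]
  exact partialDeriv_bilin b
    (differentiableAt_of_smooth hU (contDiffOn_partialDeriv hU hX j) hy)
    (differentiableAt_of_smooth hU (contDiffOn_partialDeriv hU hX l) hy) i

theorem contDiffOn_bilin (b : E →L[ℝ] E →L[ℝ] ℝ) {Y Z : Coord n → E} (hY : ContDiffOn ℝ ∞ Y U)
    (hZ : ContDiffOn ℝ ∞ Z U) : ContDiffOn ℝ ∞ (fun z => b (Y z) (Z z)) U :=
  (b.contDiff.comp_contDiffOn hY).clm_apply hZ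

/-- Expanding the three derivatives of the metric by the product rule, all terms cancel in pairs
except the two equal ones that contain `∂ᵢ∂ⱼX`. -/
theorem christoffel_gram (hb : ∀ p q, b p q = b q p) (hU : IsOpen U) (hX : ContDiffOn ℝ ∞ X U)
    {y : Coord n} (hy : y ∈ U) (k i j : Fin n) :
    christoffel (gram b X) k i j y = ∑ l, (gram b X y)⁻¹ k l *
      b (partialDeriv i (partialDeriv j X) y) (partialDeriv l X y) := by
  unfold christoffel
  rw [Finset.mul_sum]
  refine Finset.sum_congr rfl fun l _ => ?_
  rw [pd_gram hU hX hy, pd_gram hU hX hy, pd_gram hU hX hy, partialDeriv_comm hU hX hy j i,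
    partialDeriv_comm hU hX hy l i, partialDeriv_comm hU hX hy l j,
    hb (partialDeriv j X y) (partialDeriv i (partialDeriv l X) y),
    hb (partialDeriv i X y) (partialDeriv j (partialDeriv l X) y)]
  ring

theorem sum_christoffel_mul_gram (hb : ∀ p q, b p q = b q p) (hU : IsOpen U)
    (hX : ContDiffOn ℝ ∞ X U) {y : Coord n} (hy : y ∈ U) (hdet : IsUnit (gram b X y).det)
    (i j m : Fin n) :
    ∑ k, christoffel (gram b X) k i j y * gram b X y k m
      = b (partialDeriv i (partialDeriv j X) y) (partialDeriv m X y) := by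
  have hsymm : ∀ p q, gram b X y p q = gram b X y q p := fun p q => hb _ _
  have h1 : ∀ l, ∑ k, gram b X y m k * (gram b X y)⁻¹ k l = (1 : Matrix (Fin n) (Fin n) ℝ) m l := by
    intro l
    rw [← Matrix.mul_nonsing_inv _ hdet, Matrix.mul_apply]
  simp_rw [christoffel_gram hb hU hX hy, Finset.sum_mul]
  rw [Finset.sum_comm]
  calc _ = ∑ l, (∑ k, gram b X y m k * (gram b X y)⁻¹ k l) *
        b (partialDeriv i (partialDeriv j X) y) (partialDeriv l X y) := by
        refine Finset.sum_congr rfl fun l _ => ?_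
        rw [Finset.sum_mul]
        refine Finset.sum_congr rfl fun k _ => ?_
        rw [hsymm k m]; ring
    _ = _ := by
        simp_rw [h1, Matrix.one_apply]
        simp

theorem contDiffAt_gram (hU : IsOpen U) (hX : ContDiffOn ℝ ∞ X U) (k l : Fin n) :
    ContDiffOn ℝ ∞ (fun z => gram b X z k l) U :=
  contDiffOn_bilin b (contDiffOn_partialDeriv hU hX k) (contDiffOn_partialDeriv hU hX l)

/-- By Cramer's rule the entries of the inverse are quotients of polynomials in the entries of `g`.
-/
theorem differentiableAt_inv_entry {g : Coord n → Matrix (Fin n) (Fin n) ℝ} {y : Coord n}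
    (hg : ∀ k l, DifferentiableAt ℝ (fun z => g z k l) y) (hdet : IsUnit (g y).det)
    (k l : Fin n) : DifferentiableAt ℝ (fun z => (g z)⁻¹ k l) y := by
  have hd : ∀ h : Coord n → Matrix (Fin n) (Fin n) ℝ,
      (∀ k l, DifferentiableAt ℝ (fun z => h z k l) y) →
      DifferentiableAt ℝ (fun z => (h z).det) y := by
    intro h hh
    simp_rw [Matrix.det_apply]
    refine DifferentiableAt.fun_sum fun σ _ => ?_
    refine DifferentiableAt.fun_const_smul ?_ _
    exact (HasFDerivAt.finsetProd fun i _ => (hh (σ i) i).hasFDerivAt).differentiableAt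
  simp_rw [Matrix.inv_def, Ring.inverse_eq_inv', Matrix.smul_apply, smul_eq_mul]
  refine ((hd g hg).inv hdet.ne_zero).mul ?_
  simp_rw [Matrix.adjugate_apply]
  refine hd _ fun p q => ?_
  by_cases h : p = l
  · subst h; simp
  · simpa [Matrix.updateRow_ne h] using hg p q

theorem differentiableAt_christoffel (hb : ∀ p q, b p q = b q p) (hU : IsOpen U)
    (hX : ContDiffOn ℝ ∞ X U) {y : Coord n} (hy : y ∈ U)
    (hdet : IsUnit (gram b X y).det) (k i j : Fin n) :
    DifferentiableAt ℝ (christoffel (gram b X) k i j) y := by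
  have h1 : DifferentiableAt ℝ (fun z => ∑ l, (gram b X z)⁻¹ k l *
      b (partialDeriv i (partialDeriv j X) z) (partialDeriv l X z)) y := by
    refine DifferentiableAt.fun_sum fun l _ => ?_
    refine DifferentiableAt.fun_mul ?_ ?_
    · exact differentiableAt_inv_entry
        (fun p q => differentiableAt_of_smooth hU (contDiffAt_gram hU hX p q) hy) hdet k l
    · exact differentiableAt_of_smooth hU (contDiffOn_bilin b
        (contDiffOn_partialDeriv hU (contDiffOn_partialDeriv hU hX j) i)
        (contDiffOn_partialDeriv hU hX l)) hy
  refine h1.congr_of_eventuallyEq ?_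
  filter_upwards [hU.mem_nhds hy] with z hz using christoffel_gram hb hU hX hz k i j

/-- The tangential part of the second derivative `∂ᵢ∂ⱼX`. -/
def tangentialPart (b : E →L[ℝ] E →L[ℝ] ℝ) (X : Coord n → E) (i j : Fin n) (y : Coord n) : E :=
  ∑ k, christoffel (gram b X) k i j y • partialDeriv k X y

/-- The Gauss equation in coordinates. -/
theorem sum_riemann_mul_gram (hb : ∀ p q, b p q = b q p) (hU : IsOpen U)
    (hX : ContDiffOn ℝ ∞ X U) (hdet : ∀ y ∈ U, IsUnit (gram b X y).det) {y : Coord n} (hy : y ∈ U)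
    (i j k m : Fin n) :
    ∑ l, riemann (gram b X) l i j k y * gram b X y l m
      = b (partialDeriv j (partialDeriv k X) y - tangentialPart b X j k y)
          (partialDeriv i (partialDeriv m X) y)
        - b (partialDeriv i (partialDeriv k X) y - tangentialPart b X i k y)
          (partialDeriv j (partialDeriv m X) y) := by
  -- This is `sum_christoffel_mul_gram` differentiated in the direction `i`. The third derivatives
  -- it produces are symmetric in `i` and `j` and cancel in the curvature.
  have key : ∀ i j : Fin n, ∑ l, pd i (christoffel (gram b X) l j k) y * gram b X y l m
      = b (partialDeriv i (partialDeriv j (partialDeriv k X)) y) (partialDeriv m X y)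
        + b (partialDeriv j (partialDeriv k X) y - tangentialPart b X j k y)
          (partialDeriv i (partialDeriv m X) y)
        - ∑ l, christoffel (gram b X) l j k y *
          b (partialDeriv i (partialDeriv l X) y) (partialDeriv m X y) := by
    intro i j
    have hdX : ∀ k, ContDiffOn ℝ ∞ (partialDeriv k X) U := contDiffOn_partialDeriv hU hX
    have e1 : partialDeriv i (fun z => ∑ l, christoffel (gram b X) l j k z * gram b X z l m) y
        = partialDeriv i (fun z => b (partialDeriv j (partialDeriv k X) z)
          (partialDeriv m X z)) y :=
      partialDeriv_congr hU
        (fun z hz => sum_christoffel_mul_gram hb hU hX hz (hdet z hz) j k m) hy i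
    have dC : ∀ l, DifferentiableAt ℝ (christoffel (gram b X) l j k) y := fun l =>
      differentiableAt_christoffel hb hU hX hy (hdet y hy) l j k
    have dG : ∀ l, DifferentiableAt ℝ (fun z => gram b X z l m) y := fun l =>
      differentiableAt_of_smooth hU (contDiffAt_gram hU hX l m) hy
    rw [partialDeriv_sum _ (fun l _ => (dC l).fun_mul (dG l)),
      partialDeriv_bilin b
        (differentiableAt_of_smooth hU (contDiffOn_partialDeriv hU (hdX k) j) hy)
        (differentiableAt_of_smooth hU (hdX m) hy)] at e1
    simp_rw [partialDeriv_mul (dC _) (dG _)] at e1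
    have e2 : ∀ l, partialDeriv i (fun z => gram b X z l m) y = _ := fun l =>
      pd_gram (b := b) hU hX hy i l m
    simp_rw [e2, mul_add, Finset.sum_add_distrib] at e1
    simp only [tangentialPart, map_sub, map_sum, map_smul, sub_apply,
      sum_apply, smul_apply, smul_eq_mul]
    simp only [pd_eq_partialDeriv]
    linarith
  -- The quadratic Christoffel terms of the curvature cancel the last sum left over in `key`.
  have hquad : ∀ i j : Fin n, ∑ l, (∑ p, christoffel (gram b X) p j k y *
      christoffel (gram b X) l i p y) * gram b X y l m
      = ∑ p, christoffel (gram b X) p j k y *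
        b (partialDeriv i (partialDeriv p X) y) (partialDeriv m X y) := by
    intro i j
    simp_rw [← sum_christoffel_mul_gram hb hU hX hy (hdet y hy), Finset.sum_mul, Finset.mul_sum]
    rw [Finset.sum_comm]
    simp_rw [mul_assoc]
  have hexp : ∑ l, riemann (gram b X) l i j k y * gram b X y l m
      = ∑ l, pd i (christoffel (gram b X) l j k) y * gram b X y l m
        - ∑ l, pd j (christoffel (gram b X) l i k) y * gram b X y l m
        + ∑ l, (∑ p, christoffel (gram b X) p j k y *
          christoffel (gram b X) l i p y) * gram b X y l m
        - ∑ l, (∑ p, christoffel (gram b X) p i k y *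
          christoffel (gram b X) l j p y) * gram b X y l m := by
    rw [← Finset.sum_sub_distrib, ← Finset.sum_add_distrib, ← Finset.sum_sub_distrib]
    refine Finset.sum_congr rfl fun l _ => ?_
    unfold riemann
    rw [Finset.sum_sub_distrib]
    ring
  rw [hexp, key i j, key j i, hquad i j, hquad j i,
    partialDeriv_comm hU (contDiffOn_partialDeriv hU hX k) hy i j]
  ring

/-- Justifies the name of `tangentialPart`: what it leaves of `∂ᵢ∂ⱼX` is normal. -/
theorem bilin_sub_tangentialPart (hb : ∀ p q, b p q = b q p) (hU : IsOpen U)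
    (hX : ContDiffOn ℝ ∞ X U) {y : Coord n} (hy : y ∈ U) (hdet : IsUnit (gram b X y).det)
    (i j m : Fin n) :
    b (partialDeriv i (partialDeriv j X) y - tangentialPart b X i j y) (partialDeriv m X y)
      = 0 := by
  have := sum_christoffel_mul_gram hb hU hX hy hdet i j m
  simp only [tangentialPart, map_sub, map_sum, map_smul, sub_apply,
    sum_apply, smul_apply, smul_eq_mul]
  rw [← this]
  simp [gram]

end Gauss

/-! ### Linear algebra of the ambient forms -/

section Form

variable {n : ℕ} {ε : ℝ}

theorem form_comm (x y : Vec n) : form ε x y = form ε y x := by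
  unfold form
  simp_rw [mul_comm (x _) (y _)]
  ring_nf

theorem form_add_left (x y z : Vec n) : form ε (x + y) z = form ε x z + form ε y z := by
  simp only [form, Pi.add_apply, add_mul, Finset.sum_add_distrib]
  ring

theorem form_smul_left (a : ℝ) (x z : Vec n) : form ε (a • x) z = a * form ε x z := by
  simp only [form, Pi.smul_apply, smul_eq_mul, mul_add, Finset.mul_sum]
  congr 1
  · ring
  · exact Finset.sum_congr rfl fun i _ => by ring

theorem form_add_right (x y z : Vec n) : form ε x (y + z) = form ε x y + form ε x z := by
  rw [form_comm, form_add_left, form_comm y, form_comm z]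

theorem form_smul_right (a : ℝ) (x z : Vec n) : form ε x (a • z) = a * form ε x z := by
  rw [form_comm, form_smul_left, form_comm]

theorem form_neg_left (x z : Vec n) : form ε (-x) z = -form ε x z := by
  simpa using form_smul_left (-1) x z

theorem form_neg_right (x z : Vec n) : form ε x (-z) = -form ε x z := by
  simpa using form_smul_right (-1) x z

theorem form_sub_left (x y z : Vec n) : form ε (x - y) z = form ε x z - form ε y z := by
  rw [sub_eq_add_neg, form_add_left, form_neg_left, sub_eq_add_neg]

theorem form_sub_right (x y z : Vec n) : form ε x (y - z) = form ε x y - form ε x z := by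
  rw [sub_eq_add_neg, form_add_right, form_neg_right, sub_eq_add_neg]

theorem form_zero_left (z : Vec n) : form ε 0 z = 0 := by simp [form]

theorem form_zero_right (z : Vec n) : form ε z 0 = 0 := by simp [form]

/-- The form of `ℝ^{n+1}` as a continuous bilinear map. -/
def formL (n : ℕ) (ε : ℝ) : Vec n →L[ℝ] Vec n →L[ℝ] ℝ :=
  (LinearMap.mk₂ ℝ (form ε) form_add_left form_smul_left form_add_right
    form_smul_right).toContinuousBilinearMap

@[simp] theorem formL_apply (x y : Vec n) : formL n ε x y = form ε x y := rfl

theorem prodForm_comm (X Y : Amb n) : prodForm ε X Y = prodForm ε Y X := by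
  simp [prodForm, form_comm X.1, mul_comm]

/-- The form of `ℝ^{n+1} × ℝ` as a continuous bilinear map. -/
def prodL (n : ℕ) (ε : ℝ) : Amb n →L[ℝ] Amb n →L[ℝ] ℝ :=
  (LinearMap.mk₂ ℝ (prodForm ε)
    (fun X Y Z => by simp [prodForm, form_add_left]; ring)
    (fun a X Z => by simp [prodForm, form_smul_left]; ring)
    (fun X Y Z => by simp [prodForm, form_add_right]; ring)
    (fun a X Z => by simp [prodForm, form_smul_right]; ring)).toContinuousBilinearMap

@[simp] theorem prodL_apply (x y : Amb n) : prodL n ε x y = prodForm ε x y := rfl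

theorem prodForm_add_left (x y z : Amb n) :
    prodForm ε (x + y) z = prodForm ε x z + prodForm ε y z := by
  simp only [← prodL_apply, map_add, add_apply]

theorem prodForm_sub_left (x y z : Amb n) :
    prodForm ε (x - y) z = prodForm ε x z - prodForm ε y z := by
  simp only [← prodL_apply, map_sub, sub_apply]

theorem prodForm_smul_left (a : ℝ) (x z : Amb n) :
    prodForm ε (a • x) z = a * prodForm ε x z := by
  simp only [← prodL_apply, map_smul, smul_apply, smul_eq_mul]

theorem sq_sum_mul_le (a b : Fin n → ℝ) :
    (∑ i, a i * b i) ^ 2 ≤ (∑ i, a i * a i) * ∑ i, b i * b i := by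
  simpa [sq] using Finset.sum_mul_sq_le_sq_mul_sq Finset.univ a b

/-- For `ε = -1` the orthogonal complement of a timelike vector is spacelike: Cauchy–Schwarz for the
last `n` coordinates bounds `(x₀ w₀)²` by `(x₀² - 1) ∑ wᵢ²`. -/
theorem form_self_nonneg (hε : ε = 1 ∨ ε = -1) {x w : Vec n} (hx : x ∈ spaceForm n ε)
    (hw : form ε x w = 0) : 0 ≤ form ε w w := by
  have hs : 0 ≤ ∑ i : Fin n, w i.succ * w i.succ :=
    Finset.sum_nonneg fun i _ => mul_self_nonneg _
  rcases hε with rfl | rfl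
  · unfold form
    nlinarith [mul_self_nonneg (w 0)]
  · have h1 := hx.1
    have h0 := hx.2 rfl
    have hcs := sq_sum_mul_le (fun i : Fin n => x i.succ) (fun i => w i.succ)
    unfold form at *
    have e1 : ∑ i : Fin n, x i.succ * w i.succ = x 0 * w 0 := by linarith
    have e2 : ∑ i : Fin n, x i.succ * x i.succ = x 0 ^ 2 - 1 := by linarith
    rw [e1, e2] at hcs
    have h2 : 0 ≤ x 0 ^ 2 * (∑ i : Fin n, w i.succ * w i.succ - w 0 ^ 2) := by nlinarith
    have := nonneg_of_mul_nonneg_right h2 (by positivity)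
    nlinarith

theorem eq_zero_of_form_self (hε : ε = 1 ∨ ε = -1) {x w : Vec n} (hx : x ∈ spaceForm n ε)
    (hw : form ε x w = 0) (h : form ε w w = 0) : w = 0 := by
  have hs : 0 ≤ ∑ i : Fin n, w i.succ * w i.succ :=
    Finset.sum_nonneg fun i _ => mul_self_nonneg _
  have key : w 0 = 0 ∧ ∑ i : Fin n, w i.succ * w i.succ = 0 := by
    rcases hε with rfl | rfl
    · unfold form at h
      constructor <;> nlinarith [mul_self_nonneg (w 0)]
    · have h1 := hx.1
      have h0 := hx.2 rfl
      have hcs := sq_sum_mul_le (fun i : Fin n => x i.succ) (fun i => w i.succ)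
      unfold form at *
      have e1 : ∑ i : Fin n, x i.succ * w i.succ = x 0 * w 0 := by linarith
      have e2 : ∑ i : Fin n, x i.succ * x i.succ = x 0 ^ 2 - 1 := by linarith
      have e3 : ∑ i : Fin n, w i.succ * w i.succ = w 0 ^ 2 := by linarith
      rw [e1, e2, e3] at hcs
      have : w 0 ^ 2 = 0 := by nlinarith [sq_nonneg (w 0)]
      exact ⟨by simpa using this, by rw [e3, this]⟩
  rw [Finset.sum_eq_zero_iff_of_nonneg fun i _ => mul_self_nonneg _] at key
  funext i
  refine Fin.cases key.1 (fun j => ?_) i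
  simpa using key.2 j (Finset.mem_univ _)

theorem prodForm_self_nonneg (hε : ε = 1 ∨ ε = -1) {x : Vec n} {W : Amb n}
    (hx : x ∈ spaceForm n ε) (hw : form ε x W.1 = 0) : 0 ≤ prodForm ε W W :=
  add_nonneg (form_self_nonneg hε hx hw) (mul_self_nonneg _)

theorem eq_zero_of_prodForm_self (hε : ε = 1 ∨ ε = -1) {x : Vec n} {W : Amb n}
    (hx : x ∈ spaceForm n ε) (hw : form ε x W.1 = 0) (h : prodForm ε W W = 0) : W = 0 := by
  have h1 := form_self_nonneg hε hx hw
  have h2 := mul_self_nonneg W.2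
  unfold prodForm at h
  refine Prod.ext (eq_zero_of_form_self hε hx hw (by linarith)) ?_
  exact mul_self_eq_zero.1 (by linarith)

/-- The time components dominate the space components for both vectors, strictly for `x`, so
Cauchy–Schwarz makes the sign of `-x₀ y₀` prevail. -/
theorem form_neg_of_causal {x y : Vec n} (hx : x ∈ spaceForm n (-1)) (hy : form (-1) y y ≤ 0)
    (hy0 : 0 < y 0) : form (-1) x y < 0 := by
  have h1 := hx.1
  have h0 := hx.2 rfl
  have hcs := sq_sum_mul_le (fun i : Fin n => x i.succ) (fun i => y i.succ)
  unfold form at *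
  have e2 : ∑ i : Fin n, x i.succ * x i.succ = x 0 ^ 2 - 1 := by linarith
  rw [e2] at hcs
  have h3 : 0 ≤ ∑ i : Fin n, y i.succ * y i.succ :=
    Finset.sum_nonneg fun i _ => mul_self_nonneg _
  have h4 : (∑ i : Fin n, x i.succ * y i.succ) ^ 2 < (x 0 * y 0) ^ 2 := by
    have : 0 ≤ x 0 ^ 2 - 1 := by
      rw [← e2]; exact Finset.sum_nonneg fun i _ => mul_self_nonneg _
    nlinarith [mul_pos hy0 hy0, mul_nonneg this (sub_nonneg.2 hy)]
  have := (abs_lt_of_sq_lt_sq h4 (by positivity))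
  nlinarith [le_abs_self (∑ i : Fin n, x i.succ * y i.succ)]

/-- The sign of `⟨x, y⟩` decides on which sheet of the hyperboloid `y` lies, since on the other
sheet `form_neg_of_causal` applies to `-y`. -/
theorem mem_spaceForm_of_form_neg {x y : Vec n} (hx : x ∈ spaceForm n (-1))
    (hy : form (-1) y y = -1) (hxy : form (-1) x y < 0) : y ∈ spaceForm n (-1) := by
  refine ⟨hy, fun _ => ?_⟩
  by_contra h0
  have hne : y 0 ≠ 0 := by
    intro h
    unfold form at hy
    rw [h] at hy
    have : 0 ≤ ∑ i : Fin n, y i.succ * y i.succ :=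
      Finset.sum_nonneg fun i _ => mul_self_nonneg _
    linarith
  have hpos : 0 < (-y) 0 := by
    have : y 0 < 0 := lt_of_le_of_ne (not_lt.1 h0) hne
    simpa using this
  have := form_neg_of_causal hx (y := -y) (by rw [form_neg_left, form_neg_right, hy]; norm_num) hpos
  rw [form_neg_right] at this
  linarith

theorem sq_eq_one_of_sign (hε : ε = 1 ∨ ε = -1) : ε * ε = 1 := by
  rcases hε with rfl | rfl <;> norm_num

/-- The component of `v` tangent to the space form at `x`. -/
def tangentPart (ε : ℝ) (v x : Vec n) : Vec n := v - (ε * form ε x v) • x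

theorem form_tangentPart (hε : ε = 1 ∨ ε = -1) {x : Vec n} (hx : x ∈ spaceForm n ε)
    (v : Vec n) : form ε x (tangentPart ε v x) = 0 := by
  have h2 := sq_eq_one_of_sign hε
  rw [tangentPart, form_sub_right, form_smul_right, hx.1]
  linear_combination (-form ε x v) * h2

theorem form_tangentPart_of_tangent {x w : Vec n} (hw : form ε x w = 0) (v : Vec n) :
    form ε w (tangentPart ε v x) = form ε w v := by
  rw [tangentPart, form_sub_right, form_smul_right, form_comm w x, hw]
  ring

theorem form_tangentPart_self (hε : ε = 1 ∨ ε = -1) {x : Vec n} (hx : x ∈ spaceForm n ε)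
    (v : Vec n) : form ε (tangentPart ε v x) (tangentPart ε v x)
      = form ε v v - ε * form ε x v ^ 2 := by
  rw [form_tangentPart_of_tangent (form_tangentPart hε hx v), tangentPart, form_sub_left,
    form_smul_left]
  ring

theorem form_sub_nonneg (hε : ε = 1 ∨ ε = -1) {x : Vec n} (hx : x ∈ spaceForm n ε)
    (v : Vec n) : 0 ≤ form ε v v - ε * form ε x v ^ 2 := by
  rw [← form_tangentPart_self hε hx]
  exact form_self_nonneg hε hx (form_tangentPart hε hx v)

/-- The value of `form ε v v` for an axis `v`. -/
theorem eq_smul_of_form_sub_eq_zero (hε : ε = 1 ∨ ε = -1) {x v : Vec n} (hx : x ∈ spaceForm n ε)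
    (h : form ε v v - ε * form ε x v ^ 2 = 0) : v = (ε * form ε x v) • x := by
  rw [← form_tangentPart_self hε hx] at h
  exact sub_eq_zero.1 (eq_zero_of_form_self hε hx (form_tangentPart hε hx v) h)

/-- When the tangential part of `v` vanishes, `v` is a multiple of `x`, so it is neither null and
nonzero nor spacelike in the Lorentzian case. Hence the orbits degenerate only in the elliptic case,
and there only at `x = ±v`. -/
theorem IsAxis.form_of_form_sub_eq_zero (hε : ε = 1 ∨ ε = -1) {x v : Vec n} (hv : IsAxis ε v)
    (hx : x ∈ spaceForm n ε) (h : form ε v v - ε * form ε x v ^ 2 = 0) :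
    form ε v v = ε ∧ form ε x v ^ 2 = 1 ∧ x = (ε * form ε x v) • v := by
  have hvx := eq_smul_of_form_sub_eq_zero hε hx h
  have h2 := sq_eq_one_of_sign hε
  have hm : form ε v v = ε := by
    rcases hv with hv | ⟨rfl, hv, hv0⟩ | ⟨rfl, hv⟩
    · exact hv.1
    · rw [hv] at h
      have : form (-1) x v = 0 := by
        have : form (-1) x v ^ 2 = 0 := by linarith
        simpa using this
      rw [this] at hvx
      rw [hvx] at hv0
      simp at hv0
    · nlinarith [sq_nonneg (form (-1) x v)]
  have hc : form ε x v ^ 2 = 1 := by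
    rw [hm] at h
    linear_combination (1 - form ε x v ^ 2) * h2 - ε * h
  refine ⟨hm, hc, ?_⟩
  conv_rhs => rw [hvx]
  rw [form_smul_right, hx.1, smul_smul]
  have : ε * (ε * form ε x v * ε) * (ε * form ε x v) = 1 := by
    linear_combination form ε x v ^ 2 * (ε * ε + 1) * h2 + hc
  rw [this, one_smul]

end Form

/-! ### Parametrized hypersurfaces -/

/-- `X` parametrizes regularly a piece of a hypersurface of `Q_ε^n × ℝ`. -/
structure IsPatch {n : ℕ} (ε : ℝ) (U : Set (Coord n)) (X : Coord n → Amb n) : Prop where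
  isOpen : IsOpen U
  smooth : ContDiffOn ℝ ∞ X U
  mem : ∀ y ∈ U, X y ∈ productSpace n ε
  inj : ∀ y ∈ U, Function.Injective (fderiv ℝ X y)

/-- The derivative of `X` in the direction `u`. -/
def dirDeriv {n : ℕ} {E : Type*} [NormedAddCommGroup E] [NormedSpace ℝ E] (X : Coord n → E)
    (u : Fin n → ℝ) (y : Coord n) : E :=
  ∑ i, u i • partialDeriv i X y

/-- The second derivative of `X` in the directions `u` and `w`. -/
def secondDeriv {n : ℕ} {E : Type*} [NormedAddCommGroup E] [NormedSpace ℝ E] (X : Coord n → E)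
    (u w : Fin n → ℝ) (y : Coord n) : E :=
  ∑ i, ∑ j, (u i * w j) • partialDeriv i (partialDeriv j X) y

section Patch

variable {n : ℕ} {ε : ℝ} {U : Set (Coord n)} {X : Coord n → Amb n}

theorem dirDeriv_eq_fderiv {E : Type*} [NormedAddCommGroup E] [NormedSpace ℝ E] (X : Coord n → E)
    (u : Fin n → ℝ) (y : Coord n) : dirDeriv X u y = fderiv ℝ X y (WithLp.toLp 2 u) := by
  rw [fderiv_apply_eq_sum]; rfl

theorem dirDeriv_add {E : Type*} [NormedAddCommGroup E] [NormedSpace ℝ E] (X : Coord n → E)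
    (u w : Fin n → ℝ) (y : Coord n) : dirDeriv X (u + w) y = dirDeriv X u y + dirDeriv X w y := by
  simp [dirDeriv, add_smul, Finset.sum_add_distrib]

theorem dirDeriv_smul {E : Type*} [NormedAddCommGroup E] [NormedSpace ℝ E] (X : Coord n → E)
    (a : ℝ) (u : Fin n → ℝ) (y : Coord n) : dirDeriv X (a • u) y = a • dirDeriv X u y := by
  simp [dirDeriv, mul_smul, Finset.smul_sum]

theorem inducedMetric_eq_gram (X : Coord n → Amb n) : inducedMetric ε X = gram (prodL n ε) X := rfl

theorem IsPatch.dirDeriv_ne_zero (h : IsPatch ε U X) {y : Coord n} (hy : y ∈ U) {u : Fin n → ℝ}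
    (hu : u ≠ 0) : dirDeriv X u y ≠ 0 := by
  intro h0
  rw [dirDeriv_eq_fderiv] at h0
  have := h.inj y hy (h0.trans (map_zero _).symm)
  exact hu ((WithLp.toLp_eq_zero 2).1 this)

theorem IsPatch.partialDeriv_fst (h : IsPatch ε U X) {y : Coord n} (hy : y ∈ U) (i : Fin n) :
    partialDeriv i (fun z => (X z).1) y = (partialDeriv i X y).1 := by
  have := (differentiableAt_of_smooth h.isOpen h.smooth hy).hasFDerivAt.fst
  unfold partialDeriv
  rw [this.fderiv]; rfl

theorem IsPatch.partialDeriv_snd (h : IsPatch ε U X) {y : Coord n} (hy : y ∈ U) (i : Fin n) :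
    partialDeriv i (fun z => (X z).2) y = (partialDeriv i X y).2 := by
  have := (differentiableAt_of_smooth h.isOpen h.smooth hy).hasFDerivAt.snd
  unfold partialDeriv
  rw [this.fderiv]; rfl

theorem IsPatch.smooth_fst (h : IsPatch ε U X) : ContDiffOn ℝ ∞ (fun z => (X z).1) U := h.smooth.fst

theorem IsPatch.smooth_snd (h : IsPatch ε U X) : ContDiffOn ℝ ∞ (fun z => (X z).2) U := h.smooth.snd

theorem IsPatch.form_partialDeriv (h : IsPatch ε U X) {y : Coord n} (hy : y ∈ U) (i : Fin n) :
    form ε (X y).1 (partialDeriv i X y).1 = 0 := by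
  have h1 : partialDeriv i (fun z => formL n ε (X z).1 (X z).1) y
      = partialDeriv i (fun _ => ε) y :=
    partialDeriv_congr h.isOpen (fun z hz => (h.mem z hz).1.1) hy i
  have hd := differentiableAt_of_smooth h.isOpen h.smooth_fst hy
  rw [partialDeriv_bilin _ hd hd, h.partialDeriv_fst hy] at h1
  have h2 : partialDeriv i (fun _ : Coord n => ε) y = 0 := by simp [partialDeriv]
  rw [h2, formL_apply, formL_apply, form_comm _ (X y).1] at h1
  linarith

theorem IsPatch.form_dirDeriv (h : IsPatch ε U X) {y : Coord n} (hy : y ∈ U) (u : Fin n → ℝ) :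
    form ε (X y).1 (dirDeriv X u y).1 = 0 := by
  have : form ε (X y).1 (dirDeriv X u y).1 = ∑ i, u i * form ε (X y).1 (partialDeriv i X y).1 := by
    simp only [dirDeriv, Prod.fst_sum, Prod.smul_fst, ← formL_apply, map_sum, map_smul, smul_eq_mul]
  rw [this]
  simp [h.form_partialDeriv hy]

theorem IsPatch.form_secondDeriv (h : IsPatch ε U X) {y : Coord n} (hy : y ∈ U) (i j : Fin n) :
    form ε (X y).1 (partialDeriv i (partialDeriv j X) y).1
      = -form ε (partialDeriv i X y).1 (partialDeriv j X y).1 := by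
  have hXj := contDiffOn_partialDeriv h.isOpen h.smooth j
  have h1 : partialDeriv i (fun z => formL n ε (X z).1 (partialDeriv j X z).1) y
      = partialDeriv i (fun _ => (0 : ℝ)) y :=
    partialDeriv_congr h.isOpen (fun z hz => h.form_partialDeriv hz j) hy i
  have hd := differentiableAt_of_smooth h.isOpen h.smooth_fst hy
  have hdj := differentiableAt_of_smooth h.isOpen hXj hy
  have h3 : partialDeriv i (fun z => (partialDeriv j X z).1) y
      = (partialDeriv i (partialDeriv j X) y).1 := by
    unfold partialDeriv at hdj ⊢
    rw [hdj.hasFDerivAt.fst.fderiv]; rfl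
  rw [partialDeriv_bilin _ hd hdj.fst, h.partialDeriv_fst hy, h3] at h1
  have h2 : partialDeriv i (fun _ : Coord n => (0 : ℝ)) y = 0 := by simp [partialDeriv]
  rw [h2, formL_apply, formL_apply] at h1
  linarith

theorem metricForm_inducedMetric (y : Coord n) (u w : Fin n → ℝ) :
    metricForm (inducedMetric ε X) y u w = prodForm ε (dirDeriv X u y) (dirDeriv X w y) := by
  simp only [metricForm, inducedMetric_eq_gram, gram, Matrix.of_apply, dirDeriv, ← prodL_apply,
    map_sum, map_smul, sum_apply, smul_apply, smul_eq_mul, Finset.mul_sum]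
  rw [Finset.sum_comm]
  refine Finset.sum_congr rfl fun i _ => Finset.sum_congr rfl fun j _ => by ring

theorem IsPatch.prodForm_pos (hε : ε = 1 ∨ ε = -1) (h : IsPatch ε U X) {y : Coord n} (hy : y ∈ U)
    {u : Fin n → ℝ} (hu : u ≠ 0) : 0 < prodForm ε (dirDeriv X u y) (dirDeriv X u y) := by
  have hx := (h.mem y hy).1
  refine lt_of_le_of_ne (prodForm_self_nonneg hε hx (h.form_dirDeriv hy u)) fun h0 => ?_
  exact h.dirDeriv_ne_zero hy hu (eq_zero_of_prodForm_self hε hx (h.form_dirDeriv hy u) h0.symm)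

theorem IsPatch.isUnit_det (hε : ε = 1 ∨ ε = -1) (h : IsPatch ε U X) {y : Coord n} (hy : y ∈ U) :
    IsUnit (gram (prodL n ε) X y).det := by
  rw [isUnit_iff_ne_zero]
  intro h0
  obtain ⟨u, hu, hu0⟩ := Matrix.exists_mulVec_eq_zero_iff.2 h0
  refine (h.prodForm_pos hε hy hu).ne' ?_
  rw [← metricForm_inducedMetric, inducedMetric_eq_gram]
  have : metricForm (gram (prodL n ε) X) y u u = u ⬝ᵥ (gram (prodL n ε) X y).mulVec u := by
    simp only [metricForm, dotProduct, Matrix.mulVec, Finset.mul_sum]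
    refine Finset.sum_congr rfl fun i _ => Finset.sum_congr rfl fun j _ => by ring
  rw [this, hu0, dotProduct_zero]

theorem IsPatch.gram_pos (hε : ε = 1 ∨ ε = -1) (h : IsPatch ε U X) {y : Coord n} (hy : y ∈ U)
    {u w : Fin n → ℝ} (hl : LinearIndependent ℝ ![u, w]) :
    0 < prodForm ε (dirDeriv X u y) (dirDeriv X u y) * prodForm ε (dirDeriv X w y) (dirDeriv X w y)
      - prodForm ε (dirDeriv X u y) (dirDeriv X w y) ^ 2 := by
  have hu : u ≠ 0 := hl.ne_zero 0
  have ha := h.prodForm_pos hε hy hu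
  set a := prodForm ε (dirDeriv X u y) (dirDeriv X u y) with ha'
  set b := prodForm ε (dirDeriv X u y) (dirDeriv X w y) with hb'
  -- Up to the factor `a`, the component of `w` orthogonal to `u`; the square of its image is `a`
  -- times the Gram determinant.
  have hz : a • w + (-b) • u ≠ 0 := by
    intro h0
    have := LinearIndependent.pair_iff.1 hl (-b) a (by rw [add_comm]; exact h0)
    exact ha.ne' this.2
  have hp := h.prodForm_pos hε hy hz
  rw [dirDeriv_add, dirDeriv_smul, dirDeriv_smul, prodForm_add_left, prodForm_smul_left,
    prodForm_smul_left, prodForm_comm, prodForm_add_left, prodForm_smul_left,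
    prodForm_smul_left, prodForm_comm (dirDeriv X u y) (_ + _), prodForm_add_left,
    prodForm_smul_left, prodForm_smul_left, ← ha', ← hb', prodForm_comm _ (dirDeriv X u y),
    ← hb'] at hp
  have : 0 < a * (a * prodForm ε (dirDeriv X w y) (dirDeriv X w y) - b ^ 2) := by
    linarith
  exact pos_of_mul_pos_right this ha.le

/-- A dimension count: the image of `dX`, the position vector `(x, 0)` and `N` are independent and
fill the `n + 2` dimensions. A vector orthogonal to all of them is orthogonal to itself and tangent
to the product, where the form is definite. -/
theorem IsPatch.eq_zero_of_orthogonal (hε : ε = 1 ∨ ε = -1) (h : IsPatch ε U X) {y : Coord n}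
    (hy : y ∈ U) {N Z : Amb n} (hN : form ε (X y).1 N.1 = 0)
    (hNX : ∀ i, prodForm ε N (partialDeriv i X y) = 0) (hN0 : N ≠ 0)
    (hZ : form ε (X y).1 Z.1 = 0) (hZX : ∀ i, prodForm ε Z (partialDeriv i X y) = 0)
    (hZN : prodForm ε Z N = 0) : Z = 0 := by
  have hx := (h.mem y hy).1
  have hε2 := sq_eq_one_of_sign hε
  have hNN : prodForm ε N N ≠ 0 := fun h0 => hN0 (eq_zero_of_prodForm_self hε hx hN h0)
  have ortho : ∀ W : Amb n, (∀ i, prodForm ε W (partialDeriv i X y) = 0) →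
      ∀ u : Coord n, prodForm ε W (fderiv ℝ X y u) = 0 := by
    intro W hW u
    rw [fderiv_apply_eq_sum]
    simp only [← prodL_apply, map_sum, map_smul, smul_eq_mul] at hW ⊢
    simp [hW]
  have tang : ∀ u : Coord n, form ε (X y).1 (fderiv ℝ X y u).1 = 0 := by
    intro u
    simpa [dirDeriv_eq_fderiv] using h.form_dirDeriv hy u.ofLp
  let Φ : (Coord n × ℝ × ℝ) →ₗ[ℝ] Amb n :=
    (fderiv ℝ X y : Coord n →ₗ[ℝ] Amb n).coprod
      ((LinearMap.toSpanSingleton ℝ (Amb n) ((X y).1, 0)).coprod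
        (LinearMap.toSpanSingleton ℝ (Amb n) N))
  have hΦ : ∀ u r s, Φ (u, r, s) = fderiv ℝ X y u + (r • ((X y).1, 0) + s • N) := fun u r s => rfl
  have e1 : ∀ u r s, form ε (X y).1 (Φ (u, r, s)).1 = r * ε := by
    intro u r s
    rw [hΦ]
    simp only [Prod.fst_add, Prod.smul_fst, form_add_right, form_smul_right, tang, hx.1, hN]
    ring
  have e2 : ∀ u r s, prodForm ε N (Φ (u, r, s)) = s * prodForm ε N N := by
    intro u r s
    rw [hΦ, prodForm_comm, prodForm_add_left, prodForm_comm, ortho N hNX, prodForm_add_left,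
      prodForm_smul_left, prodForm_smul_left]
    have : prodForm ε ((X y).1, 0) N = 0 := by simp [prodForm, hN]
    rw [this]; ring
  have hinj : Function.Injective Φ := by
    rw [← LinearMap.ker_eq_bot, LinearMap.ker_eq_bot']
    rintro ⟨u, r, s⟩ h0
    have hr : r = 0 := by
      have := e1 u r s
      rw [h0, Prod.fst_zero, form_zero_right] at this
      have : r * ε * ε = 0 := by rw [← this]; ring
      rwa [mul_assoc, hε2, mul_one] at this
    have hs : s = 0 := by
      have := e2 u r s
      have h0' : prodForm ε N 0 = 0 := by simp [prodForm, form_zero_right]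
      rw [h0, h0'] at this
      exact (mul_eq_zero.1 this.symm).resolve_right hNN
    subst hr hs
    rw [hΦ] at h0
    have : u = 0 := h.inj y hy (by simpa using h0)
    rw [this]; rfl
  have hsurj : Function.Surjective Φ := by
    refine (LinearMap.injective_iff_surjective_of_finrank_eq_finrank ?_).1 hinj
    simp [Module.finrank_prod]
  obtain ⟨⟨u, r, s⟩, hu⟩ := hsurj Z
  have hr : r = 0 := by
    have := e1 u r s
    rw [hu, hZ] at this
    have : r * ε * ε = 0 := by rw [← this]; ring
    rwa [mul_assoc, hε2, mul_one] at this
  have hs : s = 0 := by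
    have := e2 u r s
    rw [hu, prodForm_comm, hZN] at this
    simpa [hNN] using this.symm
  refine eq_zero_of_prodForm_self hε hx hZ ?_
  have hZu : Z = fderiv ℝ X y u := by rw [← hu, hΦ, hr, hs]; simp
  nth_rw 2 [hZu]
  exact ortho Z hZX u

/-- In the flat space `ℝ^{n+1} × ℝ` the hypersurface has codimension two, with normal space spanned
by `(x, 0)` and `N`. The `(x, 0)` component produces the curvature of the space form in the Gauss
equation, the `N` component the second fundamental form. -/
theorem IsPatch.sub_tangentialPart_eq (hε : ε = 1 ∨ ε = -1) (h : IsPatch ε U X) {y : Coord n}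
    (hy : y ∈ U) {N : Amb n} (hN : form ε (X y).1 N.1 = 0)
    (hNX : ∀ i, prodForm ε N (partialDeriv i X y) = 0) (hN0 : N ≠ 0) (i j : Fin n) :
    partialDeriv i (partialDeriv j X) y - tangentialPart (prodL n ε) X i j y
      = (-ε * form ε (partialDeriv i X y).1 (partialDeriv j X y).1) • ((X y).1, (0 : ℝ))
        + (prodForm ε (partialDeriv i (partialDeriv j X) y) N / prodForm ε N N) • N := by
  have hx := (h.mem y hy).1
  have hε2 := sq_eq_one_of_sign hε
  have hNN : prodForm ε N N ≠ 0 := fun h0 => hN0 (eq_zero_of_prodForm_self hε hx hN h0)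
  have hxN : prodForm ε ((X y).1, (0 : ℝ)) N = 0 := by simp [prodForm, hN]
  have tx : form ε (X y).1 (tangentialPart (prodL n ε) X i j y).1 = 0 := by
    simp only [tangentialPart, Prod.fst_sum, Prod.smul_fst, ← formL_apply, map_sum, map_smul,
      smul_eq_mul]
    simp [h.form_partialDeriv hy]
  have tN : prodForm ε (tangentialPart (prodL n ε) X i j y) N = 0 := by
    rw [prodForm_comm]
    simp only [tangentialPart, ← prodL_apply, map_sum, map_smul, smul_eq_mul]
    simp [hNX]
  rw [← sub_eq_zero]
  refine h.eq_zero_of_orthogonal hε hy hN hNX hN0 ?_ ?_ ?_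
  · simp only [Prod.fst_sub, Prod.fst_add, Prod.smul_fst, form_sub_right, form_add_right,
      form_smul_right, tx, h.form_secondDeriv hy, hN, hx.1]
    linear_combination form ε (partialDeriv i X y).1 (partialDeriv j X y).1 * hε2
  · intro m
    have := bilin_sub_tangentialPart (b := prodL n ε) prodForm_comm h.isOpen h.smooth hy
      (h.isUnit_det hε hy) i j m
    rw [prodL_apply] at this
    rw [prodForm_sub_left, this, prodForm_add_left, prodForm_smul_left, prodForm_smul_left, hNX]
    have : prodForm ε ((X y).1, (0 : ℝ)) (partialDeriv m X y) = 0 := by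
      simp [prodForm, h.form_partialDeriv hy]
    rw [this]; ring
  · rw [prodForm_sub_left, prodForm_sub_left, tN, prodForm_add_left, prodForm_smul_left,
      prodForm_smul_left, hxN]
    field_simp
    ring

/-- The Gauss equation of a hypersurface of `Q_ε^n × ℝ`; `N` is a normal vector. -/
theorem IsPatch.curvatureForm_eq (hε : ε = 1 ∨ ε = -1) (h : IsPatch ε U X) {y : Coord n}
    (hy : y ∈ U) {N : Amb n} (hN : form ε (X y).1 N.1 = 0)
    (hNX : ∀ i, prodForm ε N (partialDeriv i X y) = 0) (hN0 : N ≠ 0) (u w : Fin n → ℝ) :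
    curvatureForm (inducedMetric ε X) y u w w u
      = ε * (form ε (dirDeriv X u y).1 (dirDeriv X u y).1
          * form ε (dirDeriv X w y).1 (dirDeriv X w y).1
          - form ε (dirDeriv X u y).1 (dirDeriv X w y).1 ^ 2)
        + (prodForm ε (secondDeriv X u u y) N * prodForm ε (secondDeriv X w w y) N
          - prodForm ε (secondDeriv X u w y) N ^ 2) / prodForm ε N N := by
  have hx := (h.mem y hy).1
  have hε2 := sq_eq_one_of_sign hε
  have hNN : prodForm ε N N ≠ 0 := fun h0 => hN0 (eq_zero_of_prodForm_self hε hx hN h0)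
  set G : Fin n → Fin n → ℝ := fun i j => form ε (partialDeriv i X y).1 (partialDeriv j X y).1
    with hG
  set H : Fin n → Fin n → ℝ := fun i j => prodForm ε (partialDeriv i (partialDeriv j X) y) N
    with hH
  have hGf : ∀ a b : Fin n → ℝ, form ε (dirDeriv X a y).1 (dirDeriv X b y).1
      = ∑ i, ∑ j, a i * b j * G i j := by
    intro a b
    simp only [hG, dirDeriv, Prod.fst_sum, Prod.smul_fst, ← formL_apply, map_sum, map_smul,
      sum_apply, smul_apply, smul_eq_mul, Finset.mul_sum]
    rw [Finset.sum_comm]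
    refine Finset.sum_congr rfl fun i _ => Finset.sum_congr rfl fun j _ => by ring
  have hHf : ∀ a b : Fin n → ℝ, prodForm ε (secondDeriv X a b y) N
      = ∑ i, ∑ j, a i * b j * H i j := by
    intro a b
    simp only [hH, secondDeriv, ← prodL_apply, map_sum, map_smul, sum_apply, smul_apply,
      smul_eq_mul]
  have hR : ∀ i j k m, ∑ l, riemann (gram (prodL n ε) X) l i j k y * gram (prodL n ε) X y l m
      = ε * (G j k * G i m - G i k * G j m)
        + (H j k * H i m - H i k * H j m) / prodForm ε N N := by
    intro i j k m
    rw [sum_riemann_mul_gram (b := prodL n ε) prodForm_comm h.isOpen h.smooth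
      (fun z hz => h.isUnit_det hε hz) hy]
    have hII : ∀ a b c d : Fin n, prodL n ε (partialDeriv a (partialDeriv b X) y
        - tangentialPart (prodL n ε) X a b y) (partialDeriv c (partialDeriv d X) y)
        = ε * (G a b * G c d) + H a b * H c d / prodForm ε N N := by
      intro a b c d
      rw [prodL_apply, h.sub_tangentialPart_eq hε hy hN hNX hN0, prodForm_add_left,
        prodForm_smul_left, prodForm_smul_left,
        prodForm_comm N (partialDeriv c (partialDeriv d X) y)]
      have : prodForm ε ((X y).1, (0 : ℝ)) (partialDeriv c (partialDeriv d X) y) = -G c d := by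
        simp [prodForm, h.form_secondDeriv hy, hG]
      rw [this]
      simp only [hG, hH]
      ring
    rw [hII, hII]
    ring
  have hcurv : curvatureForm (inducedMetric ε X) y u w w u
      = ∑ i, ∑ j, ∑ k, ∑ m, u i * w j * w k * u m *
        (ε * (G j k * G i m - G i k * G j m)
        + (H j k * H i m - H i k * H j m) / prodForm ε N N) := by
    unfold curvatureForm
    rw [inducedMetric_eq_gram]
    refine Finset.sum_congr rfl fun i _ => Finset.sum_congr rfl fun j _ =>
      Finset.sum_congr rfl fun k _ => ?_
    rw [Finset.sum_comm]
    refine Finset.sum_congr rfl fun m _ => ?_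
    rw [← hR, Finset.mul_sum]
    refine Finset.sum_congr rfl fun l _ => by ring
  have hprod1 : ∀ B : Fin n → Fin n → ℝ,
      ∑ i, ∑ j, ∑ k, ∑ m, u i * w j * w k * u m * (B j k * B i m)
      = (∑ i, ∑ j, u i * u j * B i j) * ∑ i, ∑ j, w i * w j * B i j := by
    intro B
    simp_rw [Finset.sum_mul_sum]
    refine Finset.sum_congr rfl fun i _ => ?_
    refine Finset.sum_congr rfl fun j _ => ?_
    rw [Finset.sum_comm]
    refine Finset.sum_congr rfl fun m _ => Finset.sum_congr rfl fun k _ => by ring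
  have hprod2 : ∀ B : Fin n → Fin n → ℝ, (∀ i j, B i j = B j i) →
      ∑ i, ∑ j, ∑ k, ∑ m, u i * w j * w k * u m * (B i k * B j m)
      = (∑ i, ∑ j, u i * w j * B i j) ^ 2 := by
    intro B hB
    rw [sq]
    simp_rw [Finset.sum_mul_sum]
    refine Finset.sum_congr rfl fun i _ => ?_
    calc _ = ∑ j, ∑ m, ∑ k, u i * w j * w k * u m * (B i k * B j m) :=
          Finset.sum_congr rfl fun j _ => Finset.sum_comm
      _ = ∑ m, ∑ j, ∑ k, u i * w j * w k * u m * (B i k * B j m) := Finset.sum_comm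
      _ = ∑ m, ∑ k, ∑ j, u i * w j * w k * u m * (B i k * B j m) :=
          Finset.sum_congr rfl fun m _ => Finset.sum_comm
      _ = _ := by
          refine Finset.sum_congr rfl fun m _ => Finset.sum_congr rfl fun k _ =>
            Finset.sum_congr rfl fun j _ => ?_
          rw [hB j m]; ring
  have hGs : ∀ i j, G i j = G j i := fun i j => form_comm _ _
  have hHs : ∀ i j, H i j = H j i := fun i j => by
    simp only [hH]; rw [partialDeriv_comm h.isOpen h.smooth hy]
  rw [hcurv, hGf, hGf, hGf, hHf, hHf, hHf, ← hprod1, ← hprod1, ← hprod2 G hGs, ← hprod2 H hHs]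
  simp_rw [← Finset.sum_sub_distrib, Finset.sum_div, Finset.mul_sum, ← Finset.sum_add_distrib]
  refine Finset.sum_congr rfl fun i _ => Finset.sum_congr rfl fun j _ =>
    Finset.sum_congr rfl fun k _ => Finset.sum_congr rfl fun m _ => by ring

theorem IsPatch.sectionalCurvature_eq_iff (hε : ε = 1 ∨ ε = -1) (h : IsPatch ε U X) {y : Coord n}
    (hy : y ∈ U) {N : Amb n} (hN : form ε (X y).1 N.1 = 0)
    (hNX : ∀ i, prodForm ε N (partialDeriv i X y) = 0) (hN0 : N ≠ 0) {u w : Fin n → ℝ}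
    (hl : LinearIndependent ℝ ![u, w]) (K : ℝ) :
    sectionalCurvature (inducedMetric ε X) y u w = K ↔
      ε * (form ε (dirDeriv X u y).1 (dirDeriv X u y).1
          * form ε (dirDeriv X w y).1 (dirDeriv X w y).1
          - form ε (dirDeriv X u y).1 (dirDeriv X w y).1 ^ 2)
        + (prodForm ε (secondDeriv X u u y) N * prodForm ε (secondDeriv X w w y) N
          - prodForm ε (secondDeriv X u w y) N ^ 2) / prodForm ε N N
      = K * (prodForm ε (dirDeriv X u y) (dirDeriv X u y)
        * prodForm ε (dirDeriv X w y) (dirDeriv X w y)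
        - prodForm ε (dirDeriv X u y) (dirDeriv X w y) ^ 2) := by
  rw [← h.curvatureForm_eq hε hy hN hNX hN0, sectionalCurvature, metricForm_inducedMetric,
    metricForm_inducedMetric, metricForm_inducedMetric]
  exact div_eq_iff (h.gram_pos hε hy hl).ne'

end Patch

/-! ### One-parameter groups of symmetries -/

section Symmetry

variable {n : ℕ} {ε : ℝ}

/-- The infinitesimal isometry `z ↦ ⟨a, z⟩ b - ⟨b, z⟩ a`. -/
def rotationGenerator (ε : ℝ) (a b : Vec n) : Vec n →L[ℝ] Vec n :=
  (formL n ε a).smulRight b - (formL n ε b).smulRight a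

theorem rotationGenerator_apply (a b z : Vec n) :
    rotationGenerator ε a b z = form ε a z • b - form ε b z • a := by
  simp [rotationGenerator]

theorem form_rotationGenerator (a b z w : Vec n) :
    form ε (rotationGenerator ε a b z) w + form ε z (rotationGenerator ε a b w) = 0 := by
  simp only [rotationGenerator_apply, form_sub_left, form_smul_left, form_comm z]
  ring

theorem hasDerivAt_exp_apply (B : Vec n →L[ℝ] Vec n) (z : Vec n) (s : ℝ) :
    HasDerivAt (fun r : ℝ => NormedSpace.exp (r • B) z) (B (NormedSpace.exp (s • B) z)) s := by
  have h := hasDerivAt_exp_smul_const' (𝕂 := ℝ) B s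
  simpa using h.clm_apply (hasDerivAt_const s z)

theorem form_exp_rotationGenerator (a b z w : Vec n) (s : ℝ) :
    form ε (NormedSpace.exp (s • rotationGenerator ε a b) z)
      (NormedSpace.exp (s • rotationGenerator ε a b) w) = form ε z w := by
  set B := rotationGenerator ε a b with hB
  have hd : ∀ r : ℝ, HasDerivAt (fun r : ℝ => formL n ε (NormedSpace.exp (r • B) z)
      (NormedSpace.exp (r • B) w)) 0 r := by
    intro r
    have h := ((formL n ε).hasFDerivAt.comp_hasDerivAt r (hasDerivAt_exp_apply B z r)).clm_apply
      (hasDerivAt_exp_apply B w r)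
    have h0 := form_rotationGenerator (ε := ε) a b (NormedSpace.exp (r • B) z)
      (NormedSpace.exp (r • B) w)
    rw [← hB] at h0
    exact h.congr_deriv h0
  have := is_const_of_deriv_eq_zero (fun r => (hd r).differentiableAt) (fun r => (hd r).deriv) s 0
  simpa using this

/-- The generator is skew for the form and kills `v`, so its flow preserves the form and fixes `v`.
-/
theorem exp_rotationGenerator_mem (hε : ε = 1 ∨ ε = -1) {v a b : Vec n} (ha : form ε a v = 0)
    (hb : form ε b v = 0) (s : ℝ) :
    NormedSpace.exp (s • rotationGenerator ε a b) ∈ symmetryGroup ε v := by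
  refine ⟨fun x y => form_exp_rotationGenerator a b x y s, fun x hx => ⟨?_, ?_⟩, ?_⟩
  · rw [form_exp_rotationGenerator]; exact hx.1
  · rintro rfl
    set φ : ℝ → ℝ := fun r => (NormedSpace.exp (r • rotationGenerator (-1) a b) x) 0 with hφ
    have hcont : Continuous φ := continuous_iff_continuousAt.2 fun r =>
      (continuousAt_apply 0 _).comp
        (hasDerivAt_exp_apply (rotationGenerator (-1) a b) x r).continuousAt
    have h0 : 0 < φ 0 := by simpa [hφ] using hx.2 rfl
    -- No vector of square `-1` has vanishing time coordinate, so by continuity the flow cannot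
    -- change the sheet.
    have hne : ∀ r, φ r ≠ 0 := by
      intro r hr
      have h1 : form (-1) _ _ = _ := form_exp_rotationGenerator (ε := -1) a b x x r
      rw [hx.1] at h1
      unfold form at h1
      simp only [hφ] at hr
      rw [hr] at h1
      have : 0 ≤ ∑ i : Fin n, (NormedSpace.exp (r • rotationGenerator (-1) a b) x) i.succ *
          (NormedSpace.exp (r • rotationGenerator (-1) a b) x) i.succ :=
        Finset.sum_nonneg fun i _ => mul_self_nonneg _
      linarith
    by_contra hs
    obtain ⟨r, hr⟩ := mem_range_of_exists_le_of_exists_ge hcont ⟨s, not_lt.1 hs⟩ ⟨0, h0.le⟩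
    exact hne r hr
  · have hd : ∀ r : ℝ, HasDerivAt (fun r : ℝ =>
        NormedSpace.exp (r • rotationGenerator ε a b) v) 0 r := by
      intro r
      have h := hasDerivAt_exp_smul_const (𝕂 := ℝ) (rotationGenerator ε a b) r
      have := h.clm_apply (hasDerivAt_const r v)
      simpa [rotationGenerator_apply, ha, hb] using this
    have := is_const_of_deriv_eq_zero (fun r => (hd r).differentiableAt) (fun r => (hd r).deriv) s 0
    simpa using this

/-- A curve that runs in every piece of an immersed submanifold around a point is tangent to it. -/
theorem mem_range_of_curve {X : Coord n → Amb n} {X' : Coord n →L[ℝ] Amb n} {y : Coord n}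
    (hX : HasStrictFDerivAt X X' y) (hinj : Function.Injective X') {γ : ℝ → Amb n} {γ' : Amb n}
    (hγ : HasDerivAt γ γ' 0) (h0 : γ 0 = X y) (hmem : ∀ V ∈ 𝓝 y, ∀ᶠ s in 𝓝 (0 : ℝ), γ s ∈ X '' V) :
    γ' ∈ range X' := by
  obtain ⟨L₀, hL₀⟩ := (X' : Coord n →ₗ[ℝ] Amb n).exists_leftInverse_of_injective
    (LinearMap.ker_eq_bot.2 hinj)
  set L : Amb n →L[ℝ] Coord n := L₀.toContinuousLinearMap with hL
  have hLX : L.comp X' = ContinuousLinearEquiv.refl ℝ (Coord n) := by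
    ext1 u
    exact LinearMap.congr_fun hL₀ u
  have hg : HasStrictFDerivAt (fun z => L (X z))
      ((ContinuousLinearEquiv.refl ℝ (Coord n) : Coord n ≃L[ℝ] Coord n) : Coord n →L[ℝ] Coord n)
      y := by
    rw [← hLX]
    exact L.hasStrictFDerivAt.comp y hX
  set ψ := hg.localInverse with hψ
  have hψd := hg.to_localInverse.hasFDerivAt
  -- For small `s` the point `γ s` has a parameter so close to `y` that `ψ` recovers it from `L (γ
  -- s)`. This exhibits `γ` as `X` composed with a differentiable curve, and the chain rule
  -- finishes.
  have hev : ∀ᶠ s in 𝓝 (0 : ℝ), γ s = X (ψ (L (γ s))) := by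
    filter_upwards [hmem _ hg.eventually_left_inverse] with s hs
    obtain ⟨z, hz, hzs⟩ := hs
    rw [← hzs]
    exact congrArg X (Eq.symm hz)
  have hc1 : HasDerivAt (fun s => L (γ s)) (L γ') 0 := L.hasFDerivAt.comp_hasDerivAt 0 hγ
  have hψ0 : ψ (L (γ 0)) = y := by
    rw [h0]; exact hg.eventually_left_inverse.self_of_nhds
  have hc2 : HasDerivAt (fun s => ψ (L (γ s))) (L γ') 0 := by
    rw [← h0] at hψd
    exact hψd.comp_hasDerivAt 0 hc1
  have hc3 : HasDerivAt (fun s => X (ψ (L (γ s)))) (X' (L γ')) 0 := by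
    have hX0 := hX.hasFDerivAt
    rw [← hψ0] at hX0
    exact hX0.comp_hasDerivAt 0 hc2
  exact ⟨L γ', (hc3.congr_of_eventuallyEq hev).unique hγ⟩

/-- A parametrized hypersurface is infinitesimally symmetric with respect to the axis `v`: away
from the axis it is tangent to the orbits of the isometries. -/
def IsTangentToOrbits (ε : ℝ) (v : Vec n) (U : Set (Coord n)) (X : Coord n → Amb n) : Prop :=
  ∀ y ∈ U, form ε v v - ε * form ε (X y).1 v ^ 2 ≠ 0 → ∀ w : Vec n, form ε (X y).1 w = 0 →
    form ε v w = 0 → ∃ u : Coord n, fderiv ℝ X y u = (w, 0)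

variable {S : Type*} [TopologicalSpace S] [ChartedSpace (Coord n) S] {f : S → Amb n}

theorem IsHypersurface.isPatch [IsManifold (𝓡 n) ∞ S] (hf : IsHypersurface ε f)
    {e : OpenPartialHomeomorph S (Coord n)} (he : e ∈ atlas (Coord n) S) :
    IsPatch ε e.target (f ∘ e.symm) := by
  have hes : ContMDiffOn (𝓡 n) (𝓡 n) ∞ e.symm e.target :=
    contMDiffOn_symm_of_mem_maximalAtlas (IsManifold.subset_maximalAtlas he)
  refine ⟨e.open_target, ?_, fun y _ => hf.mem _, fun y hy => ?_⟩
  · exact contMDiffOn_iff_contDiffOn.1 (hf.smooth.comp_contMDiffOn hes)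
  · have hmd : e.MDifferentiable (𝓡 n) (𝓡 n) :=
      mdifferentiable_of_mem_atlas (I := 𝓡 n) he
    have h1 : Function.Injective (mfderiv (𝓡 n) (𝓡 n) e.symm y) :=
      hmd.symm.mfderiv_injective hy
    have h2 : mfderiv (𝓡 n) 𝓘(ℝ, Amb n) (f ∘ e.symm) y
        = (mfderiv (𝓡 n) 𝓘(ℝ, Amb n) f (e.symm y)).comp (mfderiv (𝓡 n) (𝓡 n) e.symm y) :=
      mfderiv_comp y (hf.smooth.mdifferentiable (by simp) _)
        (hmd.mdifferentiableAt_symm hy)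
    rw [← mfderiv_eq_fderiv]
    rw [show mfderiv 𝓘(ℝ, Coord n) 𝓘(ℝ, Amb n) (f ∘ e.symm) y = _ from h2]
    exact (hf.immersion _).comp h1

/-- Off the axis, each `w` orthogonal to `x` and `v` is the velocity at `x` of a one-parameter group
of symmetries. Local invariance keeps the resulting curve in every piece of the hypersurface around
the point, and `mem_range_of_curve` makes its velocity tangent. -/
theorem IsHypersurface.isTangentToOrbits [IsManifold (𝓡 n) ∞ S] (hε : ε = 1 ∨ ε = -1)
    (hf : IsHypersurface ε f) {v : Vec n}
    (hsym : ∀ p : S, ∀ U ∈ 𝓝 p,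
      ∀ᶠ A in 𝓝[symmetryGroup ε v] (ContinuousLinearMap.id ℝ (Vec n)),
        (A (f p).1, (f p).2) ∈ f '' U)
    {e : OpenPartialHomeomorph S (Coord n)} (he : e ∈ atlas (Coord n) S) :
    IsTangentToOrbits ε v e.target (f ∘ e.symm) := by
  intro y hy hoff w hxw hvw
  have hpatch := hf.isPatch he
  set x := (f (e.symm y)).1 with hx
  have hxx : form ε x x = ε := (hf.mem (e.symm y)).1.1
  have hε2 := sq_eq_one_of_sign hε
  change form ε x w = 0 at hxw
  set c := form ε x v with hc
  set D := form ε v v - ε * c ^ 2 with hD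
  -- `a` lies in the span of `x` and `v`, is orthogonal to `v`, and `⟨a, x⟩ = 1`
  set a : Vec n := (form ε v v * ε / D) • x - (ε * c / D) • v with ha
  have hav : form ε a v = 0 := by
    rw [ha, form_sub_left, form_smul_left, form_smul_left, ← hc]
    ring
  have hax : form ε a x = 1 := by
    rw [ha, form_sub_left, form_smul_left, form_smul_left, form_comm v x, ← hc, hxx]
    change form ε v v - ε * c ^ 2 ≠ 0 at hoff
    rw [← hD] at hoff
    field_simp
    rw [hD]
    linear_combination (form ε v v) * hε2
  set B := rotationGenerator ε a w with hB
  have hγ : HasDerivAt (fun s : ℝ => ((NormedSpace.exp (s • B) x, (f (e.symm y)).2) : Amb n))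
      (w, 0) 0 := by
    have := (hasDerivAt_exp_apply B x 0).prodMk (hasDerivAt_const (0 : ℝ) (f (e.symm y)).2)
    simpa [hB, rotationGenerator_apply, hax, form_comm w x, hxw] using this
  have hXd : HasStrictFDerivAt (f ∘ e.symm) (fderiv ℝ (f ∘ e.symm) y) y :=
    (hpatch.smooth.contDiffAt (hpatch.isOpen.mem_nhds hy)).hasStrictFDerivAt (by simp)
  refine mem_range_of_curve hXd (hpatch.inj y hy) hγ (by simp [hx]) fun V hV => ?_
  have hU : e.source ∩ e ⁻¹' V ∈ 𝓝 (e.symm y) := by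
    have hys := e.map_target hy
    refine Filter.inter_mem (e.open_source.mem_nhds hys) ?_
    exact (e.continuousAt hys).preimage_mem_nhds (by rwa [e.right_inv hy])
  have hcont : Tendsto (fun s : ℝ => NormedSpace.exp (s • B)) (𝓝 0)
      (𝓝[symmetryGroup ε v] (ContinuousLinearMap.id ℝ (Vec n))) := by
    refine tendsto_nhdsWithin_iff.2 ⟨?_, Eventually.of_forall fun s =>
      exp_rotationGenerator_mem hε hav (by rwa [form_comm]) s⟩
    have := (hasDerivAt_exp_smul_const (𝕂 := ℝ) B 0).continuousAt.tendsto
    simp only [zero_smul, NormedSpace.exp_zero] at this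
    exact this
  filter_upwards [hcont.eventually (hsym (e.symm y) _ hU)] with s hs
  obtain ⟨p, ⟨hp1, hp2⟩, hp⟩ := hs
  exact ⟨e p, hp2, by rw [Function.comp_apply, e.left_inv hp1, hp]⟩

end Symmetry

/-! ### Symmetric hypersurfaces of constant sectional curvature: local analysis -/

section LocalAnalysis

variable {n : ℕ} {ε : ℝ} {U : Set (Coord n)} {X : Coord n → Amb n} {v : Vec n}

/-- The function `⟨x, v⟩` along a parametrized hypersurface. -/
def axisFun (ε : ℝ) (v : Vec n) (X : Coord n → Amb n) (y : Coord n) : ℝ := form ε (X y).1 v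

/-- The height function along a parametrized hypersurface. -/
def heightFun (X : Coord n → Amb n) (y : Coord n) : ℝ := (X y).2

/-- The squared length of the tangential part of the axis; it vanishes at the points of the
axis of revolution. -/
def axisDist (ε : ℝ) (v : Vec n) (X : Coord n → Amb n) (y : Coord n) : ℝ :=
  form ε v v - ε * axisFun ε v X y ^ 2

theorem IsPatch.smooth_axisFun (h : IsPatch ε U X) (v : Vec n) :
    ContDiffOn ℝ ∞ (axisFun ε v X) U :=
  ((formL n ε).contDiff.comp_contDiffOn h.smooth_fst).clm_apply contDiffOn_const

theorem IsPatch.smooth_heightFun (h : IsPatch ε U X) : ContDiffOn ℝ ∞ (heightFun X) U :=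
  h.smooth_snd

theorem IsPatch.smooth_axisDist (h : IsPatch ε U X) (v : Vec n) :
    ContDiffOn ℝ ∞ (axisDist ε v X) U :=
  contDiffOn_const.sub (contDiffOn_const.mul ((h.smooth_axisFun v).pow 2))

theorem IsPatch.partialDeriv_axisFun (h : IsPatch ε U X) (v : Vec n) {y : Coord n} (hy : y ∈ U)
    (i : Fin n) : partialDeriv i (axisFun ε v X) y = form ε (partialDeriv i X y).1 v := by
  have hd := differentiableAt_of_smooth h.isOpen h.smooth_fst hy
  have := partialDeriv_bilin (formL n ε) hd (differentiableAt_const v) i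
  rw [h.partialDeriv_fst hy] at this
  have h2 : partialDeriv i (fun _ : Coord n => v) y = 0 := by simp [partialDeriv]
  rw [h2, map_zero, add_zero] at this
  exact this

theorem IsPatch.partialDeriv_heightFun (h : IsPatch ε U X) {y : Coord n} (hy : y ∈ U)
    (i : Fin n) : partialDeriv i (heightFun X) y = (partialDeriv i X y).2 :=
  h.partialDeriv_snd hy i

theorem IsPatch.axisDist_nonneg (hε : ε = 1 ∨ ε = -1) (h : IsPatch ε U X) (v : Vec n)
    {y : Coord n} (hy : y ∈ U) : 0 ≤ axisDist ε v X y :=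
  form_sub_nonneg hε (h.mem y hy).1 v

theorem IsPatch.dirDeriv_axisFun (h : IsPatch ε U X) (v : Vec n) {y : Coord n} (hy : y ∈ U)
    (u : Fin n → ℝ) : dirDeriv (axisFun ε v X) u y = form ε (dirDeriv X u y).1 v := by
  unfold dirDeriv
  simp only [h.partialDeriv_axisFun v hy, Prod.fst_sum, Prod.smul_fst, ← formL_apply, map_sum,
    map_smul, sum_apply, smul_apply]

theorem IsPatch.dirDeriv_heightFun (h : IsPatch ε U X) {y : Coord n} (hy : y ∈ U)
    (u : Fin n → ℝ) : dirDeriv (heightFun X) u y = (dirDeriv X u y).2 := by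
  unfold dirDeriv
  simp only [h.partialDeriv_heightFun hy, Prod.snd_sum, Prod.smul_snd]

theorem IsPatch.partialDeriv_partialDeriv_axisFun (h : IsPatch ε U X) (v : Vec n) {y : Coord n}
    (hy : y ∈ U) (i j : Fin n) : partialDeriv i (partialDeriv j (axisFun ε v X)) y
      = form ε (partialDeriv i (partialDeriv j X) y).1 v := by
  rw [partialDeriv_congr h.isOpen (Y := fun z => formL n ε (partialDeriv j X z).1 v)
    (fun z hz => h.partialDeriv_axisFun v hz j) hy i]
  have hd := differentiableAt_of_smooth h.isOpen (contDiffOn_partialDeriv h.isOpen h.smooth j) hy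
  have := partialDeriv_bilin (formL n ε) hd.fst (differentiableAt_const v) i
  have h2 : partialDeriv i (fun _ : Coord n => v) y = 0 := by simp [partialDeriv]
  rw [h2, map_zero, add_zero] at this
  rw [this]
  have h3 : partialDeriv i (fun z => (partialDeriv j X z).1) y
      = (partialDeriv i (partialDeriv j X) y).1 := by
    unfold partialDeriv at hd ⊢
    rw [hd.hasFDerivAt.fst.fderiv]; rfl
  rw [h3, formL_apply]

theorem IsPatch.partialDeriv_partialDeriv_heightFun (h : IsPatch ε U X) {y : Coord n}
    (hy : y ∈ U) (i j : Fin n) : partialDeriv i (partialDeriv j (heightFun X)) y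
      = (partialDeriv i (partialDeriv j X) y).2 := by
  rw [partialDeriv_congr h.isOpen (Y := fun z => (partialDeriv j X z).2)
    (fun z hz => h.partialDeriv_heightFun hz j) hy i]
  have hd := differentiableAt_of_smooth h.isOpen (contDiffOn_partialDeriv h.isOpen h.smooth j) hy
  unfold partialDeriv at hd ⊢
  rw [hd.hasFDerivAt.snd.fderiv]; rfl

theorem IsPatch.secondDeriv_axisFun (h : IsPatch ε U X) (v : Vec n) {y : Coord n} (hy : y ∈ U)
    (u w : Fin n → ℝ) : secondDeriv (axisFun ε v X) u w y = form ε (secondDeriv X u w y).1 v := by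
  unfold secondDeriv
  simp only [h.partialDeriv_partialDeriv_axisFun v hy, Prod.fst_sum, Prod.smul_fst, ← formL_apply,
    map_sum, map_smul, sum_apply, smul_apply]

theorem IsPatch.secondDeriv_heightFun (h : IsPatch ε U X) {y : Coord n} (hy : y ∈ U)
    (u w : Fin n → ℝ) : secondDeriv (heightFun X) u w y = (secondDeriv X u w y).2 := by
  unfold secondDeriv
  simp only [h.partialDeriv_partialDeriv_heightFun hy, Prod.snd_sum, Prod.smul_snd]

theorem IsPatch.form_fst_secondDeriv (h : IsPatch ε U X) {y : Coord n} (hy : y ∈ U)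
    (u w : Fin n → ℝ) : form ε (X y).1 (secondDeriv X u w y).1
      = -form ε (dirDeriv X u y).1 (dirDeriv X w y).1 := by
  unfold secondDeriv dirDeriv
  simp only [Prod.fst_sum, Prod.smul_fst, ← formL_apply, map_sum, map_smul, sum_apply, smul_apply,
    smul_eq_mul]
  simp only [formL_apply, h.form_secondDeriv hy]
  simp only [Finset.mul_sum, ← Finset.sum_neg_distrib]
  rw [Finset.sum_comm]
  exact Finset.sum_congr rfl fun i _ => Finset.sum_congr rfl fun j _ => by ring

/-- The second fundamental form with respect to the normal vector `(α v^⊤, β)`. -/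
theorem IsPatch.prodForm_secondDeriv (h : IsPatch ε U X) {y : Coord n} (hy : y ∈ U)
    (u w : Fin n → ℝ) (α β : ℝ) :
    prodForm ε (secondDeriv X u w y) (α • tangentPart ε v (X y).1, β)
      = α * (secondDeriv (axisFun ε v X) u w y
          + ε * axisFun ε v X y * form ε (dirDeriv X u y).1 (dirDeriv X w y).1)
        + β * secondDeriv (heightFun X) u w y := by
  rw [h.secondDeriv_axisFun v hy, h.secondDeriv_heightFun hy, prodForm, form_smul_right,
    tangentPart, form_sub_right, form_smul_right, form_comm _ (X y).1, h.form_fst_secondDeriv hy,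
    axisFun]
  ring

theorem IsPatch.prodForm_dirDeriv (h : IsPatch ε U X) {y : Coord n} (hy : y ∈ U)
    (i : Fin n) (α β : ℝ) :
    prodForm ε (α • tangentPart ε v (X y).1, β) (partialDeriv i X y)
      = α * partialDeriv i (axisFun ε v X) y + β * partialDeriv i (heightFun X) y := by
  rw [h.partialDeriv_axisFun v hy, h.partialDeriv_heightFun hy, prodForm, form_smul_left,
    form_comm, form_tangentPart_of_tangent (h.form_partialDeriv hy i)]

theorem IsPatch.prodForm_normal (hε : ε = 1 ∨ ε = -1) (h : IsPatch ε U X) {y : Coord n}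
    (hy : y ∈ U) (α β : ℝ) :
    prodForm ε (α • tangentPart ε v (X y).1, β) (α • tangentPart ε v (X y).1, β)
      = α ^ 2 * axisDist ε v X y + β ^ 2 := by
  rw [prodForm, form_smul_left, form_smul_right, form_tangentPart_self hε (h.mem y hy).1, axisDist,
    axisFun]
  ring

theorem IsPatch.form_normal (hε : ε = 1 ∨ ε = -1) (h : IsPatch ε U X) {y : Coord n}
    (hy : y ∈ U) (α : ℝ) : form ε (X y).1 (α • tangentPart ε v (X y).1) = 0 := by
  rw [form_smul_right, form_tangentPart hε (h.mem y hy).1, mul_zero]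

/-- Away from the axis, the differentials of `⟨x, v⟩` and of the height are linearly dependent. -/
theorem IsTangentToOrbits.wedge_eq_zero (h : IsPatch ε U X) (hT : IsTangentToOrbits ε v U X)
    {y : Coord n} (hy : y ∈ U) (hoff : axisDist ε v X y ≠ 0) (i j : Fin n) :
    partialDeriv i (heightFun X) y * partialDeriv j (axisFun ε v X) y
      = partialDeriv i (axisFun ε v X) y * partialDeriv j (heightFun X) y := by
  by_contra hne
  rw [h.partialDeriv_axisFun v hy, h.partialDeriv_axisFun v hy, h.partialDeriv_heightFun hy,
    h.partialDeriv_heightFun hy] at hne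
  -- `ker ℓ` consists of the orbit directions and has dimension at least `n - 1`. If the asserted
  -- equality failed, `∂ᵢX` and `∂ⱼX` would be independent modulo these directions, giving `n + 1`
  -- independent vectors in a tangent space of dimension `n`.
  let ℓ : Vec n →ₗ[ℝ] ℝ × ℝ :=
    ((formL n ε (X y).1 : Vec n →ₗ[ℝ] ℝ)).prod (formL n ε v : Vec n →ₗ[ℝ] ℝ)
  let W := LinearMap.ker ℓ
  let Ψ : (W × ℝ × ℝ) →ₗ[ℝ] Amb n :=
    ((LinearMap.inl ℝ (Vec n) ℝ).comp W.subtype).coprod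
      ((LinearMap.toSpanSingleton ℝ (Amb n) (partialDeriv i X y)).coprod
        (LinearMap.toSpanSingleton ℝ (Amb n) (partialDeriv j X y)))
  have hΨ : ∀ w r s, Ψ (w, r, s)
      = ((w : Vec n), (0 : ℝ)) + (r • partialDeriv i X y + s • partialDeriv j X y) :=
    fun _ _ _ => rfl
  have hW : ∀ w : W, form ε (X y).1 w = 0 ∧ form ε v w = 0 := by
    intro w
    have := w.2
    rw [LinearMap.mem_ker] at this
    exact ⟨congrArg Prod.fst this, congrArg Prod.snd this⟩
  have hrange : ∀ z, Ψ z ∈ LinearMap.range (fderiv ℝ X y : Coord n →ₗ[ℝ] Amb n) := by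
    rintro ⟨w, r, s⟩
    rw [hΨ]
    refine Submodule.add_mem _ ?_ (Submodule.add_mem _ (Submodule.smul_mem _ _ ⟨_, rfl⟩)
      (Submodule.smul_mem _ _ ⟨_, rfl⟩))
    exact hT y hy hoff w (hW w).1 (hW w).2
  have hinj : Function.Injective (Ψ.codRestrict _ hrange) := by
    rw [← LinearMap.ker_eq_bot, LinearMap.ker_codRestrict, LinearMap.ker_eq_bot']
    rintro ⟨w, r, s⟩ h0
    rw [hΨ] at h0
    have h1 := congrArg (fun z : Amb n => formL n ε v z.1) h0
    have h2 := congrArg (fun z : Amb n => z.2) h0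
    simp only [Prod.fst_add, Prod.smul_fst, map_add, map_smul, formL_apply, (hW w).2,
      Prod.fst_zero, map_zero, smul_eq_mul, zero_add] at h1
    simp only [Prod.snd_add, Prod.smul_snd, Prod.snd_zero, smul_eq_mul, zero_add] at h2
    rw [form_comm v, form_comm v] at h1
    have hdet := sub_ne_zero.2 hne
    have hr : r = 0 := by
      have : r * ((partialDeriv i X y).2 * form ε (partialDeriv j X y).1 v
        - form ε (partialDeriv i X y).1 v * (partialDeriv j X y).2) = 0 := by
        linear_combination form ε (partialDeriv j X y).1 v * h2 - (partialDeriv j X y).2 * h1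
      exact (mul_eq_zero.1 this).resolve_right hdet
    have hs : s = 0 := by
      have : s * ((partialDeriv i X y).2 * form ε (partialDeriv j X y).1 v
        - form ε (partialDeriv i X y).1 v * (partialDeriv j X y).2) = 0 := by
        linear_combination (partialDeriv i X y).2 * h1 - form ε (partialDeriv i X y).1 v * h2
      exact (mul_eq_zero.1 this).resolve_right hdet
    subst hr hs
    have h3 := congrArg Prod.fst h0
    simp only [zero_smul, add_zero, Prod.fst_zero] at h3
    rw [Prod.mk_eq_zero]
    exact ⟨Subtype.ext h3, rfl⟩
  have hle := LinearMap.finrank_le_finrank_of_injective hinj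
  have hle2 := LinearMap.finrank_range_le (fderiv ℝ X y : Coord n →ₗ[ℝ] Amb n)
  have hker := ℓ.finrank_range_add_finrank_ker
  have hle3 : Module.finrank ℝ (LinearMap.range ℓ) ≤ 2 := by
    simpa using Submodule.finrank_le (LinearMap.range ℓ)
  have e1 : Module.finrank ℝ (W × ℝ × ℝ) = Module.finrank ℝ W + 2 := by
    simp [Module.finrank_prod]
  have e2 : Module.finrank ℝ (Vec n) = n + 1 := by simp
  have e3 : Module.finrank ℝ (Coord n) = n := by simp
  change Module.finrank ℝ (LinearMap.range ℓ) + Module.finrank ℝ W = _ at hker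
  omega

/-- Away from the axis, the differentials of `⟨x, v⟩` and of the height do not both vanish. -/
theorem IsPatch.exists_partialDeriv_ne_zero (hε : ε = 1 ∨ ε = -1) (h : IsPatch ε U X)
    {y : Coord n} (hy : y ∈ U) (hoff : axisDist ε v X y ≠ 0) :
    ∃ i, partialDeriv i (axisFun ε v X) y ≠ 0 ∨ partialDeriv i (heightFun X) y ≠ 0 := by
  by_contra hcon
  push Not at hcon
  have hx := (h.mem y hy).1.1
  have hε2 := sq_eq_one_of_sign hε
  have hc : ∀ u : Coord n, form ε (fderiv ℝ X y u).1 v = 0 := by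
    intro u
    rw [← WithLp.toLp_ofLp 2 u, ← dirDeriv_eq_fderiv, ← h.dirDeriv_axisFun v hy, dirDeriv]
    simp [hcon]
  have ht : ∀ u : Coord n, (fderiv ℝ X y u).2 = 0 := by
    intro u
    rw [← WithLp.toLp_ofLp 2 u, ← dirDeriv_eq_fderiv, ← h.dirDeriv_heightFun hy, dirDeriv]
    simp [hcon]
  have htan : ∀ u : Coord n, form ε (fderiv ℝ X y u).1 (X y).1 = 0 := by
    intro u
    rw [form_comm, ← WithLp.toLp_ofLp 2 u, ← dirDeriv_eq_fderiv]
    exact h.form_dirDeriv hy _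
  -- If both differentials vanished, `dX` would embed `ℝ^n` into the vectors of `ℝ^{n+1}` orthogonal
  -- to `x` and `v`. These two are independent off the axis, so there would be `n + 2` independent
  -- vectors in `ℝ^{n+1}`.
  let Ψ : (Coord n × ℝ × ℝ) →ₗ[ℝ] Vec n :=
    ((LinearMap.fst ℝ (Vec n) ℝ).comp (fderiv ℝ X y : Coord n →ₗ[ℝ] Amb n)).coprod
      ((LinearMap.toSpanSingleton ℝ (Vec n) (X y).1).coprod
        (LinearMap.toSpanSingleton ℝ (Vec n) v))
  have hΨ : ∀ u r s, Ψ (u, r, s) = (fderiv ℝ X y u).1 + (r • (X y).1 + s • v) :=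
    fun _ _ _ => rfl
  have hinj : Function.Injective Ψ := by
    rw [← LinearMap.ker_eq_bot, LinearMap.ker_eq_bot']
    rintro ⟨u, r, s⟩ h0
    rw [hΨ] at h0
    have h1 := congrArg (fun z => form ε z (X y).1) h0
    have h2 := congrArg (fun z => form ε z v) h0
    simp only [form_add_left, form_smul_left, htan, hc, hx, form_zero_left, zero_add,
      form_comm v (X y).1] at h1 h2
    have hD : form ε v v - ε * form ε (X y).1 v ^ 2 ≠ 0 := hoff
    have hs : s = 0 := by
      have : s * (form ε v v - ε * form ε (X y).1 v ^ 2) = 0 := by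
        linear_combination h2 - ε * form ε (X y).1 v * h1 + form ε (X y).1 v * r * hε2
      exact (mul_eq_zero.1 this).resolve_right hD
    have hr : r = 0 := by
      rw [hs] at h1
      have : r * ε * ε = 0 := by linear_combination ε * h1
      rwa [mul_assoc, hε2, mul_one] at this
    subst hr hs
    have : u = 0 := h.inj y hy (Prod.ext (by simpa using h0) (by rw [ht, ht]))
    rw [this]; rfl
  have hle := LinearMap.finrank_le_finrank_of_injective hinj
  have e1 : Module.finrank ℝ (Coord n × ℝ × ℝ) = n + 2 := by
    simp [Module.finrank_prod]
  have e2 : Module.finrank ℝ (Vec n) = n + 1 := by simp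
  omega

end LocalAnalysis

/-! ### Symmetric hypersurfaces of constant sectional curvature: the profile equation -/

section Profile

variable {n : ℕ} {ε K : ℝ} {U : Set (Coord n)} {X : Coord n → Amb n} {v : Vec n}

theorem IsPatch.mem_nhds_axisDist_ne (h : IsPatch ε U X) {y : Coord n} (hy : y ∈ U)
    (hoff : axisDist ε v X y ≠ 0) : ∀ᶠ z in 𝓝 y, z ∈ U ∧ axisDist ε v X z ≠ 0 := by
  filter_upwards [h.isOpen.mem_nhds hy, (((h.smooth_axisDist v).contDiffAt
    (h.isOpen.mem_nhds hy)).continuousAt).eventually_ne hoff] with z h1 h2 using ⟨h1, h2⟩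

/-- Two independent directions that are tangent to the orbits. -/
theorem exists_pair_orbit_directions (hn : 3 ≤ n) (h : IsPatch ε U X)
    (hT : IsTangentToOrbits ε v U X) {y : Coord n} (hy : y ∈ U) (hoff : axisDist ε v X y ≠ 0)
    {e : Fin n} (he : partialDeriv e (axisFun ε v X) y ≠ 0 ∨ partialDeriv e (heightFun X) y ≠ 0) :
    ∃ u w : Fin n → ℝ, LinearIndependent ℝ ![u, w] ∧ dirDeriv (axisFun ε v X) u y = 0 ∧
      dirDeriv (heightFun X) u y = 0 ∧ dirDeriv (axisFun ε v X) w y = 0 ∧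
      dirDeriv (heightFun X) w y = 0 := by
  set ce := partialDeriv e (axisFun ε v X) y with hce
  set te := partialDeriv e (heightFun X) y with hte
  -- The pair `(dc(u), dt(u))` is always a multiple of `(ce, te) ≠ 0`, so the single equation `ℓ u =
  -- 0` makes both entries vanish. Its kernel has dimension at least `n - 1 ≥ 2`, which is where `n
  -- ≥ 3` enters.
  let ℓ : (Fin n → ℝ) →ₗ[ℝ] ℝ :=
    { toFun := fun u => ce * dirDeriv (axisFun ε v X) u y + te * dirDeriv (heightFun X) u y
      map_add' := fun u w => by simp only [dirDeriv_add]; ring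
      map_smul' := fun a u => by simp only [dirDeriv_smul, smul_eq_mul, RingHom.id_apply]; ring }
  have hpos : 0 < ce ^ 2 + te ^ 2 := by
    rcases he with he | he
    · have := sq_pos_of_ne_zero he; positivity
    · have := sq_pos_of_ne_zero he; positivity
  have hwedge : ∀ u : Fin n → ℝ, te * dirDeriv (axisFun ε v X) u y
      = ce * dirDeriv (heightFun X) u y := by
    intro u
    simp only [dirDeriv, smul_eq_mul, Finset.mul_sum]
    refine Finset.sum_congr rfl fun j _ => ?_
    linear_combination u j * hT.wedge_eq_zero h hy hoff e j
  have hker : ∀ u, ℓ u = 0 → dirDeriv (axisFun ε v X) u y = 0 ∧ dirDeriv (heightFun X) u y = 0 := by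
    intro u hu
    change ce * dirDeriv (axisFun ε v X) u y + te * dirDeriv (heightFun X) u y = 0 at hu
    have hw := hwedge u
    constructor
    · have : (ce ^ 2 + te ^ 2) * dirDeriv (axisFun ε v X) u y = 0 := by
        linear_combination ce * hu + te * hw
      exact (mul_eq_zero.1 this).resolve_left hpos.ne'
    · have : (ce ^ 2 + te ^ 2) * dirDeriv (heightFun X) u y = 0 := by
        linear_combination te * hu - ce * hw
      exact (mul_eq_zero.1 this).resolve_left hpos.ne'
  have hdim : 1 < Module.finrank ℝ (LinearMap.ker ℓ) := by
    have h1 := ℓ.finrank_range_add_finrank_ker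
    have h2 : Module.finrank ℝ (LinearMap.range ℓ) ≤ 1 := by
      simpa using Submodule.finrank_le (LinearMap.range ℓ)
    have h3 : Module.finrank ℝ (Fin n → ℝ) = n := by simp
    omega
  obtain ⟨u, hu⟩ := Module.finrank_pos_iff_exists_ne_zero.1 (zero_lt_one.trans hdim)
  obtain ⟨w, hw⟩ := exists_linearIndependent_pair_of_one_lt_finrank hdim hu
  refine ⟨u, w, ?_, (hker u u.2).1, (hker u u.2).2, (hker w w.2).1, (hker w w.2).2⟩
  rw [LinearIndependent.pair_iff] at hw ⊢
  intro s t hst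
  exact hw s t (Subtype.ext hst)

/-- The relation between the differentials of `⟨x, v⟩` and of the height that is imposed by the
sectional curvature of the planes tangent to the orbits. -/
theorem profile_equation (hn : 3 ≤ n) (hε : ε = 1 ∨ ε = -1) (h : IsPatch ε U X)
    (hT : IsTangentToOrbits ε v U X) (hK : PatchHasCurvature ε X U K) {y : Coord n} (hy : y ∈ U)
    (hoff : axisDist ε v X y ≠ 0) (e : Fin n) :
    (K - ε) * (axisDist ε v X y * partialDeriv e (heightFun X) y ^ 2
        + partialDeriv e (axisFun ε v X) y ^ 2)
      = axisFun ε v X y ^ 2 * partialDeriv e (heightFun X) y ^ 2 := by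
  by_cases he : partialDeriv e (axisFun ε v X) y ≠ 0 ∨ partialDeriv e (heightFun X) y ≠ 0
  swap
  · push Not at he
    rw [he.1, he.2]; ring
  obtain ⟨u, w, hl, hcu, htu, hcw, htw⟩ := exists_pair_orbit_directions hn h hT hy hoff he
  set ce := partialDeriv e (axisFun ε v X) y with hce
  set te := partialDeriv e (heightFun X) y with hte
  -- Normal to the hypersurface because `te dc - ce dt = 0` on it.
  set N : Amb n := (te • tangentPart ε v (X y).1, -ce) with hN
  have hD : 0 < axisDist ε v X y := lt_of_le_of_ne (h.axisDist_nonneg hε v hy) (Ne.symm hoff)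
  have hNN : prodForm ε N N = te ^ 2 * axisDist ε v X y + ce ^ 2 := by
    rw [hN, h.prodForm_normal hε hy]; ring
  have hNpos : 0 < prodForm ε N N := by
    rw [hNN]
    rcases he with he | he
    · have := sq_pos_of_ne_zero he; positivity
    · have := sq_pos_of_ne_zero he; positivity
  have hN0 : N ≠ 0 := by
    intro h0
    rw [h0] at hNpos
    simp [prodForm, form_zero_left] at hNpos
  have hNX : ∀ i, prodForm ε N (partialDeriv i X y) = 0 := by
    intro i
    rw [hN, h.prodForm_dirDeriv hy]
    linear_combination hT.wedge_eq_zero h hy hoff e i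
  -- Differentiate the proportionality of `dc` and `dt` in the direction `a` and contract with `b`:
  -- the terms with derivatives of the factors `∂ₑc`, `∂ₑt` drop out, since `dc(b) = dt(b) = 0`.
  have hsec : ∀ a b : Fin n → ℝ, dirDeriv (axisFun ε v X) b y = 0 →
      dirDeriv (heightFun X) b y = 0 →
      te * secondDeriv (axisFun ε v X) a b y = ce * secondDeriv (heightFun X) a b y := by
    intro a b hcb htb
    have hsc := h.smooth_axisFun v
    have hst := h.smooth_heightFun
    have d1 := fun i => differentiableAt_of_smooth h.isOpen
      (contDiffOn_partialDeriv h.isOpen hsc i) hy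
    have d2 := fun i => differentiableAt_of_smooth h.isOpen
      (contDiffOn_partialDeriv h.isOpen hst i) hy
    have hij : ∀ i j, partialDeriv i (partialDeriv e (heightFun X)) y
          * partialDeriv j (axisFun ε v X) y
        + te * partialDeriv i (partialDeriv j (axisFun ε v X)) y
        = partialDeriv i (partialDeriv e (axisFun ε v X)) y * partialDeriv j (heightFun X) y
        + ce * partialDeriv i (partialDeriv j (heightFun X)) y := by
      intro i j
      have hU' : IsOpen {z | z ∈ U ∧ axisDist ε v X z ≠ 0} := by
        rw [isOpen_iff_mem_nhds]
        exact fun z hz => h.mem_nhds_axisDist_ne hz.1 hz.2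
      have := partialDeriv_congr hU'
        (fun z hz => hT.wedge_eq_zero h hz.1 hz.2 e j) ⟨hy, hoff⟩ i
      rwa [partialDeriv_mul (d2 e) (d1 j), partialDeriv_mul (d1 e) (d2 j)] at this
    have e1 : ∀ g : Coord n → ℝ, secondDeriv g a b y
        = ∑ i, ∑ j, a i * b j * partialDeriv i (partialDeriv j g) y := fun g => by
      simp [secondDeriv]
    have e2 : ∑ i, ∑ j, a i * b j * (te * partialDeriv i (partialDeriv j (axisFun ε v X)) y
        - ce * partialDeriv i (partialDeriv j (heightFun X)) y)
        = (∑ i, a i * partialDeriv i (partialDeriv e (axisFun ε v X)) y)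
          * dirDeriv (heightFun X) b y
        - (∑ i, a i * partialDeriv i (partialDeriv e (heightFun X)) y)
          * dirDeriv (axisFun ε v X) b y := by
      simp only [dirDeriv, Finset.sum_mul_sum, smul_eq_mul]
      rw [← Finset.sum_sub_distrib]
      refine Finset.sum_congr rfl fun i _ => ?_
      rw [← Finset.sum_sub_distrib]
      refine Finset.sum_congr rfl fun j _ => ?_
      linear_combination a i * b j * hij i j
    rw [hcb, htb, mul_zero, mul_zero, sub_self] at e2
    rw [e1, e1, ← sub_eq_zero, Finset.mul_sum, Finset.mul_sum, ← Finset.sum_sub_distrib]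
    simp_rw [Finset.mul_sum, ← Finset.sum_sub_distrib]
    refine Eq.trans ?_ e2
    exact Finset.sum_congr rfl fun i _ => Finset.sum_congr rfl fun j _ => by ring
  -- In the orbit directions the second fundamental form is a multiple of the metric, so the Gram
  -- determinant `G` factors out of the Gauss equation.
  have hH : ∀ a b : Fin n → ℝ, dirDeriv (axisFun ε v X) b y = 0 →
      dirDeriv (heightFun X) b y = 0 → prodForm ε (secondDeriv X a b y) N
        = te * ε * axisFun ε v X y * form ε (dirDeriv X a y).1 (dirDeriv X b y).1 := by
    intro a b hcb htb
    rw [hN, h.prodForm_secondDeriv hy]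
    linear_combination hsec a b hcb htb
  have hG := (h.sectionalCurvature_eq_iff hε hy (h.form_normal hε hy te) hNX hN0 hl K).1
    (hK y hy u w hl)
  have hpos := h.gram_pos hε hy hl
  have hgu : (dirDeriv X u y).2 = 0 := by rw [← h.dirDeriv_heightFun hy, htu]
  have hgw : (dirDeriv X w y).2 = 0 := by rw [← h.dirDeriv_heightFun hy, htw]
  rw [hH u u hcu htu, hH w w hcw htw, hH u w hcw htw] at hG
  simp only [prodForm, hgu, hgw, mul_zero, add_zero] at hG hpos
  set G := form ε (dirDeriv X u y).1 (dirDeriv X u y).1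
          * form ε (dirDeriv X w y).1 (dirDeriv X w y).1
          - form ε (dirDeriv X u y).1 (dirDeriv X w y).1 ^ 2 with hGdef
  have hε2 := sq_eq_one_of_sign hε
  change _ + _ / prodForm ε N N = _ at hG
  have hG2 : G * ((K - ε) * prodForm ε N N) = G * (axisFun ε v X y ^ 2 * te ^ 2) := by
    field_simp at hG
    rw [hGdef] at hG ⊢
    linear_combination (-1 : ℝ) * hG + (te ^ 2 * axisFun ε v X y ^ 2 * G) * hε2
  have := mul_left_cancel₀ hpos.ne' hG2
  rw [hNN] at this
  linear_combination this

/-- If `⟨x, v⟩` is constant on a piece of the hypersurface, then `K = 0`. -/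
theorem curvature_eq_zero_of_axisFun_const (hn : 3 ≤ n) (hε : ε = 1 ∨ ε = -1) (h : IsPatch ε U X)
    (hT : IsTangentToOrbits ε v U X) (hK : PatchHasCurvature ε X U K) {y : Coord n} (hy : y ∈ U)
    (hoff : axisDist ε v X y ≠ 0)
    (hconst : ∀ᶠ z in 𝓝 y, ∀ i, partialDeriv i (axisFun ε v X) z = 0) : K = 0 := by
  have hc0 : ∀ i, partialDeriv i (axisFun ε v X) y = 0 := hconst.self_of_nhds
  have hc1 : ∀ i j, partialDeriv i (partialDeriv j (axisFun ε v X)) y = 0 := by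
    intro i j
    have : partialDeriv j (axisFun ε v X) =ᶠ[𝓝 y] fun _ => 0 := hconst.mono fun z hz => hz j
    change fderiv ℝ _ y _ = 0
    rw [this.fderiv_eq]
    simp
  obtain ⟨e, he⟩ := h.exists_partialDeriv_ne_zero hε hy hoff
  obtain ⟨_, w, hl, -, -, hcw, htw⟩ := exists_pair_orbit_directions hn h hT hy hoff he
  have hw0 : w ≠ 0 := hl.ne_zero 1
  replace he : partialDeriv e (heightFun X) y ≠ 0 := he.resolve_left fun h0 => h0 (hc0 e)
  have hD : 0 < axisDist ε v X y := lt_of_le_of_ne (h.axisDist_nonneg hε v hy) (Ne.symm hoff)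
  obtain ⟨u', hu'⟩ := hT y hy hoff (partialDeriv e X y).1 (h.form_partialDeriv hy e)
    (by rw [form_comm, ← h.partialDeriv_axisFun v hy, hc0])
  -- As `dc = 0`, the horizontal part of `∂ₑX` is itself an orbit direction; subtracting it leaves a
  -- vertical tangent vector. The plane of this vector and an orbit direction is the one whose
  -- curvature vanishes.
  obtain ⟨u, hu⟩ : ∃ u : Fin n → ℝ, dirDeriv X u y = (0, partialDeriv e (heightFun X) y) := by
    refine ⟨(EuclideanSpace.single e (1 : ℝ) - u').ofLp, ?_⟩
    rw [dirDeriv_eq_fderiv, WithLp.toLp_ofLp, map_sub, hu']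
    refine Prod.ext (sub_self _) ?_
    rw [h.partialDeriv_heightFun hy]
    exact sub_zero _
  have htw' : (dirDeriv X w y).2 = 0 := by rw [← h.dirDeriv_heightFun hy, htw]
  have hl' : LinearIndependent ℝ ![u, w] := by
    rw [LinearIndependent.pair_iff]
    intro s t hst
    have h1 := congrArg (fun a => (dirDeriv X a y).2) hst
    simp only [dirDeriv_add, dirDeriv_smul, Prod.snd_add, Prod.smul_snd, hu, htw', smul_eq_mul,
      mul_zero, add_zero] at h1
    have h2 : (dirDeriv X (0 : Fin n → ℝ) y).2 = 0 := by simp [dirDeriv]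
    rw [h2] at h1
    have hs : s = 0 := (mul_eq_zero.1 h1).resolve_right he
    rw [hs, zero_smul, zero_add] at hst
    exact ⟨hs, (smul_eq_zero.1 hst).resolve_right hw0⟩
  set N : Amb n := ((1 : ℝ) • tangentPart ε v (X y).1, 0) with hN
  have hNN : prodForm ε N N = axisDist ε v X y := by
    rw [hN, h.prodForm_normal hε hy]; ring
  have hN0 : N ≠ 0 := by
    intro h0
    rw [h0] at hNN
    simp only [prodForm, Prod.fst_zero, form_zero_left, Prod.snd_zero, mul_zero, add_zero] at hNN
    exact hD.ne hNN
  have hNX : ∀ i, prodForm ε N (partialDeriv i X y) = 0 := by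
    intro i
    rw [hN, h.prodForm_dirDeriv hy, hc0]; ring
  have hG := (h.sectionalCurvature_eq_iff hε hy (h.form_normal hε hy 1) hNX hN0 hl' K).1
    (hK y hy u w hl')
  have hpos := h.gram_pos hε hy hl'
  have hsec : ∀ a b, secondDeriv (axisFun ε v X) a b y = 0 := by
    intro a b
    simp [secondDeriv, hc1]
  -- The normal is horizontal and `u` maps to a vertical vector, so `u` is in the kernel of the
  -- second fundamental form; the term from the space form vanishes for the same reason.
  have hH : ∀ a, prodForm ε (secondDeriv X u a y) N = 0 := by
    intro a
    rw [hN, h.prodForm_secondDeriv hy, hsec, hu, form_zero_left]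
    ring
  have hG' : K * (prodForm ε (dirDeriv X u y) (dirDeriv X u y)
      * prodForm ε (dirDeriv X w y) (dirDeriv X w y)
      - prodForm ε (dirDeriv X u y) (dirDeriv X w y) ^ 2) = 0 := by
    rw [← hG, hH, hH, hu]
    simp [form_zero_left]
  exact (mul_eq_zero.1 hG').resolve_right hpos.ne'

/-- The points of the axis do not fill a piece of the hypersurface. -/
theorem frequently_axisDist_ne (hn : 3 ≤ n) (hε : ε = 1 ∨ ε = -1) (h : IsPatch ε U X)
    (hv : IsAxis ε v) {y : Coord n} (hy : y ∈ U) : ∃ᶠ z in 𝓝 y, z ∈ U ∧ axisDist ε v X z ≠ 0 := by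
  intro hcon
  have hcont := ((h.smooth_axisFun v).contDiffAt (h.isOpen.mem_nhds hy)).continuousAt
  have hzero : ∀ᶠ z in 𝓝 y, z ∈ U ∧ axisDist ε v X z = 0 := by
    filter_upwards [hcon, h.isOpen.mem_nhds hy] with z h1 h2
    exact ⟨h2, by_contra fun h3 => h1 ⟨h2, h3⟩⟩
  have key : ∀ z, z ∈ U → axisDist ε v X z = 0 → axisFun ε v X z ^ 2 = 1 ∧
      (X z).1 = (ε * axisFun ε v X z) • v := fun z hz h0 =>
    (hv.form_of_form_sub_eq_zero hε (h.mem z hz).1 h0).2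
  have hyz := hzero.self_of_nhds
  have hc0 := (key y hyz.1 hyz.2).1
  -- Points of the axis have `x = ±v`, with a sign read off from `⟨x, v⟩` and hence locally
  -- constant. Then only the height could vary, and `dX` would have rank at most one.
  have hconst : (fun z => (X z).1) =ᶠ[𝓝 y] fun _ => (X y).1 := by
    have hcont2 : ContinuousAt (fun z => axisFun ε v X z * axisFun ε v X y) y :=
      hcont.mul continuousAt_const
    have hpos : 0 < axisFun ε v X y * axisFun ε v X y := by nlinarith
    filter_upwards [hzero, hcont2.eventually_const_lt hpos] with z hz1 hz2
    have h1 := key z hz1.1 hz1.2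
    have : axisFun ε v X z = axisFun ε v X y := by
      rcases sq_eq_sq_iff_eq_or_eq_neg.1 (h1.1.trans hc0.symm) with h3 | h3
      · exact h3
      · rw [h3] at hz2; nlinarith
    rw [h1.2, this, ← (key y hyz.1 hyz.2).2]
  have hfst : ∀ u : Coord n, (fderiv ℝ X y u).1 = 0 := by
    intro u
    have h1 := (differentiableAt_of_smooth h.isOpen h.smooth hy).hasFDerivAt.fst
    have h2 := h1.fderiv.symm.trans hconst.fderiv_eq
    have := congrArg (fun L => L u) h2
    simpa using this
  have hinj : Function.Injective ((LinearMap.snd ℝ (Vec n) ℝ).comp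
      (fderiv ℝ X y : Coord n →ₗ[ℝ] Amb n)) := by
    intro a b hab
    exact h.inj y hy (Prod.ext ((hfst a).trans (hfst b).symm) hab)
  have hle := LinearMap.finrank_le_finrank_of_injective hinj
  have e3 : Module.finrank ℝ (Coord n) = n := by simp
  rw [e3, Module.finrank_self] at hle
  omega

theorem eq_zero_of_frequently {g : Coord n → ℝ} {y : Coord n} (hg : ContinuousAt g y)
    (h : ∃ᶠ z in 𝓝 y, g z = 0) : g y = 0 := by
  by_contra hne
  exact h ((hg.eventually_ne hne).mono fun z hz => hz)

theorem le_curvature (hn : 3 ≤ n) (hε : ε = 1 ∨ ε = -1) (h : IsPatch ε U X)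
    (hT : IsTangentToOrbits ε v U X) (hK : PatchHasCurvature ε X U K) {y : Coord n} (hy : y ∈ U)
    (hoff : axisDist ε v X y ≠ 0) : ε ≤ K := by
  obtain ⟨e, he⟩ := h.exists_partialDeriv_ne_zero hε hy hoff
  have hD : 0 < axisDist ε v X y := lt_of_le_of_ne (h.axisDist_nonneg hε v hy) (Ne.symm hoff)
  have hE := profile_equation hn hε h hT hK hy hoff e
  have hpos : 0 < axisDist ε v X y * partialDeriv e (heightFun X) y ^ 2
        + partialDeriv e (axisFun ε v X) y ^ 2 := by
    rcases he with he | he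
    · have := sq_pos_of_ne_zero he; positivity
    · have := sq_pos_of_ne_zero he; positivity
  by_contra hlt
  have : (K - ε) * (axisDist ε v X y * partialDeriv e (heightFun X) y ^ 2
        + partialDeriv e (axisFun ε v X) y ^ 2) < 0 :=
    mul_neg_of_neg_of_pos (by linarith) hpos
  rw [hE] at this
  nlinarith [mul_nonneg (sq_nonneg (axisFun ε v X y)) (sq_nonneg (partialDeriv e (heightFun X) y))]

theorem IsPatch.continuousAt_partialDeriv_heightFun (h : IsPatch ε U X) {y : Coord n} (hy : y ∈ U)
    (e : Fin n) : ContinuousAt (partialDeriv e (heightFun X)) y :=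
  ((contDiffOn_partialDeriv h.isOpen h.smooth_heightFun e).contDiffAt
    (h.isOpen.mem_nhds hy)).continuousAt

theorem IsPatch.continuousAt_partialDeriv_axisFun (h : IsPatch ε U X) {y : Coord n} (hy : y ∈ U)
    (e : Fin n) : ContinuousAt (partialDeriv e (axisFun ε v X)) y :=
  ((contDiffOn_partialDeriv h.isOpen (h.smooth_axisFun v) e).contDiffAt
    (h.isOpen.mem_nhds hy)).continuousAt

theorem IsPatch.continuousAt_axisFun (h : IsPatch ε U X) {y : Coord n} (hy : y ∈ U) :
    ContinuousAt (axisFun ε v X) y :=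
  ((h.smooth_axisFun v).contDiffAt (h.isOpen.mem_nhds hy)).continuousAt

theorem IsPatch.continuousAt_axisDist (h : IsPatch ε U X) {y : Coord n} (hy : y ∈ U) :
    ContinuousAt (axisDist ε v X) y :=
  ((h.smooth_axisDist v).contDiffAt (h.isOpen.mem_nhds hy)).continuousAt

theorem eventually_partialDeriv_axisFun_eq_zero {y : Coord n}
    (h0 : ∀ᶠ z in 𝓝 y, axisFun ε v X z = 0) :
    ∀ᶠ z in 𝓝 y, ∀ i, partialDeriv i (axisFun ε v X) z = 0 := by
  filter_upwards [h0.eventually_nhds] with z hz i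
  have : axisFun ε v X =ᶠ[𝓝 z] fun _ => 0 := hz
  change fderiv ℝ _ z _ = 0
  rw [this.fderiv_eq]
  simp

/-- If `K = ε`, then the height is locally constant. -/
theorem partialDeriv_heightFun_eq_zero (hn : 3 ≤ n) (hε : ε = 1 ∨ ε = -1) (h : IsPatch ε U X)
    (hv : IsAxis ε v) (hT : IsTangentToOrbits ε v U X) (hK : PatchHasCurvature ε X U ε)
    {y : Coord n} (hy : y ∈ U) (e : Fin n) : partialDeriv e (heightFun X) y = 0 := by
  have hε0 : ε ≠ 0 := by rcases hε with rfl | rfl <;> norm_num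
  refine eq_zero_of_frequently (h.continuousAt_partialDeriv_heightFun hy e) ?_
  refine (frequently_axisDist_ne hn hε h hv hy).mono fun z hz => ?_
  by_contra hne
  -- On the neighbourhood where `∂ₑt ≠ 0`, the profile equation with `K = ε` reads `c² (∂ₑt)² = 0`.
  -- So `c` vanishes identically there and the curvature would have to be `0`.
  have hev := (h.continuousAt_partialDeriv_heightFun hz.1 e).eventually_ne hne
  refine hε0 (curvature_eq_zero_of_axisFun_const hn hε h hT hK hz.1 hz.2
    (eventually_partialDeriv_axisFun_eq_zero ?_))
  filter_upwards [hev, h.mem_nhds_axisDist_ne hz.1 hz.2] with a ha1 ha2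
  have hE := profile_equation hn hε h hT hK ha2.1 ha2.2 e
  rw [sub_self, zero_mul] at hE
  have := (mul_eq_zero.1 hE.symm).resolve_right (pow_ne_zero 2 ha1)
  exact pow_eq_zero_iff (two_ne_zero) |>.1 this

end Profile

/-! ### Symmetric hypersurfaces of constant sectional curvature: integration of the profile -/

section Integration

/-- The even solution of `φ'' = l φ` with `φ(0) = 1`. -/
def genCos (l t : ℝ) : ℝ :=
  if 0 < l then Real.cosh (√l * t) else if l = 0 then 1 else Real.cos (√(-l) * t)

/-- The odd solution of `φ'' = l φ` with `φ'(0) = 1`. -/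
def genSin (l t : ℝ) : ℝ :=
  if 0 < l then Real.sinh (√l * t) / √l else if l = 0 then t else Real.sin (√(-l) * t) / √(-l)

theorem hasDerivAt_const_mul_id (a t : ℝ) : HasDerivAt (fun s => a * s) a t := by
  simpa using (hasDerivAt_id t).const_mul a

theorem hasDerivAt_genCos (l t : ℝ) : HasDerivAt (genCos l) (l * genSin l t) t := by
  unfold genCos genSin
  split_ifs with h1 h2
  · refine ((Real.hasDerivAt_cosh _).comp t (hasDerivAt_const_mul_id (√l) t)).congr_deriv ?_
    have := Real.mul_self_sqrt h1.le
    have h0 : √l ≠ 0 := (Real.sqrt_pos.2 h1).ne'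
    field_simp
    linear_combination Real.sinh (√l * t) * this
  · simpa [h2] using hasDerivAt_const t (1 : ℝ)
  · have h3 : 0 < -l := by
      have := lt_of_le_of_ne (not_lt.1 h1) h2
      linarith
    refine ((Real.hasDerivAt_cos _).comp t (hasDerivAt_const_mul_id (√(-l)) t)).congr_deriv ?_
    have := Real.mul_self_sqrt h3.le
    have h0 : √(-l) ≠ 0 := (Real.sqrt_pos.2 h3).ne'
    field_simp
    linear_combination -Real.sin (√(-l) * t) * this

theorem hasDerivAt_genSin (l t : ℝ) : HasDerivAt (genSin l) (genCos l t) t := by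
  unfold genCos genSin
  split_ifs with h1 h2
  · refine (((Real.hasDerivAt_sinh _).comp t (hasDerivAt_const_mul_id (√l) t)).div_const
      (√l)).congr_deriv ?_
    have h0 : √l ≠ 0 := (Real.sqrt_pos.2 h1).ne'
    field_simp
  · exact hasDerivAt_id t
  · have h3 : 0 < -l := by
      have := lt_of_le_of_ne (not_lt.1 h1) h2
      linarith
    refine (((Real.hasDerivAt_sin _).comp t (hasDerivAt_const_mul_id (√(-l)) t)).div_const
      (√(-l))).congr_deriv ?_
    have h0 : √(-l) ≠ 0 := (Real.sqrt_pos.2 h3).ne'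
    field_simp

/-- The Wronskian of the two solutions. It allows the coefficients of a solution to be recovered
from its value and derivative. -/
theorem genCos_sq_sub (l t : ℝ) : genCos l t ^ 2 - l * genSin l t ^ 2 = 1 := by
  unfold genCos genSin
  split_ifs with h1 h2
  · have := Real.sq_sqrt h1.le
    have h0 : √l ≠ 0 := (Real.sqrt_pos.2 h1).ne'
    rw [div_pow, this, mul_div_cancel₀ _ h1.ne', Real.cosh_sq]
    ring
  · simp [h2]
  · have h3 : 0 < -l := by
      have := lt_of_le_of_ne (not_lt.1 h1) h2
      linarith
    have := Real.sq_sqrt h3.le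
    rw [div_pow, this, Real.cos_sq']
    field_simp
    ring

variable {n : ℕ} {ε K : ℝ} {U : Set (Coord n)} {X : Coord n → Amb n} {v : Vec n}

theorem partialDeriv_comp {φ : ℝ → ℝ} {φ' : ℝ} {g : Coord n → ℝ} {y : Coord n}
    (hφ : HasDerivAt φ φ' (g y)) (hg : DifferentiableAt ℝ g y) (i : Fin n) :
    partialDeriv i (fun z => φ (g z)) y = φ' * partialDeriv i g y := by
  unfold partialDeriv
  have h := hφ.comp_hasFDerivAt y hg.hasFDerivAt
  change fderiv ℝ (φ ∘ g) y _ = _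
  rw [h.fderiv]
  simp

theorem eventually_const_of_partialDeriv_eq_zero {E : Type*} [NormedAddCommGroup E]
    [NormedSpace ℝ E] {g : Coord n → E} {y : Coord n}
    (h : ∀ᶠ z in 𝓝 y, DifferentiableAt ℝ g z ∧ ∀ i, partialDeriv i g z = 0) :
    ∀ᶠ z in 𝓝 y, g z = g y := by
  obtain ⟨r, hr, hball⟩ := Metric.eventually_nhds_iff_ball.1 h
  filter_upwards [Metric.ball_mem_nhds y hr] with z hz
  refine (convex_ball y r).is_const_of_fderivWithin_eq_zero (𝕜 := ℝ)
    (fun a ha => (hball a ha).1.differentiableWithinAt) (fun a ha => ?_) hz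
    (Metric.mem_ball_self hr)
  rw [fderivWithin_of_isOpen Metric.isOpen_ball ha]
  ext1 u
  rw [fderiv_apply_eq_sum]
  simp [(hball a ha).2]

/-- Near `y` the hypersurface is contained in `⟨x, v⟩ = A genCos l t + B genSin l t`. -/
def HasProfileAt (ε l : ℝ) (v : Vec n) (X : Coord n → Amb n) (y : Coord n) (q : ℝ × ℝ) : Prop :=
  ∀ᶠ z in 𝓝 y, axisFun ε v X z
    = q.1 * genCos l (heightFun X z) + q.2 * genSin l (heightFun X z)

/-- The constant `l` in the equation `φ'' = l φ` of the profile. -/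
def profileConst (ε K : ℝ) : ℝ := ε * K / (K - ε)

theorem exists_partialDeriv_heightFun_ne_zero (hn : 3 ≤ n) (hε : ε = 1 ∨ ε = -1)
    (h : IsPatch ε U X) (hT : IsTangentToOrbits ε v U X) (hK : PatchHasCurvature ε X U K)
    (hKε : ε < K) {y : Coord n} (hy : y ∈ U) (hoff : axisDist ε v X y ≠ 0) :
    ∃ e, partialDeriv e (heightFun X) y ≠ 0 := by
  obtain ⟨e, he⟩ := h.exists_partialDeriv_ne_zero hε hy hoff
  refine ⟨e, fun h0 => ?_⟩
  have hE := profile_equation hn hε h hT hK hy hoff e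
  rw [h0] at hE
  have h1 : (K - ε) * partialDeriv e (axisFun ε v X) y ^ 2 = 0 := by linear_combination hE
  have h2 := (mul_eq_zero.1 h1).resolve_left (by linarith)
  exact he.elim (fun h3 => h3 (pow_eq_zero_iff two_ne_zero |>.1 h2)) fun h3 => h3 h0

/-- With `C = dc/dt`, the profile equation becomes the first integral `C² = l c² - ⟨v, v⟩` of `c'' =
l c`. Once the second-order equation is known, the coefficients follow by variation of constants,
and the first integral is the constraint on them. -/
theorem exists_hasProfileAt_of_axisDist_ne (hn : 3 ≤ n) (hε : ε = 1 ∨ ε = -1)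
    (h : IsPatch ε U X) (hT : IsTangentToOrbits ε v U X) (hK : PatchHasCurvature ε X U K)
    (hKε : ε < K) {y : Coord n} (hy : y ∈ U) (hoff : axisDist ε v X y ≠ 0) :
    ∃ q : ℝ × ℝ, HasProfileAt ε (profileConst ε K) v X y q ∧
      profileConst ε K * q.1 ^ 2 - q.2 ^ 2 = form ε v v := by
  have hε2 := sq_eq_one_of_sign hε
  have hKε0 : K - ε ≠ 0 := by linarith
  set l := profileConst ε K with hl
  obtain ⟨e, he⟩ := exists_partialDeriv_heightFun_ne_zero hn hε h hT hK hKε hy hoff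
  set c := axisFun ε v X with hc
  set t := heightFun X with ht
  set V : Set (Coord n) := {z | (z ∈ U ∧ axisDist ε v X z ≠ 0) ∧ partialDeriv e t z ≠ 0} with hV
  have hVo : IsOpen V := by
    rw [isOpen_iff_mem_nhds]
    intro z hz
    filter_upwards [h.mem_nhds_axisDist_ne hz.1.1 hz.1.2,
      (h.continuousAt_partialDeriv_heightFun hz.1.1 e).eventually_ne hz.2] with a h1 h2
    exact ⟨h1, h2⟩
  have hyV : y ∈ V := ⟨⟨hy, hoff⟩, he⟩
  have hVU : V ⊆ U := fun z hz => hz.1.1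
  set C : Coord n → ℝ := fun z => partialDeriv e c z / partialDeriv e t z with hC
  have hCs : ContDiffOn ℝ ∞ C V :=
    ((contDiffOn_partialDeriv h.isOpen (h.smooth_axisFun v) e).mono hVU).div
      ((contDiffOn_partialDeriv h.isOpen h.smooth_heightFun e).mono hVU) fun z hz => hz.2
  have dC : ∀ z ∈ V, DifferentiableAt ℝ C z :=
    fun z hz => differentiableAt_of_smooth hVo hCs hz
  have dc : ∀ z ∈ V, DifferentiableAt ℝ c z :=
    fun z hz => differentiableAt_of_smooth h.isOpen (h.smooth_axisFun v) (hVU hz)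
  have dt : ∀ z ∈ V, DifferentiableAt ℝ t z :=
    fun z hz => differentiableAt_of_smooth h.isOpen h.smooth_heightFun (hVU hz)
  have hci : ∀ z ∈ V, ∀ i, partialDeriv i c z = C z * partialDeriv i t z := by
    intro z hz i
    have := hT.wedge_eq_zero h hz.1.1 hz.1.2 e i
    have hz2 := hz.2
    simp only [hC]
    field_simp
    linear_combination this
  have hC2 : ∀ z ∈ V, C z * C z = l * (c z * c z) - form ε v v := by
    intro z hz
    have hE := profile_equation hn hε h hT hK hz.1.1 hz.1.2 e
    have hz2 := hz.2
    rw [hci z hz e] at hE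
    have hE2 : (K - ε) * (axisDist ε v X z + C z ^ 2) = c z ^ 2 := by
      refine mul_right_cancel₀ (pow_ne_zero 2 hz2) ?_
      linear_combination hE
    rw [axisDist] at hE2
    rw [hl, profileConst]
    field_simp
    linear_combination hE2 - c z ^ 2 * hε2
  -- The first integral only yields `C (dC - l c dt) = 0`. Where the second factor is nonzero, `C`
  -- vanishes on an open set, so `c` is constant there; this forces `K = 0`, hence `l = 0`, and the
  -- equation holds after all.
  have hdC : ∀ z ∈ V, ∀ i, partialDeriv i C z = l * c z * partialDeriv i t z := by
    intro z hz i
    by_contra hne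
    have hmul : ∀ a ∈ V, C a * (partialDeriv i C a - l * c a * partialDeriv i t a) = 0 := by
      intro a ha
      have h1 := partialDeriv_congr hVo (fun b hb => hC2 b hb) ha i
      rw [partialDeriv_mul (dC a ha) (dC a ha)] at h1
      have hd : DifferentiableAt ℝ (fun b => c b * c b) a := (dc a ha).fun_mul (dc a ha)
      have h2 : partialDeriv i (fun b => l * (c b * c b) - form ε v v) a
          = l * (partialDeriv i c a * c a + c a * partialDeriv i c a) := by
        rw [← partialDeriv_mul (dc a ha) (dc a ha)]
        unfold partialDeriv
        rw [fderiv_sub_const, fderiv_const_mul hd]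
        simp
      rw [h2, hci a ha] at h1
      linear_combination h1 / 2
    have hcont : ContinuousAt (fun a => partialDeriv i C a - l * c a * partialDeriv i t a) z := by
      refine ContinuousAt.sub ?_ (ContinuousAt.mul (continuousAt_const.mul (dc z hz).continuousAt)
        (h.continuousAt_partialDeriv_heightFun (hVU hz) i))
      exact ((contDiffOn_partialDeriv hVo hCs i).contDiffAt (hVo.mem_nhds hz)).continuousAt
    have hC0 : ∀ᶠ a in 𝓝 z, C a = 0 := by
      filter_upwards [hcont.eventually_ne (sub_ne_zero.2 hne), hVo.mem_nhds hz] with a h1 h2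
      exact (mul_eq_zero.1 (hmul a h2)).resolve_right h1
    have hc0 : ∀ᶠ a in 𝓝 z, ∀ j, partialDeriv j c a = 0 := by
      filter_upwards [hC0, hVo.mem_nhds hz] with a h1 h2 j
      rw [hci a h2, h1, zero_mul]
    have hK0 := curvature_eq_zero_of_axisFun_const hn hε h hT hK hz.1.1 hz.1.2 hc0
    have hl0 : l = 0 := by rw [hl, profileConst, hK0]; simp
    have : partialDeriv i C z = 0 := by
      have : C =ᶠ[𝓝 z] fun _ => 0 := hC0
      unfold partialDeriv
      rw [this.fderiv_eq]
      simp
    exact hne (by rw [this, hl0]; ring)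
  have dCos : ∀ z ∈ V, DifferentiableAt ℝ (fun a => genCos l (t a)) z := fun z hz =>
    ((hasDerivAt_genCos l (t z)).differentiableAt.comp z (dt z hz))
  have dSin : ∀ z ∈ V, DifferentiableAt ℝ (fun a => genSin l (t a)) z := fun z hz =>
    ((hasDerivAt_genSin l (t z)).differentiableAt.comp z (dt z hz))
  have pCos := fun z (hz : z ∈ V) i => partialDeriv_comp (hasDerivAt_genCos l (t z)) (dt z hz) i
  have pSin := fun z (hz : z ∈ V) i => partialDeriv_comp (hasDerivAt_genSin l (t z)) (dt z hz) i
  -- This expression and the one in `hB` solve the system `c = A genCos + B genSin`, `C = l A genSin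
  -- + B genCos` for `A` and `B`, whose determinant is `1`.
  have hA : ∀ᶠ z in 𝓝 y, c z * genCos l (t z) - C z * genSin l (t z)
      = c y * genCos l (t y) - C y * genSin l (t y) := by
    refine eventually_const_of_partialDeriv_eq_zero
      (g := fun z => c z * genCos l (t z) - C z * genSin l (t z)) ?_
    filter_upwards [hVo.mem_nhds hyV] with z hz
    have d1 := (dc z hz).fun_mul (dCos z hz)
    have d2 := (dC z hz).fun_mul (dSin z hz)
    refine ⟨d1.fun_sub d2, fun i => ?_⟩
    have h1 := partialDeriv_mul (dc z hz) (dCos z hz) i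
    have h2 := partialDeriv_mul (dC z hz) (dSin z hz) i
    have h3 : partialDeriv i (fun z => c z * genCos l (t z) - C z * genSin l (t z)) z
        = partialDeriv i (fun z => c z * genCos l (t z)) z
          - partialDeriv i (fun z => C z * genSin l (t z)) z := by
      unfold partialDeriv
      rw [fderiv_fun_sub d1 d2]; rfl
    have h4 := pCos z hz i
    have h5 := pSin z hz i
    have h6 := hci z hz i
    have h7 := hdC z hz i
    rw [h3]
    rw [h1, h2, h4, h5, h6, h7]
    ring
  have hB : ∀ᶠ z in 𝓝 y, C z * genCos l (t z) - l * (c z * genSin l (t z))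
      = C y * genCos l (t y) - l * (c y * genSin l (t y)) := by
    refine eventually_const_of_partialDeriv_eq_zero
      (g := fun z => C z * genCos l (t z) - l * (c z * genSin l (t z))) ?_
    filter_upwards [hVo.mem_nhds hyV] with z hz
    have d1 := (dC z hz).fun_mul (dCos z hz)
    have d2 := (dc z hz).fun_mul (dSin z hz)
    refine ⟨d1.fun_sub (d2.const_mul l), fun i => ?_⟩
    have h1 := partialDeriv_mul (dC z hz) (dCos z hz) i
    have h2 := partialDeriv_mul (dc z hz) (dSin z hz) i
    have h3 : partialDeriv i (fun z => C z * genCos l (t z) - l * (c z * genSin l (t z))) z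
        = partialDeriv i (fun z => C z * genCos l (t z)) z
          - l * partialDeriv i (fun z => c z * genSin l (t z)) z := by
      unfold partialDeriv
      rw [fderiv_fun_sub d1 (d2.const_mul l)]
      rw [fderiv_const_mul d2]; rfl
    have h4 := pCos z hz i
    have h5 := pSin z hz i
    have h6 := hci z hz i
    have h7 := hdC z hz i
    rw [h3]
    rw [h1, h2, h4, h5, h6, h7]
    ring
  have hgen := fun z => genCos_sq_sub l (t z)
  refine ⟨(c y * genCos l (t y) - C y * genSin l (t y),
    C y * genCos l (t y) - l * (c y * genSin l (t y))), ?_, ?_⟩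
  · change ∀ᶠ z in 𝓝 y, c z = _
    filter_upwards [hA, hB] with z h1 h2
    rw [← h1, ← h2]
    linear_combination -(c z) * hgen z
  · have := hC2 y hyV
    linear_combination (l * c y ^ 2 - C y ^ 2) * hgen y - this

/-- Near some point off the axis, where `dt ≠ 0`, the difference of the two profiles vanishes
together with its derivative in `t`. The Wronskian being `1`, both coefficients of the difference
are zero. -/
theorem HasProfileAt.unique (hn : 3 ≤ n) (hε : ε = 1 ∨ ε = -1)
    (h : IsPatch ε U X) (hv : IsAxis ε v) (hT : IsTangentToOrbits ε v U X)
    (hK : PatchHasCurvature ε X U K) (hKε : ε < K) {y : Coord n} (hy : y ∈ U) {l : ℝ} {q r : ℝ × ℝ}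
    (hq : HasProfileAt ε l v X y q) (hr : HasProfileAt ε l v X y r) : q = r := by
  have hev : ∀ᶠ z in 𝓝 y, (q.1 - r.1) * genCos l (heightFun X z)
      + (q.2 - r.2) * genSin l (heightFun X z) = 0 := by
    filter_upwards [hq, hr] with z h1 h2
    linear_combination h2 - h1
  obtain ⟨z, ⟨hzU, hzo⟩, hz⟩ :=
    ((frequently_axisDist_ne hn hε h hv hy).and_eventually hev.eventually_nhds).exists
  obtain ⟨i, hi⟩ := exists_partialDeriv_heightFun_ne_zero hn hε h hT hK hKε hzU hzo
  have dt := differentiableAt_of_smooth h.isOpen h.smooth_heightFun hzU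
  have hd := ((hasDerivAt_genCos l (heightFun X z)).const_mul (q.1 - r.1)).add
    ((hasDerivAt_genSin l (heightFun X z)).const_mul (q.2 - r.2))
  have h1 := partialDeriv_comp hd dt i
  have h2 : partialDeriv i (fun a => (q.1 - r.1) * genCos l (heightFun X a)
      + (q.2 - r.2) * genSin l (heightFun X a)) z = 0 := by
    have : (fun a => (q.1 - r.1) * genCos l (heightFun X a)
      + (q.2 - r.2) * genSin l (heightFun X a)) =ᶠ[𝓝 z] fun _ => 0 := hz
    unfold partialDeriv
    rw [this.fderiv_eq]
    simp
  have h3 := (mul_eq_zero.1 (h1.symm.trans h2)).resolve_right hi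
  have h4 := hz.self_of_nhds
  have hg := genCos_sq_sub l (heightFun X z)
  refine Prod.ext (sub_eq_zero.1 ?_) (sub_eq_zero.1 ?_)
  · linear_combination -(q.1 - r.1) * hg + genCos l (heightFun X z) * h4
      - genSin l (heightFun X z) * h3
  · linear_combination -(q.2 - r.2) * hg - l * genSin l (heightFun X z) * h4
      + genCos l (heightFun X z) * h3

/-- The homeomorphism `univBall` from the whole space to the ball carries the complement of the
origin to the punctured ball. -/
theorem isPreconnected_ball_diff_center (hn : 2 ≤ n) (y : Coord n) {r : ℝ} (hr : 0 < r) :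
    IsPreconnected (Metric.ball y r \ {y}) := by
  have hrank : 1 < Module.rank ℝ (Coord n) := by
    rw [← Module.finrank_eq_rank]
    simp only [finrank_euclideanSpace, Fintype.card_fin]
    exact_mod_cast hn
  have h0 := (isConnected_compl_singleton_of_one_lt_rank hrank (0 : Coord n)).isPreconnected
  have h1 := h0.image _ (OpenPartialHomeomorph.continuous_univBall y r).continuousOn
  have hs : (OpenPartialHomeomorph.univBall y r).source = univ :=
    OpenPartialHomeomorph.univBall_source y r
  have ht := OpenPartialHomeomorph.univBall_target y hr
  suffices hset : Metric.ball y r \ {y} = OpenPartialHomeomorph.univBall y r '' {0}ᶜ by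
    rw [hset]; exact h1
  ext z
  constructor
  · rintro ⟨hz, hzy⟩
    rw [← ht] at hz
    refine ⟨_, ?_, (OpenPartialHomeomorph.univBall y r).right_inv hz⟩
    intro h2
    refine hzy ?_
    rw [mem_singleton_iff] at h2 ⊢
    rw [← (OpenPartialHomeomorph.univBall y r).right_inv hz, h2,
      OpenPartialHomeomorph.univBall_apply_zero]
  · rintro ⟨w, hw, rfl⟩
    refine ⟨ht ▸ (OpenPartialHomeomorph.univBall y r).map_source (by rw [hs]; trivial), ?_⟩
    intro h2
    rw [mem_singleton_iff] at h2
    refine hw ((OpenPartialHomeomorph.univBall y r).injOn (by rw [hs]; trivial)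
      (by rw [hs]; trivial) ?_)
    rw [h2, OpenPartialHomeomorph.univBall_apply_zero]

/-- A relation that is locally constant and single-valued is constant on preconnected sets. -/
theorem exists_const_of_isPreconnected {Y Z : Type*} [TopologicalSpace Y] {s : Set Y}
    (hs : IsPreconnected s) (hne : s.Nonempty) {R : Y → Z → Prop}
    (hex : ∀ y ∈ s, ∃ z, R y z) (huniq : ∀ y ∈ s, ∀ z w, R y z → R y w → z = w)
    (hopen : ∀ y ∈ s, ∀ z, R y z → ∀ᶠ x in 𝓝 y, R x z) : ∃ z, ∀ y ∈ s, R y z := by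
  have : PreconnectedSpace s := isPreconnected_iff_preconnectedSpace.1 hs
  choose F hF using fun y : s => hex y y.2
  obtain ⟨y₀, hy₀⟩ := hne
  have hloc : IsLocallyConstant F := by
    rw [IsLocallyConstant.iff_eventually_eq]
    intro y
    have := (continuous_subtype_val (p := fun a => a ∈ s)).continuousAt.eventually
      (hopen y y.2 _ (hF y))
    filter_upwards [this] with x hx
    exact huniq x x.2 _ _ (hF x) hx
  refine ⟨F ⟨y₀, hy₀⟩, fun y hy => ?_⟩
  rw [hloc.apply_eq_of_preconnectedSpace ⟨y₀, hy₀⟩ ⟨y, hy⟩]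
  exact hF ⟨y, hy⟩

/-- At a point of the axis `x = ±v`, so `dc = 0`. Extended there by continuity, the profile equation
has `D = 0` and `c² = 1` and forces `dt = 0`. The horizontal projection is then an immersion at `y`,
hence takes the value `x(y)` only at `y` nearby, whereas neighbouring axis points would all have
this value. -/
theorem eventually_nhdsNE_axisDist_ne (hn : 3 ≤ n) (hε : ε = 1 ∨ ε = -1)
    (h : IsPatch ε U X) (hv : IsAxis ε v) (hT : IsTangentToOrbits ε v U X)
    (hK : PatchHasCurvature ε X U K) {y : Coord n} (hy : y ∈ U)
    (hon : axisDist ε v X y = 0) : ∀ᶠ z in 𝓝[≠] y, axisDist ε v X z ≠ 0 := by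
  obtain ⟨-, hc1, hxv⟩ := hv.form_of_form_sub_eq_zero hε (h.mem y hy).1 hon
  have hε2 := sq_eq_one_of_sign hε
  have hvx := eq_smul_of_form_sub_eq_zero hε (h.mem y hy).1 hon
  have hce : ∀ i, partialDeriv i (axisFun ε v X) y = 0 := by
    intro i
    have := congrArg (form ε (partialDeriv i X y).1) hvx
    rwa [form_smul_right, form_comm _ (X y).1, h.form_partialDeriv hy, mul_zero,
      ← h.partialDeriv_axisFun v hy] at this
  have hte : ∀ e, partialDeriv e (heightFun X) y = 0 := by
    intro e
    have h0 : (fun z => (K - ε) * (axisDist ε v X z * partialDeriv e (heightFun X) z ^ 2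
        + partialDeriv e (axisFun ε v X) z ^ 2)
        - axisFun ε v X z ^ 2 * partialDeriv e (heightFun X) z ^ 2) y = 0 := by
      refine eq_zero_of_frequently ?_ ((frequently_axisDist_ne hn hε h hv hy).mono fun z hz =>
        sub_eq_zero.2 (profile_equation hn hε h hT hK hz.1 hz.2 e))
      have a1 : ContinuousAt (axisDist ε v X) y := h.continuousAt_axisDist hy
      have a2 := h.continuousAt_partialDeriv_heightFun hy e
      have a3 : ContinuousAt (partialDeriv e (axisFun ε v X)) y :=
        h.continuousAt_partialDeriv_axisFun hy e
      have a4 : ContinuousAt (axisFun ε v X) y := h.continuousAt_axisFun hy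
      exact (continuousAt_const.mul ((a1.mul (a2.pow 2)).add (a3.pow 2))).sub
        ((a4.pow 2).mul (a2.pow 2))
    have hc1' : axisFun ε v X y ^ 2 = 1 := hc1
    simp only [hon, hce, hc1'] at h0
    have : partialDeriv e (heightFun X) y ^ 2 = 0 := by linear_combination -h0
    exact pow_eq_zero_iff two_ne_zero |>.1 this
  have hsnd : ∀ u : Coord n, (fderiv ℝ X y u).2 = 0 := by
    intro u
    rw [← WithLp.toLp_ofLp 2 u, ← dirDeriv_eq_fderiv, ← h.dirDeriv_heightFun hy, dirDeriv]
    simp [hte]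
  have hd := (differentiableAt_of_smooth h.isOpen h.smooth hy).hasFDerivAt.fst
  have hker : LinearMap.ker (((ContinuousLinearMap.fst ℝ (Vec n) ℝ).comp (fderiv ℝ X y) :
      Coord n →L[ℝ] Vec n) : Coord n →ₗ[ℝ] Vec n) = ⊥ := by
    rw [LinearMap.ker_eq_bot]
    intro a b hab
    exact h.inj y hy (Prod.ext hab ((hsnd a).trans (hsnd b).symm))
  obtain ⟨C, -, hC⟩ := LinearMap.exists_antilipschitzWith _ hker
  have hne := hd.eventually_ne (c := (X y).1) ⟨C, hC⟩
  have hcont : ContinuousAt (fun z => axisFun ε v X z * axisFun ε v X y) y :=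
    (h.continuousAt_axisFun hy).mul continuousAt_const
  have hpos : 0 < axisFun ε v X y * axisFun ε v X y := by
    have hc1' : axisFun ε v X y ^ 2 = 1 := hc1
    nlinarith
  filter_upwards [hne, nhdsWithin_le_nhds (hcont.eventually_const_lt hpos),
    nhdsWithin_le_nhds (h.isOpen.mem_nhds hy)] with z h1 h2 h3 h4
  obtain ⟨-, hcz, hxz⟩ := hv.form_of_form_sub_eq_zero hε (h.mem z h3).1 h4
  refine h1 ?_
  have : form ε (X z).1 v = form ε (X y).1 v := by
    rcases sq_eq_sq_iff_eq_or_eq_neg.1 (hcz.trans hc1.symm) with h5 | h5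
    · exact h5
    · unfold axisFun at h2 hpos
      rw [h5] at h2; linarith
  rw [hxz, this, ← hxv]

/-- An axis point is isolated, so the coefficients are defined on a punctured ball around it. They
are constant there because the punctured ball is connected, and the relation passes to the centre by
continuity. -/
theorem exists_hasProfileAt (hn : 3 ≤ n) (hε : ε = 1 ∨ ε = -1)
    (h : IsPatch ε U X) (hv : IsAxis ε v) (hT : IsTangentToOrbits ε v U X)
    (hK : PatchHasCurvature ε X U K) (hKε : ε < K) {y : Coord n} (hy : y ∈ U) :
    ∃ q : ℝ × ℝ, HasProfileAt ε (profileConst ε K) v X y q ∧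
      profileConst ε K * q.1 ^ 2 - q.2 ^ 2 = form ε v v := by
  by_cases hon : axisDist ε v X y = 0
  swap
  · exact exists_hasProfileAt_of_axisDist_ne hn hε h hT hK hKε hy hon
  have hev := eventually_nhdsNE_axisDist_ne hn hε h hv hT hK hy hon
  have hev2 : ∀ᶠ z in 𝓝 y, z ∈ U ∧ (z ≠ y → axisDist ε v X z ≠ 0) := by
    rw [eventually_nhdsWithin_iff] at hev
    filter_upwards [hev, h.isOpen.mem_nhds hy] with z h1 h2 using ⟨h2, fun h3 => h1 h3⟩
  obtain ⟨r, hr, hball⟩ := Metric.eventually_nhds_iff_ball.1 hev2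
  have : Nonempty (Fin n) := ⟨⟨0, by omega⟩⟩
  have hneb : (𝓝[≠] y).NeBot := by
    have : Nontrivial (Coord n) := inferInstance
    exact Module.punctured_nhds_neBot ℝ (Coord n) y
  have hnonempty : (Metric.ball y r \ {y}).Nonempty := by
    have : Metric.ball y r \ {y} ∈ 𝓝[≠] y :=
      sdiff_mem_nhdsWithin_compl (Metric.ball_mem_nhds y hr) {y}
    exact hneb.nonempty_of_mem this
  obtain ⟨q, hq⟩ := exists_const_of_isPreconnected
    (isPreconnected_ball_diff_center (by omega) y hr) hnonempty
    (R := fun z q => HasProfileAt ε (profileConst ε K) v X z q ∧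
      profileConst ε K * q.1 ^ 2 - q.2 ^ 2 = form ε v v)
    (fun z hz => exists_hasProfileAt_of_axisDist_ne hn hε h hT hK hKε (hball z hz.1).1
      ((hball z hz.1).2 hz.2))
    (fun z hz p q hp hq => hp.1.unique hn hε h hv hT hK hKε (hball z hz.1).1 hq.1)
    (fun z _ q hq => by
      filter_upwards [hq.1.eventually_nhds] with a ha using ⟨ha, hq.2⟩)
  refine ⟨q, ?_, (hq _ hnonempty.some_mem).2⟩
  have hpt : ∀ z ∈ Metric.ball y r \ {y}, axisFun ε v X z
      - (q.1 * genCos (profileConst ε K) (heightFun X z)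
        + q.2 * genSin (profileConst ε K) (heightFun X z)) = 0 := fun z hz =>
    sub_eq_zero.2 (hq z hz).1.self_of_nhds
  have hy0 : axisFun ε v X y - (q.1 * genCos (profileConst ε K) (heightFun X y)
        + q.2 * genSin (profileConst ε K) (heightFun X y)) = 0 := by
    refine eq_zero_of_frequently (g := fun z => axisFun ε v X z
      - (q.1 * genCos (profileConst ε K) (heightFun X z)
        + q.2 * genSin (profileConst ε K) (heightFun X z))) ?_ ?_
    · have a1 : ContinuousAt (axisFun ε v X) y := h.continuousAt_axisFun hy
      have a2 : ContinuousAt (heightFun X) y :=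
        (differentiableAt_of_smooth h.isOpen h.smooth_heightFun hy).continuousAt
      have a3 := (hasDerivAt_genCos (profileConst ε K) (heightFun X y)).continuousAt.comp a2
      have a4 := (hasDerivAt_genSin (profileConst ε K) (heightFun X y)).continuousAt.comp a2
      exact a1.sub ((continuousAt_const.mul a3).add (continuousAt_const.mul a4))
    · have h1 : ∀ᶠ z in 𝓝[≠] y, z ∈ Metric.ball y r \ {y} :=
        sdiff_mem_nhdsWithin_compl (Metric.ball_mem_nhds y hr) {y}
      exact (h1.frequently.filter_mono nhdsWithin_le_nhds).mono hpt
  refine Filter.mem_of_superset (Metric.ball_mem_nhds y hr) fun z hz => ?_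
  by_cases hzy : z = y
  · subst hzy; exact sub_eq_zero.1 hy0
  · exact sub_eq_zero.1 (hpt z ⟨hz, hzy⟩)

end Integration

/-! ### Global consequences of connectedness -/

section Global

variable {n : ℕ} {ε K : ℝ} {v : Vec n}
variable {S : Type*} [TopologicalSpace S] [ChartedSpace (Coord n) S] {f : S → Amb n}

/-- Invariance of `f` under the isometries near the identity that are determined by `v`. -/
def IsSymmetricAbout (ε : ℝ) (v : Vec n) (f : S → Amb n) : Prop :=
  ∀ p : S, ∀ U ∈ 𝓝 p, ∀ᶠ A in 𝓝[symmetryGroup ε v] (ContinuousLinearMap.id ℝ (Vec n)),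
    (A (f p).1, (f p).2) ∈ f '' U

theorem HasConstantSectionalCurvature.patch [IsManifold (𝓡 n) ∞ S]
    (hK : HasConstantSectionalCurvature ε f K) (p : S) :
    PatchHasCurvature ε (f ∘ (chartAt (Coord n) p).symm) (chartAt (Coord n) p).target K :=
  hK _ (IsManifold.chart_mem_maximalAtlas p)

theorem le_of_hasConstantSectionalCurvature [IsManifold (𝓡 n) ∞ S] [Nonempty S] (hn : 3 ≤ n)
    (hε : ε = 1 ∨ ε = -1) (hf : IsHypersurface ε f) (hv : IsAxis ε v)
    (hsym : IsSymmetricAbout ε v f) (hK : HasConstantSectionalCurvature ε f K) : ε ≤ K := by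
  obtain ⟨p⟩ := ‹Nonempty S›
  have hp := hf.isPatch (chart_mem_atlas (Coord n) p)
  obtain ⟨z, hz⟩ := (frequently_axisDist_ne hn hε hp hv (mem_chart_target _ p)).exists
  exact le_curvature hn hε hp (hf.isTangentToOrbits hε hsym (chart_mem_atlas _ p)) (hK.patch p)
    hz.1 hz.2

/-- The case `K = ε`. -/
theorem exists_height_const [IsManifold (𝓡 n) ∞ S] [ConnectedSpace S] (hn : 3 ≤ n)
    (hε : ε = 1 ∨ ε = -1) (hf : IsHypersurface ε f) (hv : IsAxis ε v)
    (hsym : IsSymmetricAbout ε v f) (hK : HasConstantSectionalCurvature ε f ε) :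
    ∃ h : ℝ, ∀ p, (f p).2 = h := by
  have hloc : IsLocallyConstant fun p => (f p).2 := by
    rw [IsLocallyConstant.iff_eventually_eq]
    intro p
    set e := chartAt (Coord n) p with he
    have hp := hf.isPatch (chart_mem_atlas (Coord n) p)
    have hT := hf.isTangentToOrbits hε hsym (chart_mem_atlas (Coord n) p)
    have hps := mem_chart_source (Coord n) p
    have h1 : ∀ᶠ z in 𝓝 (e p), heightFun (f ∘ e.symm) z = heightFun (f ∘ e.symm) (e p) := by
      refine eventually_const_of_partialDeriv_eq_zero ?_
      filter_upwards [hp.isOpen.mem_nhds (mem_chart_target _ p)] with z hz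
      exact ⟨differentiableAt_of_smooth hp.isOpen hp.smooth_heightFun hz,
        fun i => partialDeriv_heightFun_eq_zero hn hε hp hv hT (hK.patch p) hz i⟩
    filter_upwards [(e.continuousAt hps).eventually h1, e.open_source.mem_nhds hps] with q hq hqs
    simpa [heightFun, e.left_inv hqs, e.left_inv hps] using hq
  obtain ⟨p₀⟩ : Nonempty S := inferInstance
  exact ⟨(f p₀).2, fun p => hloc.apply_eq_of_preconnectedSpace p p₀⟩

/-- The case `ε < K`. -/
theorem exists_profile [IsManifold (𝓡 n) ∞ S] [ConnectedSpace S] (hn : 3 ≤ n)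
    (hε : ε = 1 ∨ ε = -1) (hf : IsHypersurface ε f) (hv : IsAxis ε v)
    (hsym : IsSymmetricAbout ε v f) (hK : HasConstantSectionalCurvature ε f K) (hKε : ε < K) :
    ∃ A B : ℝ, profileConst ε K * A ^ 2 - B ^ 2 = form ε v v ∧ ∀ p, form ε (f p).1 v
      = A * genCos (profileConst ε K) (f p).2 + B * genSin (profileConst ε K) (f p).2 := by
  set l := profileConst ε K with hl
  set R : S → ℝ × ℝ → Prop := fun p q => (∀ᶠ a in 𝓝 p, form ε (f a).1 v
      = q.1 * genCos l (f a).2 + q.2 * genSin l (f a).2) ∧ l * q.1 ^ 2 - q.2 ^ 2 = form ε v v with hR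
  have key : ∀ p : S, (∃ q, R p q) ∧ ∀ q r, R p q → R p r → q = r := by
    intro p
    set e := chartAt (Coord n) p with he
    have hp := hf.isPatch (chart_mem_atlas (Coord n) p)
    have hT := hf.isTangentToOrbits hε hsym (chart_mem_atlas (Coord n) p)
    have hps := mem_chart_source (Coord n) p
    have hpt := mem_chart_target (Coord n) p
    constructor
    · obtain ⟨q, hq, hq2⟩ := exists_hasProfileAt hn hε hp hv hT (hK.patch p) hKε hpt
      refine ⟨q, ?_, hq2⟩
      filter_upwards [(e.continuousAt hps).eventually hq, e.open_source.mem_nhds hps] with a ha has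
      simp only [axisFun, heightFun, Function.comp_apply] at ha
      rwa [e.left_inv has] at ha
    · have hconv : ∀ q, R p q → HasProfileAt ε l v (f ∘ e.symm) (e p) q := by
        intro q hq
        exact (e.tendsto_symm hps).eventually hq.1
      intro q r hq hr
      exact (hconv q hq).unique hn hε hp hv hT (hK.patch p) hKε hpt (hconv r hr)
  obtain ⟨q, hq⟩ := exists_const_of_isPreconnected (isPreconnected_univ (α := S)) univ_nonempty
    (R := R) (fun p _ => (key p).1) (fun p _ => (key p).2)
    (fun p _ q hq => by filter_upwards [hq.1.eventually_nhds] with a ha using ⟨ha, hq.2⟩)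
  obtain ⟨p₀⟩ : Nonempty S := inferInstance
  exact ⟨q.1, q.2, (hq p₀ trivial).2, fun p => (hq p trivial).1.self_of_nhds⟩

/-- The two equations `⟨x, x⟩ = ε` and `F = 0` of `P`, together with a left inverse `L` of `dX`,
form local coordinates of `ℝ^{n+1} × ℝ`. A point of `P` near `X y` is determined by its
`L`-coordinate, and the inverse function theorem for `L ∘ X` supplies a point of the patch with the
same one. -/
theorem IsPatch.eventually_mem_image {U : Set (Coord n)} {X : Coord n → Amb n}
    (hε : ε = 1 ∨ ε = -1) (h : IsPatch ε U X) {P : Set (Amb n)}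
    (hP : IsProperlyEmbeddedHypersurface ε P) (hXP : MapsTo X U P) {y : Coord n} (hy : y ∈ U) :
    ∀ᶠ z in 𝓝 (X y), z ∈ P → z ∈ X '' U := by
  obtain ⟨W, F, hWo, hqW, hF, hPW, w, hw, hFw⟩ := hP.regular (X y) (hXP hy)
  have hε0 : ε ≠ 0 := by rcases hε with rfl | rfl <;> norm_num
  have hx := (h.mem y hy).1.1
  have hXs : HasStrictFDerivAt X (fderiv ℝ X y) y :=
    (h.smooth.contDiffAt (h.isOpen.mem_nhds hy)).hasStrictFDerivAt (by simp)
  have hFs : HasStrictFDerivAt F (fderiv ℝ F (X y)) (X y) :=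
    (hF.contDiffAt (hWo.mem_nhds hqW)).hasStrictFDerivAt (by simp)
  have hFP : ∀ z ∈ P ∩ W, F z = 0 := fun z hz => by rw [hPW] at hz; exact hz.2
  -- the left inverse of the differential of `X`
  obtain ⟨L₀, hL₀⟩ := (fderiv ℝ X y : Coord n →ₗ[ℝ] Amb n).exists_leftInverse_of_injective
    (LinearMap.ker_eq_bot.2 (h.inj y hy))
  set L : Amb n →L[ℝ] Coord n := L₀.toContinuousLinearMap with hL
  have hLX : ∀ u, L (fderiv ℝ X y u) = u := fun u => LinearMap.congr_fun hL₀ u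
  have hg : HasStrictFDerivAt (fun z => L (X z))
      ((ContinuousLinearEquiv.refl ℝ (Coord n) : Coord n ≃L[ℝ] Coord n) : Coord n →L[ℝ] Coord n)
      y := by
    have h1 : L.comp (fderiv ℝ X y) = ContinuousLinearEquiv.refl ℝ (Coord n) := by
      ext1 u; exact hLX u
    rw [← h1]
    exact L.hasStrictFDerivAt.comp y hXs
  -- the differential of `X` maps onto the kernel of the differentials of the equations
  have hFX : ∀ u, fderiv ℝ F (X y) (fderiv ℝ X y u) = 0 := by
    intro u
    have hcomp := hFs.hasFDerivAt.comp y hXs.hasFDerivAt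
    have hzero : F ∘ X =ᶠ[𝓝 y] fun _ => 0 := by
      filter_upwards [h.isOpen.mem_nhds hy,
        hXs.hasFDerivAt.continuousAt.preimage_mem_nhds (hWo.mem_nhds hqW)] with z hz1 hz2
      exact hFP _ ⟨hXP hz1, hz2⟩
    have h1 := hcomp.unique ((hasFDerivAt_const (0 : ℝ) y).congr_of_eventuallyEq hzero)
    exact congrArg (fun T => T u) h1
  let ℓ : Amb n →ₗ[ℝ] ℝ × ℝ :=
    ((formL n ε (X y).1 : Vec n →ₗ[ℝ] ℝ).comp (LinearMap.fst ℝ (Vec n) ℝ)).prod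
      (fderiv ℝ F (X y) : Amb n →ₗ[ℝ] ℝ)
  have hℓ : ∀ z, ℓ z = (form ε (X y).1 z.1, fderiv ℝ F (X y) z) := fun _ => rfl
  have hsurj : LinearMap.range ℓ = ⊤ := by
    rw [LinearMap.range_eq_top]
    rintro ⟨a, b⟩
    refine ⟨(a / ε) • ((X y).1, (0 : ℝ))
      + ((b - a / ε * fderiv ℝ F (X y) ((X y).1, (0 : ℝ))) / fderiv ℝ F (X y) w) • w, ?_⟩
    rw [hℓ]
    refine Prod.ext ?_ ?_
    · simp only [Prod.fst_add, Prod.smul_fst, form_add_right, form_smul_right, hx, hw]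
      field_simp
      ring
    · simp only [map_add, map_smul, smul_eq_mul]
      field_simp
      ring
  have hle : LinearMap.range (fderiv ℝ X y : Coord n →ₗ[ℝ] Amb n) ≤ LinearMap.ker ℓ := by
    rintro _ ⟨u, rfl⟩
    rw [LinearMap.mem_ker, hℓ]
    refine Prod.ext ?_ (hFX u)
    simpa [dirDeriv_eq_fderiv] using h.form_dirDeriv hy u.ofLp
  have hrange : LinearMap.range (fderiv ℝ X y : Coord n →ₗ[ℝ] Amb n) = LinearMap.ker ℓ := by
    refine Submodule.eq_of_le_of_finrank_eq hle ?_
    rw [LinearMap.finrank_range_of_inj (h.inj y hy)]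
    have h1 := ℓ.finrank_range_add_finrank_ker
    rw [hsurj] at h1
    simp [Module.finrank_prod] at h1 ⊢
    omega
  -- the equations together with `L` are local coordinates
  let Θ' : Amb n →L[ℝ] Coord n × ℝ × ℝ := L.prod
    (((2 : ℝ) • (formL n ε (X y).1).comp (ContinuousLinearMap.fst ℝ (Vec n) ℝ)).prod
      (fderiv ℝ F (X y)))
  have hΘ' : ∀ z, Θ' z = (L z, 2 * form ε (X y).1 z.1, fderiv ℝ F (X y) z) := fun _ => rfl
  have hinj : Function.Injective (Θ' : Amb n →ₗ[ℝ] Coord n × ℝ × ℝ) := by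
    rw [← LinearMap.ker_eq_bot, LinearMap.ker_eq_bot']
    intro z hz
    change Θ' z = 0 at hz
    rw [hΘ'] at hz
    have h1 : L z = 0 := congrArg Prod.fst hz
    have h2 : 2 * form ε (X y).1 z.1 = 0 := congrArg (fun a => a.2.1) hz
    have h3 : fderiv ℝ F (X y) z = 0 := congrArg (fun a => a.2.2) hz
    have h4 : z ∈ LinearMap.ker ℓ := by
      rw [LinearMap.mem_ker, hℓ]
      exact Prod.ext (by simpa using h2) h3
    rw [← hrange] at h4
    obtain ⟨u, rfl⟩ := h4
    have : u = 0 := (hLX u).symm.trans h1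
    rw [this, map_zero]
  let Θe : Amb n ≃L[ℝ] Coord n × ℝ × ℝ :=
    (LinearMap.linearEquivOfInjective (Θ' : Amb n →ₗ[ℝ] Coord n × ℝ × ℝ) hinj
      (by simp [Module.finrank_prod])).toContinuousLinearEquiv
  set Θ : Amb n → Coord n × ℝ × ℝ := fun z => (L z, form ε z.1 z.1, F z) with hΘ
  have hΘs : HasStrictFDerivAt Θ (Θe : Amb n →L[ℝ] Coord n × ℝ × ℝ) (X y) := by
    have h1 : HasStrictFDerivAt (fun z : Amb n => form ε z.1 z.1)
        ((2 : ℝ) • (formL n ε (X y).1).comp (ContinuousLinearMap.fst ℝ (Vec n) ℝ)) (X y) := by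
      have h2 := (formL n ε).hasStrictFDerivAt_of_bilinear
        (hasStrictFDerivAt_fst (𝕜 := ℝ) (p := X y)) (hasStrictFDerivAt_fst (𝕜 := ℝ) (p := X y))
      refine h2.congr_fderiv ?_
      refine ContinuousLinearMap.ext fun z => ?_
      simp [form_comm z.1]
      ring
    exact L.hasStrictFDerivAt.prodMk (h1.prodMk hFs)
  have hinv := hΘs.eventually_left_inverse
  set ψ := hg.localInverse with hψ
  have hψr := hg.eventually_right_inverse
  have hψc : ContinuousAt (fun z => ψ (L z)) (X y) :=
    ContinuousAt.comp (g := ψ) hg.localInverse_continuousAt L.continuous.continuousAt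
  have hψy : ψ (L (X y)) = y := hg.eventually_left_inverse.self_of_nhds
  have hψt : Tendsto (fun z => ψ (L z)) (𝓝 (X y)) (𝓝 y) := by
    have := hψc.tendsto
    rwa [hψy] at this
  have hXψ : Tendsto (fun z => X (ψ (L z))) (𝓝 (X y)) (𝓝 (X y)) :=
    hXs.hasFDerivAt.continuousAt.tendsto.comp hψt
  filter_upwards [hinv, hXψ.eventually hinv, hψt.eventually (h.isOpen.mem_nhds hy),
    L.continuous.continuousAt.eventually hψr, hWo.mem_nhds hqW,
    hXψ.eventually (hWo.mem_nhds hqW)] with z h1 h2 h3 h4 h5 h6 hzP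
  refine ⟨ψ (L z), h3, ?_⟩
  -- Both points lie on `P`, so the last two coordinates agree; `ψ` was chosen to match the first.
  have : Θ (X (ψ (L z))) = Θ z := by
    simp only [hΘ]
    rw [hFP z ⟨hzP, h5⟩, hFP _ ⟨hXP h3, h6⟩, (hP.subset hzP).1.1, (h.mem _ h3).1.1]
    exact Prod.ext h4 rfl
  rw [← h2, this, h1]

/-- An immersed hypersurface that is contained in a properly embedded one is open in it. -/
theorem exists_isOpen_range_eq [IsManifold (𝓡 n) ∞ S] (hε : ε = 1 ∨ ε = -1)
    (hf : IsHypersurface ε f) {P : Set (Amb n)} (hP : IsProperlyEmbeddedHypersurface ε P)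
    (hfP : ∀ p, f p ∈ P) : ∃ O : Set (Amb n), IsOpen O ∧ range f = P ∩ O := by
  refine ⟨interior {z | z ∈ P → z ∈ range f}, isOpen_interior, ?_⟩
  refine Subset.antisymm ?_ fun z hz => interior_subset hz.2 hz.1
  rintro _ ⟨p, rfl⟩
  refine ⟨hfP p, ?_⟩
  rw [mem_interior_iff_mem_nhds]
  have hps := mem_chart_source (Coord n) p
  have hp := hf.isPatch (chart_mem_atlas (Coord n) p)
  have := hp.eventually_mem_image hε hP (fun y _ => hfP _) (mem_chart_target _ p)
  rw [Function.comp_apply, (chartAt (Coord n) p).left_inv hps] at this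
  filter_upwards [this] with z hz hzP
  obtain ⟨y, -, hy⟩ := hz hzP
  exact ⟨_, hy⟩

end Global

/-! ### The hypersurfaces `⟨x, v⟩ = ψ(t)` -/

section ProfileHypersurface

variable {n : ℕ} {ε K : ℝ} {v : Vec n} {A B : ℝ} {J : Set ℝ}

/-- The function `A genCos l + B genSin l`. -/
def profileFun (l A B t : ℝ) : ℝ := A * genCos l t + B * genSin l t

/-- The derivative of `profileFun l A B`. -/
def profileDeriv (l A B t : ℝ) : ℝ := A * (l * genSin l t) + B * genCos l t

/-- The hypersurface `⟨x, v⟩ = A genCos l t + B genSin l t`, `t ∈ J`. -/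
def profileHypersurface (ε l : ℝ) (v : Vec n) (A B : ℝ) (J : Set ℝ) : Set (Amb n) :=
  {q | q.1 ∈ spaceForm n ε ∧ form ε q.1 v = profileFun l A B q.2 ∧ q.2 ∈ J}

theorem hasDerivAt_profileFun (l A B t : ℝ) :
    HasDerivAt (profileFun l A B) (profileDeriv l A B t) t :=
  ((hasDerivAt_genCos l t).const_mul A).add ((hasDerivAt_genSin l t).const_mul B)

theorem hasDerivAt_profileDeriv (l A B t : ℝ) :
    HasDerivAt (profileDeriv l A B) (l * profileFun l A B t) t := by
  refine ((((hasDerivAt_genSin l t).const_mul l).const_mul A).add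
    ((hasDerivAt_genCos l t).const_mul B)).congr_deriv ?_
  unfold profileFun
  ring

/-- Conservation of energy for `ψ'' = l ψ`. -/
theorem profileDeriv_sq (l A B t : ℝ) :
    profileDeriv l A B t ^ 2 = l * profileFun l A B t ^ 2 - (l * A ^ 2 - B ^ 2) := by
  unfold profileDeriv profileFun
  linear_combination (B ^ 2 - l * A ^ 2) * genCos_sq_sub l t

theorem contDiff_profileFun (l A B : ℝ) : ContDiff ℝ ∞ (profileFun l A B) := by
  have h1 : ContDiff ℝ ∞ (genCos l) := by
    unfold genCos
    split_ifs
    · exact Real.contDiff_cosh.comp (contDiff_const.mul contDiff_id)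
    · exact contDiff_const
    · exact Real.contDiff_cos.comp (contDiff_const.mul contDiff_id)
  have h2 : ContDiff ℝ ∞ (genSin l) := by
    unfold genSin
    split_ifs
    · exact (Real.contDiff_sinh.comp (contDiff_const.mul contDiff_id)).div_const _
    · exact contDiff_id
    · exact (Real.contDiff_sin.comp (contDiff_const.mul contDiff_id)).div_const _
  exact (contDiff_const.mul h1).add (contDiff_const.mul h2)

theorem profileConst_sub (hε : ε = 1 ∨ ε = -1) (hKε : ε < K) :
    (profileConst ε K - ε) * (K - ε) = 1 := by
  have hε2 := sq_eq_one_of_sign hε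
  have hKε0 : K - ε ≠ 0 := by linarith
  unfold profileConst
  field_simp
  linear_combination hε2

/-- At a zero of `⟨x, v⟩` the energy identity gives `ψ'² = -⟨v, v⟩`, while `D = ⟨v, v⟩ ≥ 0`. So `⟨v,
v⟩ = 0 = D`, but at a point with `D = 0` one has `⟨v, v⟩ = ε`. -/
theorem profile_ne_zero (hε : ε = 1 ∨ ε = -1) (hv : IsAxis ε v)
    (hAB : profileConst ε K * A ^ 2 - B ^ 2 = form ε v v) {x : Vec n} {t : ℝ}
    (hx : x ∈ spaceForm n ε) (hxt : form ε x v = profileFun (profileConst ε K) A B t) :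
    form ε x v ≠ 0 := by
  intro h0
  have h1 := form_sub_nonneg hε hx v
  have h2 := profileDeriv_sq (profileConst ε K) A B t
  rw [← hxt, h0, hAB] at h2
  rw [h0] at h1
  have h3 := sq_nonneg (profileDeriv (profileConst ε K) A B t)
  have hm : form ε v v = 0 := by linarith
  have := (hv.form_of_form_sub_eq_zero hε hx (by rw [h0, hm]; ring)).1
  rcases hε with rfl | rfl <;> linarith

/-- The quantity `D + ψ'²` is the square of the normal `(v^⊤, -ψ')`. The energy identity and
`profileConst_sub` evaluate it as `c²/(K - ε)`, and `c` never vanishes. -/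
theorem normal_sq_pos (hε : ε = 1 ∨ ε = -1) (hv : IsAxis ε v) (hKε : ε < K)
    (hAB : profileConst ε K * A ^ 2 - B ^ 2 = form ε v v) {x : Vec n} {t : ℝ}
    (hx : x ∈ spaceForm n ε) (hxt : form ε x v = profileFun (profileConst ε K) A B t) :
    (K - ε) * ((form ε v v - ε * form ε x v ^ 2) + profileDeriv (profileConst ε K) A B t ^ 2)
      = form ε x v ^ 2 ∧
    0 < (form ε v v - ε * form ε x v ^ 2) + profileDeriv (profileConst ε K) A B t ^ 2 := by
  have h2 := profileDeriv_sq (profileConst ε K) A B t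
  have h3 := profileConst_sub hε hKε
  rw [← hxt, hAB] at h2
  have h4 : (K - ε) * ((form ε v v - ε * form ε x v ^ 2)
      + profileDeriv (profileConst ε K) A B t ^ 2) = form ε x v ^ 2 := by
    rw [h2]
    linear_combination form ε x v ^ 2 * h3
  refine ⟨h4, ?_⟩
  have h5 := sq_pos_of_ne_zero (profile_ne_zero hε hv hAB hx hxt)
  rw [← h4] at h5
  exact pos_of_mul_pos_right h5 (by linarith)

theorem isClosed_spaceForm (hε : ε = 1 ∨ ε = -1) : IsClosed (spaceForm n ε) := by
  have hcont : Continuous fun x : Vec n => form ε x x :=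
    ((formL n ε).continuous.clm_apply continuous_id)
  rcases hε with rfl | rfl
  · have : spaceForm n 1 = {x | form 1 x x = 1} := by
      ext x
      simp only [spaceForm, mem_ofPred_eq, and_iff_left_iff_imp]
      intro _ h
      norm_num at h
    rw [this]
    exact isClosed_eq hcont continuous_const
  · have : spaceForm n (-1) = {x | form (-1) x x = -1} ∩ {x | 0 ≤ x 0} := by
      ext x
      constructor
      · exact fun hx => ⟨hx.1, (hx.2 rfl).le⟩
      · rintro ⟨h1, h2⟩
        refine ⟨h1, fun _ => lt_of_le_of_ne h2 fun h0 => ?_⟩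
        simp only [mem_ofPred_eq, form, ← h0] at h1
        have : 0 ≤ ∑ i : Fin n, x i.succ * x i.succ :=
          Finset.sum_nonneg fun i _ => mul_self_nonneg _
        linarith
    rw [this]
    exact (isClosed_eq hcont continuous_const).inter
      (isClosed_le continuous_const (continuous_apply 0))

theorem isClosed_profileHypersurface_univ (hε : ε = 1 ∨ ε = -1) (l : ℝ) :
    IsClosed (profileHypersurface ε l v A B univ) := by
  have h1 : IsClosed {q : Amb n | q.1 ∈ spaceForm n ε} :=
    (isClosed_spaceForm hε).preimage continuous_fst
  have h2 : IsClosed {q : Amb n | form ε q.1 v = profileFun l A B q.2} :=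
    isClosed_eq (((formL n ε).continuous.comp continuous_fst).clm_apply continuous_const)
      ((contDiff_profileFun l A B).continuous.comp continuous_snd)
  convert h1.inter h2 using 1
  ext q
  simp [profileHypersurface]

/-- The normal `(v^⊤, -ψ')` is tangent to the product, and the differential of `⟨x, v⟩ - ψ(t)` takes
the value `|v^⊤|² + ψ'² > 0` on it. The open set `J` makes it possible to keep only one piece of the
level set. -/
theorem isProperlyEmbedded_profileHypersurface (hε : ε = 1 ∨ ε = -1) (hv : IsAxis ε v)
    (hKε : ε < K) (hAB : profileConst ε K * A ^ 2 - B ^ 2 = form ε v v) (hJ : IsOpen J)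
    (hclosed : IsClosed (profileHypersurface ε (profileConst ε K) v A B J)) :
    IsProperlyEmbeddedHypersurface ε (profileHypersurface ε (profileConst ε K) v A B J) := by
  refine ⟨fun q hq => ⟨hq.1, trivial⟩, hclosed, fun q hq => ?_⟩
  set l := profileConst ε K with hl
  have hF : ContDiff ℝ ∞ fun y : Amb n => form ε y.1 v - profileFun l A B y.2 :=
    (((formL n ε).contDiff.comp contDiff_fst).clm_apply contDiff_const).sub
      ((contDiff_profileFun l A B).comp contDiff_snd)
  refine ⟨Prod.snd ⁻¹' J, fun y => form ε y.1 v - profileFun l A B y.2,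
    hJ.preimage continuous_snd, hq.2.2, hF.contDiffOn, ?_,
    (tangentPart ε v q.1, -profileDeriv l A B q.2), form_tangentPart hε hq.1 v, ?_⟩
  · ext y
    constructor
    · exact fun hy => ⟨⟨⟨hy.1.1, trivial⟩, hy.2⟩, sub_eq_zero.2 hy.1.2.1⟩
    · exact fun hy => ⟨⟨hy.1.1.1, sub_eq_zero.1 hy.2, hy.1.2⟩, hy.1.2⟩
  · have h1 : HasFDerivAt (fun y : Amb n => formL n ε y.1 v)
        (((formL n ε).flip v).comp (ContinuousLinearMap.fst ℝ (Vec n) ℝ)) q :=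
      (((formL n ε).flip v).comp (ContinuousLinearMap.fst ℝ (Vec n) ℝ)).hasFDerivAt
    have h2 := (hasDerivAt_profileFun l A B q.2).comp_hasFDerivAt q
      (hasFDerivAt_snd (𝕜 := ℝ) (p := q))
    have h3 := (h1.sub h2).fderiv
    change fderiv ℝ ((fun y : Amb n => formL n ε y.1 v) - (profileFun l A B ∘ Prod.snd)) q _ ≠ 0
    rw [h3]
    have h4 : form ε (tangentPart ε v q.1) v = form ε v v - ε * form ε q.1 v ^ 2 := by
      rw [← form_tangentPart_self hε hq.1,
        form_tangentPart_of_tangent (form_tangentPart hε hq.1 v)]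
    have h5 := (normal_sq_pos hε hv hKε hAB hq.1 hq.2.1).2
    rw [← hl] at h5
    simp only [sub_apply, ContinuousLinearMap.comp_apply,
      ContinuousLinearMap.coe_fst', ContinuousLinearMap.flip_apply, formL_apply, h4,
      smul_apply, ContinuousLinearMap.coe_snd', smul_eq_mul]
    refine ne_of_gt ?_
    linarith

/-- As `ψ'' = l ψ`, the second fundamental form for `(v^⊤, -ψ')` is `c (l dt² + ε g)`, with `g` the
horizontal part of the metric. Since the normal has square `c²/(K - ε)`, the factor `c²` cancels,
and `(K - ε) l = εK` assembles the Gauss equation into `K` times the Gram determinant of `g + dt²`.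
-/
theorem profileHypersurface_hasCurvature (hε : ε = 1 ∨ ε = -1) (hv : IsAxis ε v)
    (hKε : ε < K) (hAB : profileConst ε K * A ^ 2 - B ^ 2 = form ε v v) :
    SubsetHasConstantSectionalCurvature ε
      (profileHypersurface ε (profileConst ε K) v A B J) K := by
  intro U X hU hX hXi hXP y hy u w hl
  have hε2 := sq_eq_one_of_sign hε
  set l := profileConst ε K with hldef
  have h : IsPatch ε U X := ⟨hU, hX, fun z hz => ⟨(hXP hz).1, trivial⟩, hXi⟩
  have hlK := profileConst_sub hε hKε
  rw [← hldef] at hlK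
  have hKε0 : K - ε ≠ 0 := by linarith
  have hxt : ∀ z ∈ U, axisFun ε v X z = profileFun l A B (heightFun X z) := fun z hz =>
    (hXP hz).2.1
  have dt : ∀ z ∈ U, DifferentiableAt ℝ (heightFun X) z := fun z hz =>
    differentiableAt_of_smooth hU h.smooth_heightFun hz
  have hc1 : ∀ z ∈ U, ∀ i, partialDeriv i (axisFun ε v X) z
      = profileDeriv l A B (heightFun X z) * partialDeriv i (heightFun X) z := by
    intro z hz i
    rw [partialDeriv_congr hU (fun a ha => hxt a ha) hz i]
    exact partialDeriv_comp (hasDerivAt_profileFun l A B _) (dt z hz) i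
  have hc2 : ∀ i j, partialDeriv i (partialDeriv j (axisFun ε v X)) y
      = l * axisFun ε v X y * (partialDeriv i (heightFun X) y * partialDeriv j (heightFun X) y)
        + profileDeriv l A B (heightFun X y) * partialDeriv i (partialDeriv j (heightFun X)) y := by
    intro i j
    have hD : DifferentiableAt ℝ (fun z => profileDeriv l A B (heightFun X z)) y :=
      (hasDerivAt_profileDeriv l A B (heightFun X y)).differentiableAt.comp y (dt y hy)
    rw [partialDeriv_congr hU (fun a ha => hc1 a ha j) hy i, partialDeriv_mul hD
      (differentiableAt_of_smooth hU (contDiffOn_partialDeriv hU h.smooth_heightFun j) hy),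
      partialDeriv_comp (hasDerivAt_profileDeriv l A B _) (dt y hy) i, hxt y hy]
    ring
  set c := axisFun ε v X y with hc
  set p := profileDeriv l A B (heightFun X y) with hp
  obtain ⟨hq1, hq2⟩ := normal_sq_pos hε hv hKε hAB (hXP hy).1 (hXP hy).2.1
  set N : Amb n := ((1 : ℝ) • tangentPart ε v (X y).1, -p) with hN
  have hNN : prodForm ε N N = axisDist ε v X y + p ^ 2 := by
    rw [hN, h.prodForm_normal hε hy]; ring
  have hNpos : 0 < prodForm ε N N := by rw [hNN]; exact hq2
  have hNc : (K - ε) * prodForm ε N N = c ^ 2 := by rw [hNN]; exact hq1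
  have hN0 : N ≠ 0 := by
    intro h0
    rw [h0] at hNpos
    simp [prodForm, form_zero_left] at hNpos
  have hNX : ∀ i, prodForm ε N (partialDeriv i X y) = 0 := by
    intro i
    rw [hN, h.prodForm_dirDeriv hy, hc1 y hy]
    ring
  have hsec : ∀ a b : Fin n → ℝ, secondDeriv (axisFun ε v X) a b y
      = l * c * ((dirDeriv X a y).2 * (dirDeriv X b y).2)
        + p * secondDeriv (heightFun X) a b y := by
    intro a b
    rw [← h.dirDeriv_heightFun hy, ← h.dirDeriv_heightFun hy]
    simp only [secondDeriv, dirDeriv, hc2, smul_eq_mul]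
    rw [Finset.sum_mul_sum]
    simp only [Finset.mul_sum, ← Finset.sum_add_distrib]
    exact Finset.sum_congr rfl fun i _ => Finset.sum_congr rfl fun j _ => by ring
  have hH : ∀ a b : Fin n → ℝ, prodForm ε (secondDeriv X a b y) N
      = c * (l * ((dirDeriv X a y).2 * (dirDeriv X b y).2)
        + ε * form ε (dirDeriv X a y).1 (dirDeriv X b y).1) := by
    intro a b
    rw [hN, h.prodForm_secondDeriv hy, hsec]
    ring
  rw [h.sectionalCurvature_eq_iff hε hy (h.form_normal hε hy 1) hNX hN0 hl, hH, hH, hH]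
  have hdiv : ∀ a b d : ℝ, ((c * a) * (c * b) - (c * d) ^ 2) / prodForm ε N N
      = (K - ε) * (a * b - d ^ 2) := by
    intro a b d
    rw [div_eq_iff hNpos.ne']
    linear_combination (-(a * b - d ^ 2)) * hNc
  have hlK2 : (K - ε) * l = ε * K := by rw [hldef, profileConst]; field_simp
  rw [hdiv]
  simp only [prodForm]
  set a := form ε (dirDeriv X u y).1 (dirDeriv X u y).1
  set b := form ε (dirDeriv X w y).1 (dirDeriv X w y).1
  set d := form ε (dirDeriv X u y).1 (dirDeriv X w y).1
  set s := (dirDeriv X u y).2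
  set r := (dirDeriv X w y).2
  linear_combination ε * (s ^ 2 * b + r ^ 2 * a - 2 * s * r * d) * hlK2
    + ((K - ε) * (a * b - d ^ 2) + K * (s ^ 2 * b + r ^ 2 * a - 2 * s * r * d)) * hε2

/-! ### Horizontal hyperplanes -/

theorem isProperlyEmbedded_horizontalHyperplane (hε : ε = 1 ∨ ε = -1) (h : ℝ) :
    IsProperlyEmbeddedHypersurface ε (horizontalHyperplane n ε h) := by
  refine ⟨prod_mono_right (subset_univ _), (isClosed_spaceForm hε).prod isClosed_singleton,
    fun q _ => ⟨univ, fun y => y.2 - h, isOpen_univ, trivial,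
      (contDiff_snd.sub contDiff_const).contDiffOn, ?_, (0, 1), form_zero_right _, ?_⟩⟩
  · ext y
    simp [horizontalHyperplane, productSpace, sub_eq_zero]
  · rw [fderiv_sub_const, fderiv_snd]
    simp

theorem horizontalHyperplane_hasCurvature (hε : ε = 1 ∨ ε = -1) (h₀ : ℝ) :
    SubsetHasConstantSectionalCurvature ε (horizontalHyperplane n ε h₀) ε := by
  intro U X hU hX hXi hXP y hy u w hl
  have h : IsPatch ε U X := ⟨hU, hX, fun z hz => ⟨(hXP hz).1, trivial⟩, hXi⟩
  have hconst : ∀ z ∈ U, heightFun X z = h₀ := fun z hz => (hXP hz).2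
  have ht1 : ∀ z ∈ U, ∀ i, partialDeriv i (heightFun X) z = 0 := by
    intro z hz i
    rw [partialDeriv_congr hU (Y := fun _ => h₀) (fun a ha => hconst a ha) hz]
    simp [partialDeriv]
  have ht2 : ∀ i j, partialDeriv i (partialDeriv j (heightFun X)) y = 0 := by
    intro i j
    rw [partialDeriv_congr hU (Y := fun _ => (0 : ℝ)) (fun a ha => ht1 a ha j) hy]
    simp [partialDeriv]
  have hd : ∀ a : Fin n → ℝ, (dirDeriv X a y).2 = 0 := by
    intro a
    rw [← h.dirDeriv_heightFun hy]
    simp [dirDeriv, ht1 y hy]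
  have hs : ∀ a b : Fin n → ℝ, prodForm ε (secondDeriv X a b y) (0, 1) = 0 := by
    intro a b
    have : secondDeriv (heightFun X) a b y = 0 := by simp [secondDeriv, ht2]
    rw [prodForm, ← h.secondDeriv_heightFun hy, this, form_zero_right]
    ring
  have hNX : ∀ i, prodForm ε ((0, 1) : Amb n) (partialDeriv i X y) = 0 := by
    intro i
    rw [prodForm, form_zero_left, ← h.partialDeriv_heightFun hy, ht1 y hy]
    ring
  rw [h.sectionalCurvature_eq_iff hε hy (N := ((0, 1) : Amb n)) (form_zero_right _) hNX
    (by simp) hl, hs, hs, hs]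
  simp [prodForm, hd]

end ProfileHypersurface

/-! ### Graphs over parallel hypersurfaces as level sets -/

section Graphs

variable {n : ℕ} {ε : ℝ}

theorem cosE_sinE (hε : ε = 1 ∨ ε = -1) (s : ℝ) : cosE ε s ^ 2 + ε * sinE ε s ^ 2 = 1 := by
  rcases hε with rfl | rfl
  · simp [cosE, sinE]
  · have h : (-1 : ℝ) ≠ 1 := by norm_num
    simp only [cosE, sinE, h, if_false, Real.cosh_sq]
    ring

theorem cosE_neg_one (s : ℝ) : cosE (-1) s = Real.cosh s := if_neg (by norm_num)

theorem sinE_neg_one (s : ℝ) : sinE (-1) s = Real.sinh s := if_neg (by norm_num)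

theorem cosE_one (s : ℝ) : cosE 1 s = Real.cos s := if_pos rfl

theorem sinE_one (s : ℝ) : sinE 1 s = Real.sin s := if_pos rfl

theorem geodesic_mem (hε : ε = 1 ∨ ε = -1) {x η : Vec n} (hx : x ∈ spaceForm n ε)
    (hη : form ε x η = 0) (hηη : form ε η η = 1) (s : ℝ) : geodesic ε x η s ∈ spaceForm n ε := by
  have h1 : form ε (geodesic ε x η s) (geodesic ε x η s) = ε := by
    have hε2 := sq_eq_one_of_sign hε
    have := cosE_sinE hε s
    simp only [geodesic, form_add_left, form_add_right, form_smul_left, form_smul_right, hx.1,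
      form_comm η x, hη, hηη]
    linear_combination ε * this - sinE ε s ^ 2 * hε2
  rcases hε with rfl | rfl
  · exact ⟨h1, fun h => by norm_num at h⟩
  · refine mem_spaceForm_of_form_neg hx h1 ?_
    simp only [geodesic, form_add_right, form_smul_right, hx.1, hη, cosE_neg_one]
    have := Real.cosh_pos s
    linarith

theorem exists_unit_normal (hn : 1 ≤ n) (hε : ε = 1 ∨ ε = -1) {o : Vec n}
    (ho : o ∈ spaceForm n ε) : ∃ η : Vec n, form ε o η = 0 ∧ form ε η η = 1 := by
  have hdim : 0 < Module.finrank ℝ (LinearMap.ker (formL n ε o : Vec n →ₗ[ℝ] ℝ)) := by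
    have h1 := (formL n ε o : Vec n →ₗ[ℝ] ℝ).finrank_range_add_finrank_ker
    have h2 : Module.finrank ℝ (LinearMap.range (formL n ε o : Vec n →ₗ[ℝ] ℝ)) ≤ 1 := by
      simpa using Submodule.finrank_le (LinearMap.range (formL n ε o : Vec n →ₗ[ℝ] ℝ))
    have h3 : Module.finrank ℝ (Vec n) = n + 1 := by simp
    omega
  obtain ⟨w, hw⟩ := Module.finrank_pos_iff_exists_ne_zero.1 hdim
  have hw1 : form ε o w = 0 := w.2
  have hpos : 0 < form ε (w : Vec n) w :=
    lt_of_le_of_ne (form_self_nonneg hε ho hw1) fun h0 =>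
      hw (Subtype.ext (eq_zero_of_form_self hε ho hw1 h0.symm))
  refine ⟨(1 / √(form ε (w : Vec n) w)) • (w : Vec n), ?_, ?_⟩
  · rw [form_smul_right, hw1, mul_zero]
  · rw [form_smul_left, form_smul_right]
    have h1 := Real.mul_self_sqrt hpos.le
    have h2 := (Real.sqrt_pos.2 hpos).ne'
    field_simp
    linarith

/-- Geodesic spheres are level sets of `⟨x, o⟩`. The direction of the geodesic from `o` to a given
point is recovered on dividing by `sinE ε s`; at `s = 0` the point is `o` and any unit direction
serves. -/
theorem mem_parallelGraph_sphereData (hn : 1 ≤ n) (hε : ε = 1 ∨ ε = -1) {o : Vec n}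
    (ho : o ∈ spaceForm n ε) {φ : ℝ → ℝ} {I : Set ℝ} (hI : ∀ s ∈ I, s = 0 ∨ sinE ε s ≠ 0)
    (q : Amb n) : q ∈ parallelGraph ε (sphereData ε o) φ I ↔
      q.1 ∈ spaceForm n ε ∧ ∃ s ∈ I, form ε q.1 o = ε * cosE ε s ∧ q.2 = φ s := by
  have hε2 := sq_eq_one_of_sign hε
  constructor
  · rintro ⟨⟨_, η⟩, ⟨rfl, h1, h2⟩, s, hs, rfl⟩
    refine ⟨geodesic_mem hε ho h1 h2 s, s, hs, ?_, rfl⟩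
    simp only [geodesic, form_add_left, form_smul_left, ho.1, form_comm η, h1]
    ring
  · rintro ⟨hq, s, hs, hqo, hqs⟩
    rcases hI s hs with rfl | hsin
    · obtain ⟨η, h1, h2⟩ := exists_unit_normal hn hε ho
      refine ⟨(o, η), ⟨rfl, h1, h2⟩, 0, hs, Prod.ext ?_ hqs⟩
      have hc : cosE ε 0 = 1 := by simp [cosE]
      have hs0 : sinE ε 0 = 0 := by simp [sinE]
      have h3 : o = (ε * form ε q.1 o) • q.1 := by
        refine eq_smul_of_form_sub_eq_zero hε hq ?_
        rw [hqo, hc, ho.1]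
        linear_combination -ε * hε2
      rw [hqo, hc, mul_one, hε2, one_smul] at h3
      simp [geodesic, hc, hs0, h3]
    · refine ⟨(o, (1 / sinE ε s) • (q.1 - cosE ε s • o)), ⟨rfl, ?_, ?_⟩, s, hs, Prod.ext ?_ hqs⟩
      · simp only [form_smul_right, form_sub_right, form_comm o q.1, hqo, ho.1]
        ring
      · simp only [form_smul_right, form_smul_left, form_sub_right, form_sub_left, form_comm o q.1,
          hqo, ho.1, hq.1]
        have := cosE_sinE hε s
        field_simp
        linear_combination (-ε) * this + sinE ε s ^ 2 * hε2
      · simp only [geodesic, smul_smul]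
        rw [mul_one_div_cancel hsin, one_smul]
        abel

theorem mem_parallelGraph_horosphereData {v : Vec n} (hv : form (-1) v v = 0) {φ : ℝ → ℝ}
    {I : Set ℝ} (q : Amb n) : q ∈ parallelGraph (-1) (horosphereData v) φ I ↔
      q.1 ∈ spaceForm n (-1) ∧ ∃ s ∈ I, form (-1) q.1 v = -Real.exp (-s) ∧ q.2 = φ s := by
  constructor
  · rintro ⟨⟨b, η⟩, ⟨hb, hbv, h1⟩, s, hs, rfl⟩
    simp only at hb hbv h1
    subst h1
    refine ⟨geodesic_mem (.inr rfl) hb ?_ ?_ s, s, hs, ?_, rfl⟩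
    · rw [form_sub_right, hbv, hb.1]; ring
    · simp only [form_sub_right, form_sub_left, form_comm v b, hbv, hb.1, hv]; ring
    · simp only [geodesic, form_add_left, form_smul_left, form_sub_left, hbv, hv, cosE_neg_one,
        sinE_neg_one, ← Real.cosh_sub_sinh]
      ring
  · rintro ⟨hq, s, hs, hqv, hqs⟩
    have e1 : Real.cosh s = (Real.exp s + Real.exp (-s)) / 2 := Real.cosh_eq s
    have e2 : Real.sinh s = (Real.exp s - Real.exp (-s)) / 2 := Real.sinh_eq s
    have e3 : Real.exp s * Real.exp (-s) = 1 := by rw [← Real.exp_add]; simp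
    have hp := Real.exp_pos s
    -- Since `cosh s • b + sinh s • (v - b) = exp (-s) • b + sinh s • v`, this is the only possible
    -- base point.
    set b : Vec n := Real.exp s • (q.1 - Real.sinh s • v) with hb
    have hbv : form (-1) b v = -1 := by
      rw [hb, form_smul_left, form_sub_left, form_smul_left, hqv, hv]
      linear_combination -e3
    have hbb : form (-1) b b = -1 := by
      simp only [hb, form_smul_left, form_sub_left, form_smul_right, form_sub_right,
        form_comm v q.1, hqv, hv, hq.1, e2]
      linear_combination (-(Real.exp s * Real.exp (-s)) - 1 + Real.exp s ^ 2) * e3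
    have hqb : form (-1) q.1 b < 0 := by
      simp only [hb, form_smul_right, form_sub_right, hqv, hq.1, e2]
      nlinarith [Real.exp_pos (-s), mul_pos hp hp]
    refine ⟨(b, v - b), ⟨mem_spaceForm_of_form_neg hq hbb hqb, hbv, rfl⟩, s, hs, Prod.ext ?_ hqs⟩
    simp only [geodesic, cosE_neg_one, sinE_neg_one]
    have h4 : q.1 = Real.exp (-s) • b + Real.sinh s • v := by
      rw [hb, smul_smul, mul_comm, e3, one_smul]; abel
    conv_lhs => rw [h4, ← Real.cosh_sub_sinh]
    rw [sub_smul, smul_sub]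
    abel

theorem mem_parallelGraph_hyperplaneData {v : Vec n} (hv : form (-1) v v = 1) {φ : ℝ → ℝ}
    {I : Set ℝ} (q : Amb n) : q ∈ parallelGraph (-1) (hyperplaneData v) φ I ↔
      q.1 ∈ spaceForm n (-1) ∧ ∃ s ∈ I, form (-1) q.1 v = Real.sinh s ∧ q.2 = φ s := by
  constructor
  · rintro ⟨⟨b, η⟩, ⟨hb, hbv, h1⟩, s, hs, rfl⟩
    simp only at hb hbv h1
    subst h1
    refine ⟨geodesic_mem (.inr rfl) hb hbv hv s, s, hs, ?_, rfl⟩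
    simp only [geodesic, form_add_left, form_smul_left, hbv, hv, sinE_neg_one]
    ring
  · rintro ⟨hq, s, hs, hqv, hqs⟩
    have hc := Real.cosh_pos s
    have hc2 := Real.cosh_sq s
    -- Solves `q.1 = cosh s • b + sinh s • v`.
    set b : Vec n := (1 / Real.cosh s) • (q.1 - Real.sinh s • v) with hb
    have hbv : form (-1) b v = 0 := by
      rw [hb, form_smul_left, form_sub_left, form_smul_left, hqv, hv]; ring
    have hbb : form (-1) b b = -1 := by
      simp only [hb, form_smul_left, form_sub_left, form_smul_right, form_sub_right,
        form_comm v q.1, hqv, hv, hq.1]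
      field_simp
      linear_combination hc2
    have hqb : form (-1) q.1 b < 0 := by
      simp only [hb, form_smul_right, form_sub_right, hqv, hq.1]
      refine mul_neg_of_pos_of_neg (by positivity) ?_
      nlinarith [sq_nonneg (Real.sinh s)]
    refine ⟨(b, v), ⟨mem_spaceForm_of_form_neg hq hbb hqb, hbv, rfl⟩, s, hs, Prod.ext ?_ hqs⟩
    simp only [geodesic, cosE_neg_one, sinE_neg_one, hb, smul_smul]
    rw [mul_one_div_cancel hc.ne', one_smul]
    abel

/-- The integrand may blow up at an end point where `ρ = 1`, so derivatives are required only in the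
interior. Its sign and the continuity of `Φ` up to the end points give integrability. -/
theorem heightOf_eq {ρ Φ : ℝ → ℝ} {s₀ s : ℝ} (hs : s₀ ≤ s) (hc : ContinuousOn Φ (Icc s₀ s))
    (hd : ∀ u ∈ Ioo s₀ s, HasDerivAt Φ (ρ u / √(1 - ρ u ^ 2)) u) (hρ : ∀ u ∈ Ioo s₀ s, 0 ≤ ρ u) :
    heightOf ρ s₀ s = Φ s - Φ s₀ := by
  refine intervalIntegral.integral_eq_sub_of_hasDerivAt_of_le hs hc hd ?_
  refine intervalIntegral.intervalIntegrable_deriv_of_nonneg (by rwa [uIcc_of_le hs]) ?_ ?_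
  · rwa [min_eq_left hs, max_eq_right hs]
  · rw [min_eq_left hs, max_eq_right hs]
    exact fun u hu => div_nonneg (hρ u hu) (Real.sqrt_nonneg _)

theorem ratio_div_sqrt (r a : ℝ) {b : ℝ} (hb : 0 < b) :
    r * (a / b) / √(1 - (r * (a / b)) ^ 2) = r * a / √(b ^ 2 - (r * a) ^ 2) := by
  have h1 : 1 - (r * (a / b)) ^ 2 = (b ^ 2 - (r * a) ^ 2) / b ^ 2 := by field_simp
  rw [h1, Real.sqrt_div' _ (sq_nonneg b), Real.sqrt_sq hb.le, ← mul_div_assoc,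
    div_div_div_cancel_right₀ hb.ne']

theorem mem_verticalMotion_image {σ b : ℝ} (hσ : σ = 1 ∨ σ = -1) (R : Set (Amb n)) (q : Amb n) :
    q ∈ verticalMotion σ b '' R ↔ (q.1, σ * (q.2 - b)) ∈ R := by
  have hσ2 : σ * σ = 1 := by rcases hσ with rfl | rfl <;> norm_num
  constructor
  · rintro ⟨p, hp, rfl⟩
    have : σ * (σ * p.2 + b - b) = p.2 := by linear_combination p.2 * hσ2
    simp only [verticalMotion, this]
    exact hp
  · intro h
    refine ⟨_, h, Prod.ext rfl ?_⟩
    simp only [verticalMotion]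
    linear_combination (q.2 - b) * hσ2

end Graphs

/-! ### The models as level sets -/

section Models

variable {n : ℕ} {ε K : ℝ}

theorem continuous_geodesic (ε : ℝ) (x η : Vec n) : Continuous (geodesic ε x η) := by
  have h1 : Continuous (cosE ε) := by
    unfold cosE; split_ifs
    · exact Real.continuous_cos
    · exact Real.continuous_cosh
  have h2 : Continuous (sinE ε) := by
    unfold sinE; split_ifs
    · exact Real.continuous_sin
    · exact Real.continuous_sinh
  exact (h1.smul continuous_const).add (h2.smul continuous_const)

/-- `Φ` is an explicit height function and `G` an even profile in the height relative to the equator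
`Φ δ`. The level set is closed and invariant under the reflection, hence contains both closures.
Conversely its lower half is the graph over `[0, δ]`, which is in the closure of the graph over `[0,
δ)`, and its upper half is the mirror image. -/
theorem rotationalHypersurface_eq_of_pos (hn : 1 ≤ n) (hε : ε = 1 ∨ ε = -1) {o : Vec n}
    (ho : o ∈ spaceForm n ε) (hK : 0 < K) {δ : ℝ} (hδ : rotationalRadius ε K = δ) (hδ0 : 0 < δ)
    (hsin : ∀ s ∈ Ioc 0 δ, sinE ε s ≠ 0) {Φ G : ℝ → ℝ} {J : Set ℝ}
    (hΦ : ∀ s ∈ Icc 0 δ, heightOf (rotationalRho ε K) 0 s = Φ s) (hΦc : ContinuousOn Φ (Icc 0 δ))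
    (hG : ∀ τ, G (-τ) = G τ) (hJ : ∀ τ ∈ J, -τ ∈ J)
    (ha : ∀ s ∈ Icc 0 δ, cosE ε s = G (Φ s - Φ δ) ∧ Φ s - Φ δ ∈ J)
    (hb : ∀ τ ∈ J, τ ≤ 0 → ∀ x ∈ spaceForm n ε, form ε x o = ε * G τ →
      ∃ s ∈ Icc 0 δ, cosE ε s = G τ ∧ Φ s - Φ δ = τ)
    (hclosed : IsClosed {q : Amb n | q.1 ∈ spaceForm n ε ∧ form ε q.1 o = ε * G (q.2 - Φ δ) ∧
      q.2 - Φ δ ∈ J}) :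
    rotationalHypersurface ε o K = {q : Amb n | q.1 ∈ spaceForm n ε ∧
      form ε q.1 o = ε * G (q.2 - Φ δ) ∧ q.2 - Φ δ ∈ J} := by
  have hδm : δ ∈ Icc 0 δ := right_mem_Icc.2 hδ0.le
  simp only [rotationalHypersurface, hK, if_true, hδ, hΦ δ hδm]
  set φ := heightOf (rotationalRho ε K) 0 with hφ
  set M : Set (Amb n) := {q : Amb n | q.1 ∈ spaceForm n ε ∧
      form ε q.1 o = ε * G (q.2 - Φ δ) ∧ q.2 - Φ δ ∈ J} with hM
  set Γ := parallelGraph ε (sphereData ε o) φ (Ico 0 δ) with hΓ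
  have hI : ∀ s ∈ Icc 0 δ, s = 0 ∨ sinE ε s ≠ 0 := by
    intro s hs
    rcases eq_or_lt_of_le hs.1 with h0 | h0
    · exact .inl h0.symm
    · exact .inr (hsin s ⟨h0, hs.2⟩)
  have hI' : ∀ s ∈ Ico 0 δ, s = 0 ∨ sinE ε s ≠ 0 := fun s hs => hI s (Ico_subset_Icc_self hs)
  have hΓM : Γ ⊆ M := by
    intro q hq
    obtain ⟨h1, s, hs, h2, h3⟩ := (mem_parallelGraph_sphereData hn hε ho hI' q).1 hq
    have hs' := Ico_subset_Icc_self hs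
    rw [hΦ s hs'] at h3
    refine ⟨h1, ?_, ?_⟩
    · rw [h3, ← (ha s hs').1, h2]
    · rw [h3]; exact (ha s hs').2
  have hreflM : ∀ q ∈ M, reflection (Φ δ) q ∈ M := by
    rintro q ⟨h1, h2, h3⟩
    have : 2 * Φ δ - q.2 - Φ δ = -(q.2 - Φ δ) := by ring
    refine ⟨h1, ?_, ?_⟩
    · simp only [reflection, this, hG]; exact h2
    · simp only [reflection, this]; exact hJ _ h3
  have hlow : ∀ q ∈ M, q.2 - Φ δ ≤ 0 → q ∈ closure Γ := by
    rintro q ⟨h1, h2, h3⟩ h4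
    obtain ⟨s, hs, hs1, hs2⟩ := hb _ h3 h4 q.1 h1 h2
    have hmem : q ∈ parallelGraph ε (sphereData ε o) φ (Icc 0 δ) := by
      refine (mem_parallelGraph_sphereData hn hε ho hI q).2 ⟨h1, s, hs, by rw [h2, hs1], ?_⟩
      rw [hΦ s hs]; linarith
    obtain ⟨b, hbd, s', hs', rfl⟩ := hmem
    rw [hΦ s' hs']
    have hcont : ContinuousOn (fun u => ((geodesic ε b.1 b.2 u, Φ u) : Amb n)) (Icc 0 δ) :=
      (continuous_geodesic ε b.1 b.2).continuousOn.prodMk hΦc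
    refine ((hcont s' hs').mono Ico_subset_Icc_self).mem_closure (t := Γ) ?_ ?_
    · rwa [closure_Ico hδ0.ne]
    · intro u hu
      exact ⟨b, hbd, u, hu, by rw [hΦ u (Ico_subset_Icc_self hu)]⟩
  have hrr : ∀ q : Amb n, reflection (Φ δ) (reflection (Φ δ) q) = q := by
    intro q
    refine Prod.ext rfl ?_
    simp only [reflection]; ring
  refine Subset.antisymm (union_subset (closure_minimal hΓM hclosed)
    (closure_minimal ?_ hclosed)) fun q hq => ?_
  · rintro _ ⟨q, hq, rfl⟩
    exact hreflM q (hΓM hq)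
  · rcases le_total (q.2 - Φ δ) 0 with h | h
    · exact .inl (hlow q hq h)
    · right
      have h1 : reflection (Φ δ) q ∈ closure Γ := by
        refine hlow _ (hreflM q hq) ?_
        simp only [reflection]; linarith
      have hcont : Continuous (reflection (n := n) (Φ δ)) :=
        continuous_fst.prodMk (continuous_const.sub continuous_snd)
      rw [← hrr q]
      exact image_closure_subset_closure_image hcont ⟨_, h1, rfl⟩

theorem rotationalHypersurface_eq_of_nonpos (hn : 1 ≤ n) {o : Vec n}
    (ho : o ∈ spaceForm n (-1)) (hK : K ≤ 0) {Φ G : ℝ → ℝ}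
    (hΦ : ∀ s, 0 ≤ s → heightOf (rotationalRho (-1) K) 0 s = Φ s)
    (ha : ∀ s, 0 ≤ s → Real.cosh s = G (Φ s))
    (hb : ∀ t, 1 ≤ G t → ∃ s, 0 ≤ s ∧ Real.cosh s = G t ∧ Φ s = t) :
    rotationalHypersurface (-1) o K = {q : Amb n | q.1 ∈ spaceForm n (-1) ∧
      form (-1) q.1 o = -G q.2} := by
  simp only [rotationalHypersurface, not_lt.2 hK, if_false]
  have hI : ∀ s ∈ Ici (0 : ℝ), s = 0 ∨ sinE (-1) s ≠ 0 := by
    intro s hs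
    rcases eq_or_lt_of_le (mem_Ici.1 hs) with h0 | h0
    · exact .inl h0.symm
    · right; rw [sinE_neg_one]; exact (Real.sinh_pos_iff.2 h0).ne'
  ext q
  rw [mem_parallelGraph_sphereData hn (.inr rfl) ho hI]
  refine and_congr_right fun hq => ?_
  constructor
  · rintro ⟨s, hs, h1, h2⟩
    rw [h2, hΦ s hs, ← ha s hs, h1, cosE_neg_one]; ring
  · intro h
    have h1 : 1 ≤ G q.2 := by
      have h2 := form_sub_nonneg (.inr rfl) hq o
      rw [ho.1, h] at h2
      have h3 := form_neg_of_causal hq (y := o) (by rw [ho.1]; norm_num) (ho.2 rfl)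
      rw [h] at h3
      nlinarith
    obtain ⟨s, hs, hs1, hs2⟩ := hb _ h1
    exact ⟨s, hs, by rw [h, cosE_neg_one, hs1]; ring, by rw [hΦ s hs, hs2]⟩

theorem sqrt_div_sq {D r : ℝ} (hr : 0 < r) : √(D / r ^ 2) = √D / r := by
  rw [Real.sqrt_div' _ (sq_nonneg r), Real.sqrt_sq hr.le]

/-- Here `k² = K/(K - 1)` and `cos δ = 1/k`, and the height integral has the antiderivative `-(1/k)
arcosh (k cos s)`, which vanishes at the equator. -/
theorem rotationalHypersurface_one (hn : 1 ≤ n) {o : Vec n} (ho : o ∈ spaceForm n 1) (hK : 1 < K)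
    {k : ℝ} (hk : 0 < k) (hk2 : k ^ 2 * (K - 1) = K) : ∃ b : ℝ,
    rotationalHypersurface 1 o K = {q : Amb n | q.1 ∈ spaceForm n 1 ∧
      form 1 q.1 o = 1 / k * Real.cosh (k * (q.2 - b))} := by
  set r := √(K - 1) with hr
  have hr0 : 0 < r := Real.sqrt_pos.2 (by linarith)
  have hr2 : r ^ 2 = K - 1 := Real.sq_sqrt (by linarith)
  set δ := rotationalRadius 1 K with hδ
  have hδe : δ = Real.arctan (1 / r) := if_pos rfl
  have hδ0 : 0 < δ := by rw [hδe]; exact Real.arctan_pos.2 (by positivity)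
  have hδ1 : δ < Real.pi / 2 := by rw [hδe]; exact Real.arctan_lt_pi_div_two _
  have hcδ : Real.cos δ = 1 / k := by
    rw [hδe, Real.cos_arctan]
    have : 1 + (1 / r) ^ 2 = k ^ 2 := by
      field_simp
      rw [hr2]; linarith
    rw [this, Real.sqrt_sq hk.le]
  have hcos : ∀ s ∈ Icc 0 δ, 1 ≤ k * Real.cos s := by
    intro s hs
    have := Real.cos_le_cos_of_nonneg_of_le_pi hs.1 (by linarith [Real.pi_pos]) hs.2
    rw [hcδ, div_le_iff₀ hk] at this
    linarith
  have hcos' : ∀ s ∈ Ioo 0 δ, 1 < k * Real.cos s := by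
    intro s hs
    have := Real.cos_lt_cos_of_nonneg_of_le_pi hs.1.le (by linarith [Real.pi_pos]) hs.2
    rw [hcδ, div_lt_iff₀ hk] at this
    linarith
  set Φ₀ : ℝ → ℝ := fun s => -(1 / k) * Real.arcosh (k * Real.cos s) with hΦ₀
  have hΦc : ContinuousOn Φ₀ (Icc 0 δ) :=
    continuousOn_const.mul (Real.continuousOn_arcosh.comp
      (continuous_const.mul Real.continuous_cos).continuousOn fun s hs => hcos s hs)
  have hderiv : ∀ u ∈ Ioo 0 δ,
      HasDerivAt Φ₀ (rotationalRho 1 K u / √(1 - rotationalRho 1 K u ^ 2)) u := by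
    intro u hu
    have hcu : 0 < Real.cos u := Real.cos_pos_of_mem_Ioo
      ⟨by linarith [hu.1, Real.pi_pos], by linarith [hu.2]⟩
    have hρ : rotationalRho 1 K u = r * (Real.sin u / Real.cos u) := by
      simp [rotationalRho, tanE, Real.tan_eq_sin_div_cos, hr]
    rw [hρ, ratio_div_sqrt _ _ hcu]
    refine (((Real.hasDerivAt_arcosh (hcos' u hu)).comp u
      ((Real.hasDerivAt_cos u).const_mul k)).const_mul (-(1 / k))).congr_deriv ?_
    have : (k * Real.cos u) ^ 2 - 1 = (Real.cos u ^ 2 - (r * Real.sin u) ^ 2) / r ^ 2 := by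
      have h1 := Real.sin_sq_add_cos_sq u
      field_simp
      rw [hr2]
      linear_combination Real.cos u ^ 2 * hk2 + (K - 1) * h1
    rw [this, sqrt_div_sq hr0]
    field_simp
  have hheight : ∀ s ∈ Icc 0 δ, heightOf (rotationalRho 1 K) 0 s = Φ₀ s - Φ₀ 0 := by
    intro s hs
    refine heightOf_eq hs.1 (hΦc.mono (Icc_subset_Icc_right hs.2))
      (fun u hu => hderiv u ⟨hu.1, hu.2.trans_le hs.2⟩) fun u hu => ?_
    have : 0 ≤ Real.tan u := Real.tan_nonneg_of_nonneg_of_le_pi_div_two hu.1.le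
      (by linarith [hu.2, hs.2])
    simp only [rotationalRho, tanE, if_true]
    positivity
  have hΦδ : Φ₀ δ = 0 := by simp [hΦ₀, hcδ, hk.ne']
  refine ⟨Φ₀ δ - Φ₀ 0, ?_⟩
  have hcl : IsClosed {q : Amb n | q.1 ∈ spaceForm n 1 ∧
      form 1 q.1 o = 1 * (1 / k * Real.cosh (k * (q.2 - (Φ₀ δ - Φ₀ 0)))) ∧
      q.2 - (Φ₀ δ - Φ₀ 0) ∈ univ} := by
    have h1 : IsClosed {q : Amb n | q.1 ∈ spaceForm n 1} :=
      (isClosed_spaceForm (.inl rfl)).preimage continuous_fst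
    have h2 : IsClosed {q : Amb n |
        form 1 q.1 o = 1 * (1 / k * Real.cosh (k * (q.2 - (Φ₀ δ - Φ₀ 0))))} :=
      isClosed_eq (((formL n 1).continuous.comp continuous_fst).clm_apply continuous_const)
        (by fun_prop)
    convert h1.inter h2 using 1
    ext q
    simp
  rw [rotationalHypersurface_eq_of_pos hn (.inl rfl) ho (by linarith) (δ := δ) hδ.symm hδ0
    (Φ := fun s => Φ₀ s - Φ₀ 0) (G := fun τ => 1 / k * Real.cosh (k * τ)) (J := univ)
    ?_ hheight (hΦc.sub continuousOn_const) (fun τ => by simp) (fun _ _ => trivial) ?_ ?_ hcl]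
  · ext q; simp
  · intro s hs
    rw [sinE_one]
    exact (Real.sin_pos_of_pos_of_lt_pi hs.1 (by linarith [hs.2, Real.pi_pos])).ne'
  · intro s hs
    refine ⟨?_, trivial⟩
    have : k * (Φ₀ s - Φ₀ 0 - (Φ₀ δ - Φ₀ 0)) = -Real.arcosh (k * Real.cos s) := by
      rw [hΦδ]; simp only [hΦ₀]; field_simp; ring
    rw [this, Real.cosh_neg, Real.cosh_arcosh (hcos s hs), cosE_one]
    field_simp
  · intro τ _ hτ x hx hxo
    have h1 : 1 / k ≤ 1 / k * Real.cosh (k * τ) := le_mul_of_one_le_right (by positivity)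
      (Real.one_le_cosh _)
    have hk1 : 0 < 1 / k := by positivity
    have h2 : 1 / k * Real.cosh (k * τ) ≤ 1 := by
      have := form_sub_nonneg (.inl rfl) hx o
      rw [ho.1, hxo] at this
      nlinarith
    have hcs : Real.cos (Real.arccos (1 / k * Real.cosh (k * τ))) = 1 / k * Real.cosh (k * τ) :=
      Real.cos_arccos (by linarith) h2
    refine ⟨Real.arccos (1 / k * Real.cosh (k * τ)), ⟨Real.arccos_nonneg _, ?_⟩, ?_, ?_⟩
    · rw [← Real.arccos_cos hδ0.le (by linarith [Real.pi_pos] : δ ≤ Real.pi), hcδ]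
      exact Real.arccos_le_arccos h1
    · rw [cosE_one, hcs]
    · have : Φ₀ (Real.arccos (1 / k * Real.cosh (k * τ))) = τ := by
        simp only [hΦ₀]
        rw [hcs, ← mul_assoc, mul_one_div_cancel hk.ne', one_mul, ← Real.cosh_neg,
          Real.arcosh_cosh (by nlinarith)]
        field_simp
      rw [this, hΦδ]; ring

/-- Here `k² = K/(K + 1)` and `cosh δ = 1/k`, with antiderivative `(1/k) arcsin (k cosh s)`.
Measured from the equator the profile is a cosine, and the bound on `k (t - b)` keeps the sphere
apart from its copies in the other periods. -/
theorem rotationalHypersurface_neg_one_of_pos (hn : 1 ≤ n) {o : Vec n}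
    (ho : o ∈ spaceForm n (-1)) (hK : 0 < K) {k : ℝ} (hk : 0 < k) (hk2 : k ^ 2 * (K + 1) = K)
    (hcl : ∀ b : ℝ, IsClosed {q : Amb n | q.1 ∈ spaceForm n (-1) ∧
      form (-1) q.1 o = -(1 / k * Real.cos (k * (q.2 - b))) ∧
      k * (q.2 - b) ∈ Ioo (-(Real.pi / 2)) (Real.pi / 2)}) : ∃ b : ℝ,
    rotationalHypersurface (-1) o K = {q : Amb n | q.1 ∈ spaceForm n (-1) ∧
      form (-1) q.1 o = -(1 / k * Real.cos (k * (q.2 - b))) ∧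
      k * (q.2 - b) ∈ Ioo (-(Real.pi / 2)) (Real.pi / 2)} := by
  have hne : (-1 : ℝ) ≠ 1 := by norm_num
  have hpi := Real.pi_pos
  set r := √(K + 1) with hr
  have hr0 : 0 < r := Real.sqrt_pos.2 (by linarith)
  have hr2 : r ^ 2 = K + 1 := Real.sq_sqrt (by linarith)
  have hrK : √(K - -1) = r := by rw [hr]; ring_nf
  have hr1 : 1 < r := by nlinarith
  set δ := rotationalRadius (-1) K with hδ
  have hδe : δ = Real.artanh (1 / r) := by
    rw [hδ, rotationalRadius, arctanE, if_neg hne, hrK]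
  have h1r : 1 / r ∈ Ioo (0 : ℝ) 1 := ⟨by positivity, by rw [div_lt_one hr0]; exact hr1⟩
  have hδ0 : 0 < δ := by rw [hδe]; exact Real.artanh_pos h1r
  have hcδ : Real.cosh δ = 1 / k := by
    rw [hδe, Real.cosh_artanh ⟨by linarith [h1r.1], h1r.2⟩]
    have : 1 - (1 / r) ^ 2 = k ^ 2 := by
      field_simp
      rw [hr2]; linarith
    rw [this, Real.sqrt_sq hk.le]
  have hcosh : ∀ s ∈ Icc 0 δ, k * Real.cosh s ≤ 1 := by
    intro s hs
    have : Real.cosh s ≤ Real.cosh δ := by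
      rw [Real.cosh_le_cosh, abs_of_nonneg hs.1, abs_of_nonneg hδ0.le]; exact hs.2
    rw [hcδ, le_div_iff₀ hk] at this
    linarith
  have hcosh' : ∀ s ∈ Ioo 0 δ, k * Real.cosh s < 1 := by
    intro s hs
    have : Real.cosh s < Real.cosh δ := by
      rw [Real.cosh_lt_cosh, abs_of_nonneg hs.1.le, abs_of_nonneg hδ0.le]; exact hs.2
    rw [hcδ, lt_div_iff₀ hk] at this
    linarith
  have hcpos : ∀ s, 0 < k * Real.cosh s := fun s => mul_pos hk (Real.cosh_pos s)
  set Φ₀ : ℝ → ℝ := fun s => 1 / k * Real.arcsin (k * Real.cosh s) with hΦ₀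
  have hΦc : Continuous Φ₀ :=
    continuous_const.mul (Real.continuous_arcsin.comp (continuous_const.mul Real.continuous_cosh))
  have hderiv : ∀ u ∈ Ioo 0 δ,
      HasDerivAt Φ₀ (rotationalRho (-1) K u / √(1 - rotationalRho (-1) K u ^ 2)) u := by
    intro u hu
    have hρ : rotationalRho (-1) K u = r * (Real.sinh u / Real.cosh u) := by
      rw [rotationalRho, tanE, if_neg hne, Real.tanh_eq_sinh_div_cosh, hrK]
    rw [hρ, ratio_div_sqrt _ _ (Real.cosh_pos u)]
    refine (((Real.hasDerivAt_arcsin (by linarith [hcpos u]) (hcosh' u hu).ne).comp u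
      ((Real.hasDerivAt_cosh u).const_mul k)).const_mul (1 / k)).congr_deriv ?_
    have : 1 - (k * Real.cosh u) ^ 2 = (Real.cosh u ^ 2 - (r * Real.sinh u) ^ 2) / r ^ 2 := by
      have h1 := Real.cosh_sq u
      field_simp
      rw [hr2]
      linear_combination (-Real.cosh u ^ 2) * hk2 - (K + 1) * h1
    rw [this, sqrt_div_sq hr0]
    field_simp
  have hheight : ∀ s ∈ Icc 0 δ, heightOf (rotationalRho (-1) K) 0 s = Φ₀ s - Φ₀ 0 := by
    intro s hs
    refine heightOf_eq hs.1 hΦc.continuousOn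
      (fun u hu => hderiv u ⟨hu.1, hu.2.trans_le hs.2⟩) fun u hu => ?_
    have : 0 ≤ Real.tanh u := by
      rw [Real.tanh_eq_sinh_div_cosh]
      exact div_nonneg (Real.sinh_nonneg_iff.2 hu.1.le) (Real.cosh_pos u).le
    simp only [rotationalRho, tanE, hne, if_false]
    positivity
  have hΦδ : Φ₀ δ = 1 / k * (Real.pi / 2) := by simp [hΦ₀, hcδ, hk.ne']
  refine ⟨Φ₀ δ - Φ₀ 0, ?_⟩
  rw [rotationalHypersurface_eq_of_pos hn (.inr rfl) ho hK (δ := δ) hδ.symm hδ0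
    (Φ := fun s => Φ₀ s - Φ₀ 0) (G := fun τ => 1 / k * Real.cos (k * τ))
    (J := {τ | k * τ ∈ Ioo (-(Real.pi / 2)) (Real.pi / 2)})
    ?_ hheight (hΦc.sub continuous_const).continuousOn (fun τ => by simp) ?_ ?_ ?_ ?_]
  · ext q
    simp
  · intro s hs
    rw [sinE_neg_one]
    exact (Real.sinh_pos_iff.2 hs.1).ne'
  · rintro τ ⟨h1, h2⟩
    exact ⟨by rw [mul_neg]; linarith, by rw [mul_neg]; linarith⟩
  · intro s hs
    have : k * (Φ₀ s - Φ₀ 0 - (Φ₀ δ - Φ₀ 0)) = Real.arcsin (k * Real.cosh s) - Real.pi / 2 := by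
      rw [hΦδ]; simp only [hΦ₀]; field_simp; ring
    refine ⟨?_, ?_⟩
    · rw [this, Real.cos_sub_pi_div_two,
        Real.sin_arcsin (by linarith [hcpos s]) (hcosh s hs), cosE_neg_one]
      field_simp
    · change k * (Φ₀ s - Φ₀ 0 - (Φ₀ δ - Φ₀ 0)) ∈ Ioo (-(Real.pi / 2)) (Real.pi / 2)
      rw [this]
      have h1 := Real.arcsin_pos.2 (hcpos s)
      have h2 := Real.arcsin_le_pi_div_two (k * Real.cosh s)
      exact ⟨by linarith, by linarith⟩
  · rintro τ ⟨hτ1, hτ2⟩ hτ x hx hxo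
    have hk1 : 0 < 1 / k := by positivity
    have hcτ : 0 < Real.cos (k * τ) := Real.cos_pos_of_mem_Ioo ⟨hτ1, hτ2⟩
    have h1 : 1 ≤ 1 / k * Real.cos (k * τ) := by
      have h2 := form_sub_nonneg (.inr rfl) hx o
      rw [ho.1, hxo] at h2
      have h3 : 0 < 1 / k * Real.cos (k * τ) := by positivity
      nlinarith
    have hcs := Real.cosh_arcosh h1
    refine ⟨Real.arcosh (1 / k * Real.cos (k * τ)), ⟨Real.arcosh_nonneg h1, ?_⟩, ?_, ?_⟩
    · rw [← Real.arcosh_cosh hδ0.le, hcδ,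
        Real.arcosh_le_arcosh (by linarith) hk1]
      exact mul_le_of_le_one_right hk1.le (Real.cos_le_one _)
    · rw [cosE_neg_one, hcs]
    · have : Φ₀ (Real.arcosh (1 / k * Real.cos (k * τ))) = τ + 1 / k * (Real.pi / 2) := by
        simp only [hΦ₀]
        rw [hcs, ← mul_assoc, mul_one_div_cancel hk.ne', one_mul, ← Real.sin_add_pi_div_two,
          Real.arcsin_sin (by linarith) (by nlinarith)]
        field_simp
      rw [this, hΦδ]; ring
  · convert hcl (Φ₀ δ - Φ₀ 0) using 1
    ext q
    simp

theorem rotationalHypersurface_zero (hn : 1 ≤ n) {o : Vec n} (ho : o ∈ spaceForm n (-1)) :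
    rotationalHypersurface (-1) o 0 = {q : Amb n | q.1 ∈ spaceForm n (-1) ∧
      form (-1) q.1 o = -(q.2 + 1)} := by
  have hne : (-1 : ℝ) ≠ 1 := by norm_num
  have hρ : ∀ u, rotationalRho (-1) 0 u = 1 * (Real.sinh u / Real.cosh u) := by
    intro u
    rw [rotationalRho, tanE, if_neg hne, Real.tanh_eq_sinh_div_cosh]
    norm_num
  refine rotationalHypersurface_eq_of_nonpos hn ho le_rfl (Φ := fun s => Real.cosh s - 1)
    (G := fun t => t + 1) (fun s hs => ?_) (fun s _ => by ring) fun t ht => ?_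
  · rw [heightOf_eq (Φ := Real.cosh) hs Real.continuous_cosh.continuousOn ?_ ?_, Real.cosh_zero]
    · intro u hu
      rw [hρ, ratio_div_sqrt _ _ (Real.cosh_pos u), one_mul, Real.cosh_sq, add_sub_cancel_left,
        Real.sqrt_one, div_one]
      exact Real.hasDerivAt_cosh u
    · intro u hu
      rw [hρ]
      have := Real.sinh_nonneg_iff.2 hu.1.le
      have := Real.cosh_pos u
      positivity
  · exact ⟨Real.arcosh (t + 1), Real.arcosh_nonneg ht, Real.cosh_arcosh ht,
      by simp only [Real.cosh_arcosh ht]; ring⟩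

/-- The height integral has the antiderivative `(1/k) arsinh (k cosh s)`; the shift `arsinh k` is
its contribution at `s = 0`. -/
theorem rotationalHypersurface_neg (hn : 1 ≤ n) {o : Vec n} (ho : o ∈ spaceForm n (-1))
    (hK1 : -1 < K) (hK : K < 0) {k : ℝ} (hk : 0 < k) (hk2 : k ^ 2 * (K + 1) = -K) :
    rotationalHypersurface (-1) o K = {q : Amb n | q.1 ∈ spaceForm n (-1) ∧
      form (-1) q.1 o = -(1 / k * Real.sinh (k * q.2 + Real.arsinh k))} := by
  have hne : (-1 : ℝ) ≠ 1 := by norm_num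
  set r := √(K + 1) with hr
  have hr0 : 0 < r := Real.sqrt_pos.2 (by linarith)
  have hr2 : r ^ 2 = K + 1 := Real.sq_sqrt (by linarith)
  have hρ : ∀ u, rotationalRho (-1) K u = r * (Real.sinh u / Real.cosh u) := by
    intro u
    rw [rotationalRho, tanE, if_neg hne, Real.tanh_eq_sinh_div_cosh, hr]
    ring_nf
  refine rotationalHypersurface_eq_of_nonpos hn ho hK.le
    (Φ := fun s => 1 / k * Real.arsinh (k * Real.cosh s) - 1 / k * Real.arsinh (k * Real.cosh 0))
    (G := fun t => 1 / k * Real.sinh (k * t + Real.arsinh k)) (fun s hs => ?_) (fun s _ => ?_)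
    fun t ht => ?_
  · have hderiv : ∀ u, HasDerivAt (fun s => 1 / k * Real.arsinh (k * Real.cosh s))
        (rotationalRho (-1) K u / √(1 - rotationalRho (-1) K u ^ 2)) u := by
      intro u
      rw [hρ, ratio_div_sqrt _ _ (Real.cosh_pos u)]
      refine (((Real.hasDerivAt_arsinh (k * Real.cosh u)).comp u
        ((Real.hasDerivAt_cosh u).const_mul k)).const_mul (1 / k)).congr_deriv ?_
      have : 1 + (k * Real.cosh u) ^ 2 = (Real.cosh u ^ 2 - (r * Real.sinh u) ^ 2) / r ^ 2 := by
        have h1 := Real.cosh_sq u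
        field_simp
        rw [hr2]
        linear_combination (Real.cosh u ^ 2) * hk2 - (K + 1) * h1
      rw [this, sqrt_div_sq hr0]
      field_simp
    refine heightOf_eq (Φ := fun s => 1 / k * Real.arsinh (k * Real.cosh s)) hs
      (fun u _ => (hderiv u).continuousAt.continuousWithinAt) (fun u _ => hderiv u) fun u hu => ?_
    rw [hρ]
    have := Real.sinh_nonneg_iff.2 hu.1.le
    have := Real.cosh_pos u
    positivity
  · have : k * (1 / k * Real.arsinh (k * Real.cosh s) - 1 / k * Real.arsinh (k * Real.cosh 0))
        + Real.arsinh k = Real.arsinh (k * Real.cosh s) := by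
      rw [Real.cosh_zero, mul_one]; field_simp; ring
    rw [this, Real.sinh_arsinh]
    field_simp
  · refine ⟨Real.arcosh (1 / k * Real.sinh (k * t + Real.arsinh k)), Real.arcosh_nonneg ht,
      Real.cosh_arcosh ht, ?_⟩
    rw [Real.cosh_arcosh ht, ← mul_assoc, mul_one_div_cancel hk.ne', one_mul, Real.arsinh_sinh,
      Real.cosh_zero, mul_one]
    field_simp
    ring

theorem parabolicHypersurface_eq {v : Vec n} (hv : form (-1) v v = 0) (hK1 : -1 < K)
    {k : ℝ} (hk : 0 < k) (hk2 : k ^ 2 * (K + 1) = -K) :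
    parabolicHypersurface v K = {q : Amb n | q.1 ∈ spaceForm n (-1) ∧
      form (-1) q.1 v = -Real.exp (-(k * q.2))} := by
  -- The integrand is constant, so the height is `s / k`.
  have hρ : √(K + 1) / √(1 - √(K + 1) ^ 2) = 1 / k := by
    rw [Real.sq_sqrt (by linarith)]
    have h1 : 1 - (K + 1) = k ^ 2 * (K + 1) := by linarith
    have h2 : √(K + 1) ≠ 0 := (Real.sqrt_pos.2 (by linarith)).ne'
    rw [h1, Real.sqrt_mul (sq_nonneg k), Real.sqrt_sq hk.le]
    field_simp
  have hheight : ∀ s, heightOf (fun _ => √(K + 1)) 0 s = s / k := by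
    intro s
    simp only [heightOf, hρ, intervalIntegral.integral_const, smul_eq_mul]
    ring
  ext q
  rw [parabolicHypersurface, mem_parallelGraph_horosphereData hv]
  refine and_congr_right fun hq => ?_
  constructor
  · rintro ⟨s, -, h1, h2⟩
    rw [h1, h2, hheight, mul_div_cancel₀ _ hk.ne']
  · intro h
    exact ⟨k * q.2, trivial, h, by rw [hheight]; field_simp⟩

/-- Here `sinh s₀ = 1/k`, and the height is `(1/k) arcosh (k sinh s)`. Its inverse covers the half
`t ≥ 0` of the level set, and evenness of `cosh` gives the other half as the reflection. -/
theorem hyperbolicHypersurface_eq {v : Vec n} (hv : form (-1) v v = 1) (hK1 : -1 < K) (hK : K < 0)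
    {k : ℝ} (hk : 0 < k) (hk2 : k ^ 2 * (K + 1) = -K) :
    hyperbolicHypersurface v K = {q : Amb n | q.1 ∈ spaceForm n (-1) ∧
      form (-1) q.1 v = 1 / k * Real.cosh (k * q.2)} := by
  set r := √(K + 1) with hr
  have hr0 : 0 < r := Real.sqrt_pos.2 (by linarith)
  have hr2 : r ^ 2 = K + 1 := Real.sq_sqrt (by linarith)
  have hr1 : r < 1 := by nlinarith
  set s₀ := Real.artanh r with hs₀
  have hs0 : 0 < s₀ := Real.artanh_pos ⟨hr0, hr1⟩
  have hsh : Real.sinh s₀ = 1 / k := by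
    rw [hs₀, Real.sinh_artanh ⟨by linarith, hr1⟩]
    have : 1 - r ^ 2 = (k * r) ^ 2 := by rw [mul_pow, hr2]; linarith
    rw [this, Real.sqrt_sq (by positivity)]
    field_simp
  have hsinh : ∀ s, s₀ ≤ s → 1 ≤ k * Real.sinh s := by
    intro s hs
    have := Real.sinh_le_sinh.2 hs
    rw [hsh, div_le_iff₀ hk] at this
    linarith
  have hsinh' : ∀ s, s₀ < s → 1 < k * Real.sinh s := by
    intro s hs
    have := Real.sinh_lt_sinh.2 hs
    rw [hsh, div_lt_iff₀ hk] at this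
    linarith
  set Φ : ℝ → ℝ := fun s => 1 / k * Real.arcosh (k * Real.sinh s) with hΦ
  have hheight : ∀ s, s₀ ≤ s → heightOf (hyperbolicRho K) s₀ s = Φ s := by
    intro s hs
    have h0 : Φ s₀ = 0 := by simp [hΦ, hsh, hk.ne']
    rw [heightOf_eq (Φ := Φ) hs ?_ ?_ ?_, h0, sub_zero]
    · exact continuousOn_const.mul (Real.continuousOn_arcosh.comp
        (continuous_const.mul Real.continuous_sinh).continuousOn fun u hu => hsinh u hu.1)
    · intro u hu
      have hsu : 0 < Real.sinh u := Real.sinh_pos_iff.2 (hs0.trans hu.1)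
      rw [hyperbolicRho, ratio_div_sqrt _ _ hsu]
      refine (((Real.hasDerivAt_arcosh (hsinh' u hu.1)).comp u
        ((Real.hasDerivAt_sinh u).const_mul k)).const_mul (1 / k)).congr_deriv ?_
      have : (k * Real.sinh u) ^ 2 - 1 = (Real.sinh u ^ 2 - (r * Real.cosh u) ^ 2) / r ^ 2 := by
        have h1 := Real.cosh_sq u
        field_simp
        rw [hr2]
        linear_combination (Real.sinh u ^ 2) * hk2 + (K + 1) * h1
      rw [this, sqrt_div_sq hr0, ← hr]
      field_simp
    · intro u hu
      have := Real.sinh_pos_iff.2 (hs0.trans hu.1)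
      have := Real.cosh_pos u
      unfold hyperbolicRho
      positivity
  have hΓ := mem_parallelGraph_hyperplaneData hv (φ := heightOf (hyperbolicRho K) s₀) (I := Ici s₀)
  have hkΦ : ∀ s, s₀ ≤ s → 1 / k * Real.cosh (k * Φ s) = Real.sinh s := by
    intro s hs
    have : k * Φ s = Real.arcosh (k * Real.sinh s) := by
      simp only [hΦ]; field_simp
    rw [this, Real.cosh_arcosh (hsinh s hs)]
    field_simp
  have hup : ∀ q : Amb n, q.1 ∈ spaceForm n (-1) →
      form (-1) q.1 v = 1 / k * Real.cosh (k * q.2) → 0 ≤ q.2 →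
      q ∈ parallelGraph (-1) (hyperplaneData v) (heightOf (hyperbolicRho K) s₀) (Ici s₀) := by
    intro q hq h1 h2
    have hle : s₀ ≤ Real.arsinh (1 / k * Real.cosh (k * q.2)) := by
      rw [← Real.sinh_le_sinh, Real.sinh_arsinh, hsh]
      exact le_mul_of_one_le_right (by positivity) (Real.one_le_cosh _)
    refine (hΓ q).2 ⟨hq, _, hle, by rw [Real.sinh_arsinh, h1], ?_⟩
    rw [hheight _ hle]
    simp only [hΦ]
    rw [Real.sinh_arsinh, ← mul_assoc, mul_one_div_cancel hk.ne', one_mul,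
      Real.arcosh_cosh (by positivity)]
    field_simp
  have hdown : ∀ q ∈ parallelGraph (-1) (hyperplaneData v) (heightOf (hyperbolicRho K) s₀)
      (Ici s₀), q.1 ∈ spaceForm n (-1) ∧ form (-1) q.1 v = 1 / k * Real.cosh (k * q.2) := by
    intro q hq
    obtain ⟨h1, s, hs, h2, h3⟩ := (hΓ q).1 hq
    refine ⟨h1, ?_⟩
    rw [h3, hheight s hs, hkΦ s hs, h2]
  ext q
  simp only [hyperbolicHypersurface]
  rw [← hr, ← hs₀]
  constructor
  · rintro (hq | ⟨p, hp, rfl⟩)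
    · exact hdown q hq
    · have := hdown p hp
      simpa [reflection] using this
  · rintro ⟨h1, h2⟩
    rcases le_total 0 q.2 with h | h
    · exact .inl (hup q h1 h2 h)
    · refine .inr ⟨(q.1, -q.2), hup _ h1 (by simpa using h2) (by simpa using h), ?_⟩
      simp [reflection]

end Models

/-! ### Identification of the profile hypersurfaces with the models -/

section Identification

variable {n : ℕ} {ε K : ℝ} {v : Vec n} {A B k : ℝ}

theorem profileFun_of_pos (hk : 0 < k) (t : ℝ) :
    profileFun (k ^ 2) A B t = 1 / k * (k * A * Real.cosh (k * t) + B * Real.sinh (k * t)) := by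
  have : 0 < k ^ 2 := by positivity
  simp only [profileFun, genCos, genSin, this, if_true, Real.sqrt_sq hk.le]
  field_simp

theorem profileFun_zero (t : ℝ) : profileFun 0 A B t = A + B * t := by
  simp [profileFun, genCos, genSin]

theorem profileFun_of_neg (hk : 0 < k) (t : ℝ) :
    profileFun (-k ^ 2) A B t = 1 / k * (k * A * Real.cos (k * t) + B * Real.sin (k * t)) := by
  have h1 : ¬ 0 < -k ^ 2 := by have := sq_nonneg k; linarith
  have h2 : -k ^ 2 ≠ 0 := by have := pow_pos hk 2; linarith
  simp only [profileFun, genCos, genSin, h1, h2, if_false, neg_neg, Real.sqrt_sq hk.le]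
  field_simp

theorem exists_hyperbola_param {x y : ℝ} (h : x ^ 2 - y ^ 2 = 1) :
    ∃ σ θ : ℝ, (σ = 1 ∨ σ = -1) ∧ x = σ * Real.cosh θ ∧ y = σ * Real.sinh θ := by
  have key : ∀ z w : ℝ, 0 < z → z ^ 2 - w ^ 2 = 1 → z = Real.cosh (Real.arsinh w) := by
    intro z w hz hzw
    rw [Real.cosh_arsinh, eq_comm, Real.sqrt_eq_iff_eq_sq (by positivity) hz.le]
    linarith
  rcases lt_trichotomy x 0 with hx | hx | hx
  · refine ⟨-1, Real.arsinh (-y), .inr rfl, ?_, ?_⟩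
    · have := key (-x) (-y) (by linarith) (by linarith)
      linarith
    · rw [Real.sinh_arsinh]; ring
  · rw [hx] at h
    nlinarith
  · refine ⟨1, Real.arsinh y, .inl rfl, ?_, ?_⟩
    · rw [one_mul]; exact key x y hx h
    · rw [Real.sinh_arsinh, one_mul]

theorem form_smul_sign {σ : ℝ} (hσ : σ = 1 ∨ σ = -1) (x : Vec n) (a : ℝ) :
    form ε x (σ • v) = a ↔ form ε x v = σ * a := by
  rw [form_smul_right]
  rcases hσ with rfl | rfl
  · simp
  · rw [neg_one_mul, neg_one_mul, neg_eq_iff_eq_neg]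

theorem mem_profileHypersurface_univ {l : ℝ} (q : Amb n) :
    q ∈ profileHypersurface ε l v A B univ ↔
      q.1 ∈ spaceForm n ε ∧ form ε q.1 v = profileFun l A B q.2 := by
  simp [profileHypersurface]

/-- The constraint is the hyperbola `(kA)² - B² = 1`, so the profile is `(σ/k) cosh (k t + θ)`. The
phase `θ` is a vertical translation, and the sign `σ` replaces the centre by its antipode. -/
theorem isModel_sphere (hn : 1 ≤ n) (hv : v ∈ spaceForm n 1) (hK : 1 < K)
    (hAB : profileConst 1 K * A ^ 2 - B ^ 2 = 1) :
    IsModel 1 K (profileHypersurface 1 (profileConst 1 K) v A B univ) := by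
  have hl : 0 < profileConst 1 K := by
    have : 0 < K - 1 := by linarith
    unfold profileConst
    positivity
  obtain ⟨k, hk, hkl⟩ : ∃ k : ℝ, 0 < k ∧ profileConst 1 K = k ^ 2 :=
    ⟨√(profileConst 1 K), Real.sqrt_pos.2 hl, (Real.sq_sqrt hl.le).symm⟩
  have hk2 : k ^ 2 * (K - 1) = K := by
    have : K - 1 ≠ 0 := by linarith
    rw [← hkl, profileConst]
    field_simp
  rw [hkl] at hAB ⊢
  obtain ⟨σ, θ, hσ, h1, h2⟩ := exists_hyperbola_param (x := k * A) (y := B) (by linarith)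
  have hσv : σ • v ∈ spaceForm n 1 := by
    refine ⟨?_, fun h => by norm_num at h⟩
    rw [form_smul_left, form_smul_right, hv.1]
    rcases hσ with rfl | rfl <;> norm_num
  obtain ⟨b, hb⟩ := rotationalHypersurface_one hn hσv hK hk hk2
  refine .inr (.inl ⟨hK, σ • v, hσv, 1, -b - θ / k, .inl rfl, ?_⟩)
  ext q
  have : k * (1 * (q.2 - (-b - θ / k)) - b) = k * q.2 + θ := by field_simp; ring
  rw [mem_verticalMotion_image (.inl rfl), hb, mem_profileHypersurface_univ, mem_ofPred_eq, this,
    form_smul_sign hσ, profileFun_of_pos hk, h1, h2, Real.cosh_add]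
  ring_nf

theorem profileConst_neg_one (hK : -1 < K) : profileConst (-1) K * (K + 1) = -K := by
  have : K + 1 ≠ 0 := by linarith
  unfold profileConst
  rw [sub_neg_eq_add]
  field_simp

theorem exists_profileConst_eq_sq (hK1 : -1 < K) (hK : K < 0) :
    ∃ k : ℝ, 0 < k ∧ profileConst (-1) K = k ^ 2 ∧ k ^ 2 * (K + 1) = -K := by
  have h1 := profileConst_neg_one hK1
  have hl : 0 < profileConst (-1) K := by
    by_contra! h
    nlinarith
  exact ⟨√(profileConst (-1) K), Real.sqrt_pos.2 hl, (Real.sq_sqrt hl.le).symm,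
    by rw [Real.sq_sqrt hl.le, h1]⟩

/-- The profile is `(σ/k) sinh (k t + θ)`. As `-v` is not in `ℍ^n`, the sign is absorbed by a
reflection of the height, `sinh` being odd. -/
theorem isModel_rotational_of_neg (hn : 1 ≤ n) (hv : v ∈ spaceForm n (-1)) (hK1 : -1 < K)
    (hK : K < 0) (hAB : profileConst (-1) K * A ^ 2 - B ^ 2 = -1) :
    IsModel (-1) K (profileHypersurface (-1) (profileConst (-1) K) v A B univ) := by
  obtain ⟨k, hk, hkl, hk2⟩ := exists_profileConst_eq_sq hK1 hK
  rw [hkl] at hAB ⊢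
  obtain ⟨σ, θ, hσ, h1, h2⟩ := exists_hyperbola_param (x := B) (y := k * A) (by linarith)
  refine .inr (.inl ⟨hK1, v, hv, -σ, -(θ + σ * Real.arsinh k) / k, ?_, ?_⟩)
  · rcases hσ with rfl | rfl <;> simp
  ext q
  have hσ' : -σ = 1 ∨ -σ = -1 := by rcases hσ with rfl | rfl <;> simp
  rw [mem_verticalMotion_image hσ', rotationalHypersurface_neg hn hv hK1 hK hk hk2,
    mem_profileHypersurface_univ, mem_ofPred_eq, profileFun_of_pos hk, h1, h2]
  have h3 : -(1 / k * Real.sinh (k * (-σ * (q.2 - -(θ + σ * Real.arsinh k) / k)) + Real.arsinh k))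
      = 1 / k * (σ * Real.sinh (k * q.2 + θ)) := by
    rcases hσ with rfl | rfl
    · have : k * (-1 * (q.2 - -(θ + 1 * Real.arsinh k) / k)) + Real.arsinh k
          = -(k * q.2 + θ) := by field_simp; ring
      rw [this, Real.sinh_neg]; ring
    · have : k * (- -1 * (q.2 - -(θ + -1 * Real.arsinh k) / k)) + Real.arsinh k
          = k * q.2 + θ := by field_simp; ring
      rw [this]; ring
  rw [h3, Real.sinh_add]
  ring_nf

theorem isModel_rotational_zero (hn : 1 ≤ n) (hv : v ∈ spaceForm n (-1)) (hB : B ^ 2 = 1) :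
    IsModel (-1) 0 (profileHypersurface (-1) 0 v A B univ) := by
  have hB' : -B = 1 ∨ -B = -1 := by
    rcases sq_eq_sq_iff_eq_or_eq_neg.1 (hB.trans (one_pow 2).symm) with h | h <;> simp [h]
  refine .inr (.inl ⟨by norm_num, v, hv, -B, -B * (A + 1), hB', ?_⟩)
  ext q
  have : -(-B * (q.2 - -B * (A + 1)) + 1) = A + B * q.2 := by
    linear_combination (A + 1) * hB
  rw [mem_verticalMotion_image hB', rotationalHypersurface_zero hn hv,
    mem_profileHypersurface_univ, mem_ofPred_eq, profileFun_zero, this]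

/-- The constraint degenerates to `B = ±kA`, so the profile is the exponential `A exp (±k t)`. The
factor `-A > 0` becomes a vertical translation by means of its logarithm. -/
theorem isModel_parabolic (hv : form (-1) v v = 0) (hv0 : 0 < v 0) (hK1 : -1 < K) (hK : K < 0)
    (hAB : profileConst (-1) K * A ^ 2 - B ^ 2 = 0) (hA : A < 0) :
    IsModel (-1) K (profileHypersurface (-1) (profileConst (-1) K) v A B univ) := by
  obtain ⟨k, hk, hkl, hk2⟩ := exists_profileConst_eq_sq hK1 hK
  rw [hkl] at hAB ⊢
  obtain ⟨σ, hσ, hB⟩ : ∃ σ : ℝ, (σ = 1 ∨ σ = -1) ∧ B = σ * (k * A) := by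
    rcases sq_eq_sq_iff_eq_or_eq_neg.1 (show B ^ 2 = (k * A) ^ 2 by linarith) with h | h
    · exact ⟨1, .inl rfl, by rw [h, one_mul]⟩
    · exact ⟨-1, .inr rfl, by rw [h, neg_one_mul]⟩
  have hσ' : -σ = 1 ∨ -σ = -1 := by rcases hσ with rfl | rfl <;> simp
  refine .inr (.inr (.inl ⟨rfl, hK1, hK, v, hv, hv0, -σ, -σ * Real.log (-A) / k, hσ', ?_⟩))
  ext q
  rw [mem_verticalMotion_image hσ', parabolicHypersurface_eq hv hK1 hk hk2,
    mem_profileHypersurface_univ, mem_ofPred_eq, profileFun_of_pos hk, hB]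
  have h3 : Real.exp (-(k * (-σ * (q.2 - -σ * Real.log (-A) / k))))
      = Real.exp (σ * (k * q.2)) * -A := by
    have h4 : -(k * (-σ * (q.2 - -σ * Real.log (-A) / k))) = σ * (k * q.2) + Real.log (-A) := by
      rcases hσ with rfl | rfl <;> field_simp <;> ring
    rw [h4, Real.exp_add, Real.exp_log (by linarith)]
  have h5 : Real.exp (σ * (k * q.2)) = Real.cosh (k * q.2) + σ * Real.sinh (k * q.2) := by
    rcases hσ with rfl | rfl
    · rw [one_mul, one_mul, Real.cosh_add_sinh]
    · rw [neg_one_mul, neg_one_mul, ← sub_eq_add_neg, Real.cosh_sub_sinh]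
  have h6 : 1 / k * (k * A * Real.cosh (k * q.2) + σ * (k * A) * Real.sinh (k * q.2))
      = A * (Real.cosh (k * q.2) + σ * Real.sinh (k * q.2)) := by
    field_simp
  rw [h3, h5, h6]
  ring_nf

theorem isModel_cylinder (hv : form (-1) v v = 0) (hv0 : 0 < v 0) (hA : A < 0) :
    IsModel (-1) 0 (profileHypersurface (-1) 0 v A 0 univ) := by
  have hA' : 0 < (-A)⁻¹ := inv_pos.2 (by linarith)
  -- Rescaling the null vector normalizes the level `A` of the horosphere to `-1`.
  refine .inr (.inr (.inr (.inr ⟨rfl, rfl, (-A)⁻¹ • v, ?_, ?_, ?_⟩)))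
  · rw [form_smul_left, form_smul_right, hv, mul_zero, mul_zero]
  · exact mul_pos hA' hv0
  · ext q
    rw [mem_profileHypersurface_univ, profileFun_zero, horosphereCylinder, mem_prod]
    simp only [mem_ofPred_eq, mem_univ, and_true, zero_mul, add_zero, form_smul_right]
    refine and_congr_right fun _ => ?_
    rw [inv_mul_eq_iff_eq_mul₀ (by linarith)]
    simp

theorem isModel_hyperbolic (hv : form (-1) v v = 1) (hK1 : -1 < K) (hK : K < 0)
    (hAB : profileConst (-1) K * A ^ 2 - B ^ 2 = 1) :
    IsModel (-1) K (profileHypersurface (-1) (profileConst (-1) K) v A B univ) := by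
  obtain ⟨k, hk, hkl, hk2⟩ := exists_profileConst_eq_sq hK1 hK
  rw [hkl] at hAB ⊢
  obtain ⟨σ, θ, hσ, h1, h2⟩ := exists_hyperbola_param (x := k * A) (y := B) (by linarith)
  have hσv : form (-1) (σ • v) (σ • v) = 1 := by
    rw [form_smul_left, form_smul_right, hv]
    rcases hσ with rfl | rfl <;> norm_num
  refine .inr (.inr (.inr (.inl ⟨rfl, hK1, hK, σ • v, hσv, 1, -θ / k, .inl rfl, ?_⟩)))
  ext q
  have : k * (1 * (q.2 - -θ / k)) = k * q.2 + θ := by field_simp; ring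
  rw [mem_verticalMotion_image (.inl rfl), hyperbolicHypersurface_eq hσv hK1 hK hk hk2,
    mem_profileHypersurface_univ, mem_ofPred_eq, this, form_smul_sign hσ, profileFun_of_pos hk,
    h1, h2, Real.cosh_add]
  ring_nf

/-- The open interval may be replaced by the closed one: at its end points the cosine vanishes,
while `⟨x, o⟩ < 0`. -/
theorem isClosed_cosine_band {o : Vec n} (ho : o ∈ spaceForm n (-1)) (k b : ℝ) :
    IsClosed {q : Amb n | q.1 ∈ spaceForm n (-1) ∧
      form (-1) q.1 o = -(1 / k * Real.cos (k * (q.2 - b))) ∧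
      k * (q.2 - b) ∈ Ioo (-(Real.pi / 2)) (Real.pi / 2)} := by
  have h1 : IsClosed {q : Amb n | q.1 ∈ spaceForm n (-1)} :=
    (isClosed_spaceForm (.inr rfl)).preimage continuous_fst
  have h2 : IsClosed {q : Amb n | form (-1) q.1 o = -(1 / k * Real.cos (k * (q.2 - b)))} :=
    isClosed_eq (((formL n (-1)).continuous.comp continuous_fst).clm_apply continuous_const)
      (by fun_prop)
  have h3 : IsClosed {q : Amb n | k * (q.2 - b) ∈ Icc (-(Real.pi / 2)) (Real.pi / 2)} :=
    isClosed_Icc.preimage (by fun_prop)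
  convert h1.inter (h2.inter h3) using 1
  ext q
  refine and_congr_right fun hq => and_congr_right fun hqo => ?_
  refine ⟨fun h => Ioo_subset_Icc_self h, fun h => ?_⟩
  have hneg := form_neg_of_causal hq (y := o) (by rw [ho.1]; norm_num) (ho.2 rfl)
  have hcos : Real.cos (k * (q.2 - b)) ≠ 0 := by
    intro h0
    rw [hqo, h0] at hneg
    simp at hneg
  refine ⟨lt_of_le_of_ne h.1 fun h0 => hcos ?_, lt_of_le_of_ne h.2 fun h0 => hcos ?_⟩
  · rw [← h0, Real.cos_neg, Real.cos_pi_div_two]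
  · rw [h0, Real.cos_pi_div_two]

theorem exists_cosine_param {t₀ : ℝ} (hk : 0 < k) (hAB : (k * A) ^ 2 + B ^ 2 = 1)
    (h₀ : profileFun (-k ^ 2) A B t₀ < 0) : ∃ b : ℝ,
    (∀ t, profileFun (-k ^ 2) A B t = -(1 / k * Real.cos (k * (t - b)))) ∧
      k * (t₀ - b) ∈ Ioo (-(Real.pi / 2)) (Real.pi / 2) := by
  rw [profileFun_of_neg hk] at h₀
  have hcs := Real.sin_sq_add_cos_sq (k * t₀)
  set c := Real.cos (k * t₀) with hc
  set s := Real.sin (k * t₀) with hs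
  have hu : 0 < -(k * A * c + B * s) := by
    have : 0 < 1 / k := by positivity
    by_contra! h
    nlinarith
  have hw : (-(k * A * c + B * s)) ^ 2 + (B * c - k * A * s) ^ 2 = 1 := by
    linear_combination ((k * A) ^ 2 + B ^ 2) * hcs + hAB
  set w := B * c - k * A * s with hwd
  have hw1 : w ^ 2 < 1 := by nlinarith
  have hw2 : w ∈ Ioo (-1 : ℝ) 1 := abs_lt.1 (by rwa [← sq_lt_one_iff_abs_lt_one])
  have hcos : Real.cos (Real.arcsin w) = -(k * A * c + B * s) := by
    rw [Real.cos_arcsin, Real.sqrt_eq_iff_eq_sq (by linarith) hu.le]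
    linarith
  have hsin : Real.sin (Real.arcsin w) = w := Real.sin_arcsin hw2.1.le hw2.2.le
  -- The numbers `-(k A c + B s) > 0` and `w` are the cosine and sine of the phase at `t₀`. A
  -- positive cosine means that `arcsin w` is this phase, so `t₀` lies in the central half period.
  refine ⟨t₀ - Real.arcsin w / k, fun t => ?_, ?_⟩
  · have h1 : k * (t - (t₀ - Real.arcsin w / k)) = k * t - k * t₀ + Real.arcsin w := by
      field_simp; ring
    rw [profileFun_of_neg hk, h1, Real.cos_add, Real.cos_sub, Real.sin_sub, hcos, hsin, ← hc, ← hs,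
      hwd]
    linear_combination (-(1 / k) * (k * A * Real.cos (k * t) + B * Real.sin (k * t))) * hcs
  · have h1 : k * (t₀ - (t₀ - Real.arcsin w / k)) = Real.arcsin w := by field_simp; ring
    rw [h1]
    exact ⟨Real.neg_pi_div_two_lt_arcsin.2 hw2.1, Real.arcsin_lt_pi_div_two.2 hw2.2⟩

theorem Continuous.forall_mem_Ioo {S : Type*} [TopologicalSpace S] [PreconnectedSpace S]
    {g : S → ℝ} (hg : Continuous g) {a b : ℝ} {p₀ : S} (h₀ : g p₀ ∈ Ioo a b)
    (ha : ∀ p, g p ≠ a) (hb : ∀ p, g p ≠ b) (p : S) : g p ∈ Ioo a b := by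
  constructor
  · by_contra! h
    obtain ⟨r, hr⟩ := mem_range_of_exists_le_of_exists_ge hg ⟨p, h⟩ ⟨p₀, h₀.1.le⟩
    exact ha r hr
  · by_contra! h
    obtain ⟨r, hr⟩ := mem_range_of_exists_le_of_exists_ge hg ⟨p₀, h₀.2.le⟩ ⟨p, h⟩
    exact hb r hr

/-- The level set of a cosine splits into one sphere for each period. Since `⟨x, v⟩ < 0`, the cosine
has no zero along `f`, and a connected `S` stays in a single half period; `J` is that interval. -/
theorem exists_isModel_sphere_of_hyperbolic {S : Type*} [TopologicalSpace S] [ConnectedSpace S]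
    {f : S → Amb n} (hf : Continuous f) (hn : 1 ≤ n) (hv : v ∈ spaceForm n (-1)) (hK : 0 < K)
    (hAB : profileConst (-1) K * A ^ 2 - B ^ 2 = -1)
    (hfP : ∀ p, f p ∈ profileHypersurface (-1) (profileConst (-1) K) v A B univ) :
    ∃ J : Set ℝ, IsOpen J ∧
      IsClosed (profileHypersurface (-1) (profileConst (-1) K) v A B J) ∧
      IsModel (-1) K (profileHypersurface (-1) (profileConst (-1) K) v A B J) ∧
      ∀ p, f p ∈ profileHypersurface (-1) (profileConst (-1) K) v A B J := by
  have hlK := profileConst_neg_one (K := K) (by linarith)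
  have hl : profileConst (-1) K < 0 := by
    by_contra! h
    nlinarith
  obtain ⟨k, hk, hkl⟩ : ∃ k : ℝ, 0 < k ∧ profileConst (-1) K = -k ^ 2 :=
    ⟨√(-profileConst (-1) K), Real.sqrt_pos.2 (by linarith), by
      rw [Real.sq_sqrt (by linarith), neg_neg]⟩
  have hk2 : k ^ 2 * (K + 1) = K := by rw [hkl] at hlK; linarith
  rw [hkl] at hAB hfP ⊢
  have hneg : ∀ p, profileFun (-k ^ 2) A B (f p).2 < 0 := by
    intro p
    have h1 := (mem_profileHypersurface_univ _).1 (hfP p)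
    rw [← h1.2]
    exact form_neg_of_causal h1.1 (by rw [hv.1]; norm_num) (hv.2 rfl)
  obtain ⟨p₀⟩ : Nonempty S := inferInstance
  obtain ⟨c, hc, hc₀⟩ := exists_cosine_param hk (by linarith) (hneg p₀)
  have heq : profileHypersurface (-1) (-k ^ 2) v A B
      {t | k * (t - c) ∈ Ioo (-(Real.pi / 2)) (Real.pi / 2)} =
      {q : Amb n | q.1 ∈ spaceForm n (-1) ∧
        form (-1) q.1 v = -(1 / k * Real.cos (k * (q.2 - c))) ∧
        k * (q.2 - c) ∈ Ioo (-(Real.pi / 2)) (Real.pi / 2)} := by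
    ext q
    simp only [profileHypersurface, hc, mem_ofPred_eq]
  have hcos : ∀ p, Real.cos (k * ((f p).2 - c)) ≠ 0 := by
    intro p h0
    have := hneg p
    rw [hc, h0] at this
    simp at this
  have hmem := Continuous.forall_mem_Ioo
    (show Continuous fun p => k * ((f p).2 - c) from
      continuous_const.mul ((continuous_snd.comp hf).sub continuous_const)) hc₀
    (fun p h => hcos p (by rw [h, Real.cos_neg, Real.cos_pi_div_two]))
    (fun p h => hcos p (by rw [h, Real.cos_pi_div_two]))
  refine ⟨{t | k * (t - c) ∈ Ioo (-(Real.pi / 2)) (Real.pi / 2)},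
    isOpen_Ioo.preimage (by fun_prop), ?_, ?_, fun p => ⟨(hfP p).1, (hfP p).2.1, hmem p⟩⟩
  · rw [heq]
    exact isClosed_cosine_band hv k c
  · obtain ⟨b, hb⟩ := rotationalHypersurface_neg_one_of_pos hn hv hK hk hk2
      (isClosed_cosine_band hv k)
    refine .inr (.inl ⟨by linarith, v, hv, 1, c - b, .inl rfl, ?_⟩)
    ext q
    have : 1 * (q.2 - (c - b)) - b = q.2 - c := by ring
    rw [mem_verticalMotion_image (.inl rfl), hb, heq]
    simp only [mem_ofPred_eq, this]

/-- The constraint `l A² - B² = ⟨v, v⟩` decides which cases occur. For `ε = -1` the sign of `l` is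
opposite to that of `K`. A null `v` with `K > 0` gives `A = B = 0`, against `⟨x, v⟩ < 0`; a
spacelike `v` with `K ≥ 0` makes the left side nonpositive. -/
theorem exists_isModel {S : Type*} [TopologicalSpace S] [ConnectedSpace S]
    {f : S → Amb n} (hf : Continuous f) (hn : 1 ≤ n) (hε : ε = 1 ∨ ε = -1) (hv : IsAxis ε v)
    (hK : ε < K) (hAB : profileConst ε K * A ^ 2 - B ^ 2 = form ε v v)
    (hfP : ∀ p, f p ∈ profileHypersurface ε (profileConst ε K) v A B univ) :
    ∃ J : Set ℝ, IsOpen J ∧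
      IsClosed (profileHypersurface ε (profileConst ε K) v A B J) ∧
      IsModel ε K (profileHypersurface ε (profileConst ε K) v A B J) ∧
      ∀ p, f p ∈ profileHypersurface ε (profileConst ε K) v A B J := by
  have huniv : IsModel ε K (profileHypersurface ε (profileConst ε K) v A B univ) →
      ∃ J : Set ℝ, IsOpen J ∧
        IsClosed (profileHypersurface ε (profileConst ε K) v A B J) ∧
        IsModel ε K (profileHypersurface ε (profileConst ε K) v A B J) ∧
        ∀ p, f p ∈ profileHypersurface ε (profileConst ε K) v A B J := fun h =>
    ⟨univ, isOpen_univ, isClosed_profileHypersurface_univ hε _, h, hfP⟩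
  obtain ⟨p₀⟩ : Nonempty S := inferInstance
  have hp₀ := (mem_profileHypersurface_univ _).1 (hfP p₀)
  rcases hv with hv | ⟨rfl, hv, hv0⟩ | ⟨rfl, hv⟩
  · rw [hv.1] at hAB
    rcases hε with rfl | rfl
    · exact huniv (isModel_sphere hn hv hK hAB)
    · rcases lt_trichotomy K 0 with hK0 | rfl | hK0
      · exact huniv (isModel_rotational_of_neg hn hv hK hK0 hAB)
      · have hl : profileConst (-1) 0 = 0 := by simp [profileConst]
        rw [hl] at hAB huniv ⊢
        exact huniv (isModel_rotational_zero hn hv (by linarith))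
      · exact exists_isModel_sphere_of_hyperbolic hf hn hv hK0 hAB hfP
  · rw [hv] at hAB
    have hneg := form_neg_of_causal hp₀.1 (y := v) hv.le hv0
    rw [hp₀.2] at hneg
    have hlK := profileConst_neg_one hK
    rcases lt_trichotomy K 0 with hK0 | rfl | hK0
    · refine huniv (isModel_parabolic hv hv0 hK hK0 hAB ?_)
      obtain ⟨k, hk, hkl, -⟩ := exists_profileConst_eq_sq hK hK0
      rw [hkl] at hAB hneg
      rw [profileFun_of_pos hk] at hneg
      -- Because `B² = (kA)²`, the hyperbolic cosine term dominates. The profile is negative at one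
      -- point of the hypersurface, so `A < 0`.
      have h1 : |B * Real.sinh (k * (f p₀).2)| ≤ |k * A * Real.cosh (k * (f p₀).2)| := by
        rw [← sq_le_sq, mul_pow, mul_pow, Real.cosh_sq]
        nlinarith [sq_nonneg B]
      by_contra! hA
      have h2 : 0 ≤ k * A * Real.cosh (k * (f p₀).2) :=
        mul_nonneg (mul_nonneg hk.le hA) (Real.cosh_pos _).le
      rw [abs_of_nonneg h2] at h1
      have h3 := (abs_le.1 h1).1
      have : 0 ≤ 1 / k * (k * A * Real.cosh (k * (f p₀).2) + B * Real.sinh (k * (f p₀).2)) :=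
        mul_nonneg (by positivity) (by linarith)
      linarith
    · have hl : profileConst (-1) 0 = 0 := by simp [profileConst]
      rw [hl] at hAB huniv hneg ⊢
      obtain rfl : B = 0 := by nlinarith
      rw [profileFun_zero, zero_mul, add_zero] at hneg
      exact huniv (isModel_cylinder hv hv0 hneg)
    · have hl : profileConst (-1) K < 0 := by
        by_contra! h
        nlinarith
      have hB : B = 0 := by nlinarith [sq_nonneg A, sq_nonneg B]
      have hA : A = 0 := by
        rw [hB] at hAB
        have : profileConst (-1) K * A ^ 2 = 0 := by linarith
        simpa [hl.ne] using this
      simp [hA, hB, profileFun] at hneg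
  · rw [hv] at hAB
    have hlK := profileConst_neg_one hK
    refine huniv (isModel_hyperbolic hv hK ?_ hAB)
    by_contra! hK0
    have hl : profileConst (-1) K ≤ 0 := by
      by_contra! h
      nlinarith
    nlinarith [sq_nonneg A, sq_nonneg B, mul_nonneg (neg_nonneg.2 hl) (sq_nonneg A)]

end Identification

end ProductHypersurface

end

theorem mainTheorem10 (n : ℕ) (hn : 3 ≤ n) (ε : ℝ) (hε : ε = 1 ∨ ε = -1) {S : Type*}
    [TopologicalSpace S] [T2Space S] [SecondCountableTopology S] [ConnectedSpace S]
    [ChartedSpace (ProductHypersurface.Coord n) S] [IsManifold (𝓡 n) ∞ S]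
    (f : S → ProductHypersurface.Amb n) (hf : ProductHypersurface.IsHypersurface ε f)
    (hsym : ProductHypersurface.IsSymmetric ε f) (K : ℝ)
    (hK : ProductHypersurface.HasConstantSectionalCurvature ε f K) :
    ε ≤ K ∧ ∃ P : Set (ProductHypersurface.Amb n),
      ProductHypersurface.IsModel ε K P ∧
      ProductHypersurface.IsProperlyEmbeddedHypersurface ε P ∧
      ProductHypersurface.SubsetHasConstantSectionalCurvature ε P K ∧
      ∃ O : Set (ProductHypersurface.Amb n), IsOpen O ∧ range f = P ∩ O := by
  obtain ⟨v, hv, hsym⟩ := hsym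
  have hle := ProductHypersurface.le_of_hasConstantSectionalCurvature hn hε hf hv hsym hK
  refine ⟨hle, ?_⟩
  rcases eq_or_lt_of_le hle with rfl | hlt
  · obtain ⟨h, hh⟩ := ProductHypersurface.exists_height_const hn hε hf hv hsym hK
    have hP := ProductHypersurface.isProperlyEmbedded_horizontalHyperplane (n := n) hε h
    exact ⟨_, .inl ⟨rfl, h, rfl⟩, hP, ProductHypersurface.horizontalHyperplane_hasCurvature hε h,
      ProductHypersurface.exists_isOpen_range_eq hε hf hP fun p => ⟨(hf.mem p).1, hh p⟩⟩
  · obtain ⟨A, B, hAB, hprof⟩ :=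
      ProductHypersurface.exists_profile hn hε hf hv hsym hK hlt
    obtain ⟨J, hJ, hcl, hmodel, hmem⟩ := ProductHypersurface.exists_isModel hf.smooth.continuous
      (by omega) hε hv hlt hAB fun p => ⟨(hf.mem p).1, hprof p, trivial⟩
    have hP := ProductHypersurface.isProperlyEmbedded_profileHypersurface hε hv hlt hAB hJ hcl
    exact ⟨_, hmodel, hP, ProductHypersurface.profileHypersurface_hasCurvature hε hv hlt hAB,
      ProductHypersurface.exists_isOpen_range_eq hε hf hP hmem⟩
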